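/- Work in $\mathbb{CP}^d$ with homogeneous coordinates $[x_0,\dots,x_d]$, identify the affine part $x_0\ne 0$ with $\mathbb{C}^d$, and write $\overline{S}$ for the Zariski closure of $S$. A curve is a nonempty, reduced, not necessarily irreducible projective variety of pure dimension $1$; it is real if each of its irreducible components contains infinitely many real points. Let $\Sigma_\infty$ be the set $x_0=0,\ x_1^2+\dots+x_d^2=0$. The multiplicity with which a curve contains a point $p\in\Sigma_\infty$ is its least intersection multiplicity at $p$ with the projective closure of a hypersphere $\sum_{i=1}^d (x_i-c_i)^2=\rho$ ($c\in\mathbb{C}^d$, $\rho\in\mathbb{C}\setminus\{0\}$), i.e. the one with a general hypersphere. A curve in $\mathbb{CP}^d$ is $\ell$-spherical if it is real and contains exactly $\ell$ pairs of complex conjugate points, counted with this multiplicity, on $\Sigma_\infty$; if moreover it has degree $e$, its spherical degree is $e-\ell$. The multiplicity of a point $p$ on a curve is the least intersection multiplicity at $p$ of the curve with a hyperplane through $p$ (it is $0$ if $p$ is not on the curve); a double point is a point of multiplicity $2$. In $\mathbb{CP}^{d+1}$ let $\overline{\mathbb{S}^d}$ be the quadric $x_0^2=x_1^2+\dots+x_{d+1}^2$,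 $N=[1,0,\dots,0,1]$, $\Pi_N$ the hyperplane $x_{d+1}=x_0$, $\rho$ the reflection that changes the sign of $x_{d+1}$, and $\pi:\overline{\mathbb{S}^d}\setminus\{N\}\to\mathbb{CP}^d$ the stereographic projection $\pi([y_0,\dots,y_{d+1}])=[y_0-y_{d+1},y_1,\dots,y_d]$. For $r\in\mathbb{C}^d$ let $\tau_r$ be the translation $x\mapsto x+r$, and let $\iota_r=\tau_r\circ\pi\circ\rho\circ\pi^{-1}\circ\tau_{-r}$, that is, $\iota_r(x)=r+\dfrac{x-r}{\sum_i (x_i-r_i)^2}$ (the points $x\ne r$ of $\mathbb{C}^d$ with $\sum_i(x_i-r_i)^2=0$ being mapped to $\Sigma_\infty$). The inverse of a curve $\delta$ in $r$ is $\overline{\iota_r((\delta\cap\mathbb{C}^d)\setminus\{r\})}$. Let $d,k\ge 0$ be integers. (a) Let $\delta\subset\mathbb{CP}^d$ be a real curve of spherical degree $k\ge 1$. Then $\overline{\pi^{-1}(\delta\setminus\Sigma_\infty)}$ is a real curve of degree $2k$ that is contained in $\overline{\mathbb{S}^d}$ and meets $\Pi_N$ in finitely many points. (b) Let $\delta'\subset\overline{\mathbb{S}^d}$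 be a real curve of degree $2k$ that meets $\Pi_N$ in finitely many points, and let $m\ge 0$ be the multiplicity of $\rho^{-1}(N)=[1,0,\dots,0,-1]$ on $\delta'$. Then $m\le k$, and $\overline{\pi(\rho(\delta')\setminus\{N\})}$ is a $(k-m)$-spherical curve of degree $2k-m$; in particular, its spherical degree is $k$. (c) Let $\delta\subset\mathbb{CP}^d$ be a real curve of spherical degree $k+1$ and let $r\in\mathbb{R}^d$. Then the inverse of $\delta$ in $r$ is a real curve of spherical degree $k+1$. If $r\notin\delta$, it is a $(k+1)$-spherical curve of degree $2k+2$. If $r$ is a smooth point of $\delta$, it is a $k$-spherical curve of degree $2k+1$. If $r$ is a double point of $\delta$, then $k\ge 1$ and it is a $(k-1)$-spherical curve of degree $2k$. -/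

import Mathlib

open scoped LinearAlgebra.Projectivization

noncomputable section

namespace SphericalCurve

/-- Complex projective `n`-space, with homogeneous coordinates `x₀, …, xₙ`. -/
def CP (n : ℕ) : Type := ℙ ℂ (Fin (n + 1) → ℂ)

/-- The vector `v` is a vector of homogeneous coordinates of the point `p`. -/
def CP.HasCoords {n : ℕ} (p : CP n) (v : Fin (n + 1) → ℂ) : Prop :=
  ∃ hv : v ≠ 0, Projectivization.mk ℂ v hv = p

/-- A chosen vector of homogeneous coordinates of `p`. -/
def CP.rep {n : ℕ} (p : CP n) : Fin (n + 1) → ℂ := Projectivization.rep p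

theorem CP.rep_ne_zero {n : ℕ} (p : CP n) : p.rep ≠ 0 := Projectivization.rep_nonzero p

/-- The point with homogeneous coordinates `v`. -/
def CP.mk {n : ℕ} (v : Fin (n + 1) → ℂ) (hv : v ≠ 0) : CP n := Projectivization.mk ℂ v hv

/-- The Zariski topology: its basic open sets are the complements of the projective
hypersurfaces. -/
instance (n : ℕ) : TopologicalSpace (CP n) :=
  TopologicalSpace.generateFrom
    {U | ∃ (e : ℕ) (f : MvPolynomial (Fin (n + 1)) ℂ), f.IsHomogeneous e ∧
      U = {p : CP n | MvPolynomial.eval p.rep f ≠ 0}}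

/-- The homogeneous ideal `I(X)`: the polynomials that vanish on the affine cone over `X`. -/
def idealOf {n : ℕ} (X : Set (CP n)) : Ideal (MvPolynomial (Fin (n + 1)) ℂ) :=
  MvPolynomial.vanishingIdeal ℂ {v : Fin (n + 1) → ℂ | ∃ p ∈ X, p.HasCoords v}

/-! ### Curves -/

/-- The irreducible components of a set. -/
def components {n : ℕ} (X : Set (CP n)) : Set (Set (CP n)) :=
  {Z | Maximal (fun W : Set (CP n) => IsIrreducible W ∧ W ⊆ X) Z}

/-- A (reduced, not necessarily irreducible) projective curve: a nonempty Zariski closed set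
all of whose irreducible components have dimension one. -/
structure IsCurve {n : ℕ} (X : Set (CP n)) : Prop where
  isClosed : IsClosed X
  nonempty : X.Nonempty
  dim_eq_one : ∀ Z ∈ components X, topologicalKrullDim Z = 1

/-- The points of real projective space. -/
def realPoints (n : ℕ) : Set (CP n) :=
  {p | ∃ w : Fin (n + 1) → ℝ, p.HasCoords (fun i => (w i : ℂ))}

/-- A real curve: every irreducible component has infinitely many real points. -/
structure IsRealCurve {n : ℕ} (X : Set (CP n)) : Prop extends IsCurve X where
  infinite_real : ∀ Z ∈ components X, (Z ∩ realPoints n).Infinite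

/-- The Hilbert function `t ↦ dim (S / I(X))ₜ` of `X`. -/
def hilbertFunction {n : ℕ} (X : Set (CP n)) (t : ℕ) : ℕ :=
  Module.finrank ℂ
    (MvPolynomial.homogeneousSubmodule (Fin (n + 1)) ℂ t ⧸
      ((idealOf X).restrictScalars ℂ).comap
        (MvPolynomial.homogeneousSubmodule (Fin (n + 1)) ℂ t).subtype)

/-- The curve `X` has degree `e`: its Hilbert polynomial is `e t + c` for some constant `c`. -/
def HasDegree {n : ℕ} (X : Set (CP n)) (e : ℕ) : Prop :=
  ∃ c : ℤ, ∀ᶠ t : ℕ in Filter.atTop, (hilbertFunction X t : ℤ) = e * t + c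

/-! ### Multiplicities -/

/-- The homogeneous prime ideal of a point `p`, that is, the polynomials vanishing on the line
in `ℂⁿ⁺¹` spanned by the coordinates of `p`. -/
def pointIdeal {n : ℕ} (p : CP n) : Ideal (MvPolynomial (Fin (n + 1)) ℂ) :=
  RingHom.ker (MvPolynomial.aeval
    (fun i => Polynomial.C (p.rep i) * Polynomial.X : Fin (n + 1) → Polynomial ℂ))

instance {n : ℕ} (p : CP n) : (pointIdeal p).IsPrime := by
  unfold pointIdeal
  exact RingHom.ker_isPrime _

/-- The intersection multiplicity at `p` of `X` and the hypersurface `f = 0` (`f` homogeneous):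
the length of the localization of `S / (I(X) + (f))` at the homogeneous prime of `p`. -/
def intersectionMult {n : ℕ} (X : Set (CP n)) (f : MvPolynomial (Fin (n + 1)) ℂ) (p : CP n) :
    ℕ∞ :=
  Module.length (Localization.AtPrime (pointIdeal p))
    (Localization.AtPrime (pointIdeal p) ⧸
      (idealOf X ⊔ Ideal.span {f}).map
        (algebraMap (MvPolynomial (Fin (n + 1)) ℂ) (Localization.AtPrime (pointIdeal p))))

/-- The linear form with coefficients `a`. -/
def linearForm {n : ℕ} (a : Fin (n + 1) → ℂ) : MvPolynomial (Fin (n + 1)) ℂ :=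
  ∑ i, MvPolynomial.C (a i) * MvPolynomial.X i

/-- The multiplicity of the point `p` on the curve `X`: the least intersection multiplicity at
`p` of `X` with a hyperplane through `p` (attained by the general such hyperplane; it is `0` if
`p` is not on `X`). -/
def pointMult {n : ℕ} (X : Set (CP n)) (p : CP n) : ℕ∞ :=
  ⨅ a : {a : Fin (n + 1) → ℂ // a ≠ 0 ∧ MvPolynomial.eval p.rep (linearForm a) = 0},
    intersectionMult X (linearForm a.1) p

/-- The Zariski tangent space at `p` of the affine cone over `X`. -/
def tangentCone {n : ℕ} (X : Set (CP n)) (p : CP n) : Submodule ℂ (Fin (n + 1) → ℂ) :=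
  ⨅ f ∈ idealOf X, LinearMap.ker
    (∑ i, MvPolynomial.eval p.rep (MvPolynomial.pderiv i f) •
      (LinearMap.proj i : (Fin (n + 1) → ℂ) →ₗ[ℂ] ℂ))

/-- `p` is a smooth point of the curve `X`: the projective tangent space at `p` is a line. -/
def IsSmoothPoint {n : ℕ} (X : Set (CP n)) (p : CP n) : Prop :=
  p ∈ X ∧ Module.finrank ℂ (tangentCone X p) = 2

/-- `p` is a double point of the curve `X`: a point of multiplicity two. -/
def IsDoublePoint {n : ℕ} (X : Set (CP n)) (p : CP n) : Prop :=
  p ∈ X ∧ pointMult X p = 2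

/-! ### Spherical curves -/

/-- The affine part `x₀ ≠ 0` of projective space, identified with `ℂᵈ`. -/
def affinePart (d : ℕ) : Set (CP d) := {p | p.rep 0 ≠ 0}

/-- The point `[1, x₁, …, x_d]`. -/
def affinePoint {d : ℕ} (x : Fin d → ℂ) : CP d :=
  CP.mk (Fin.cons 1 x) (fun h => one_ne_zero (α := ℂ) (by simpa using congrFun h 0))

/-- The projective closure `x₀² = x₁² + ⋯ + xₙ²` of the unit sphere in `ℂⁿ`. -/
def unitSphere (n : ℕ) : Set (CP n) :=
  {p | p.rep 0 ^ 2 = ∑ i : Fin n, p.rep i.succ ^ 2}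

/-- The imaginary sphere at infinity `Σ_∞`. -/
def sphereAtInfinity (d : ℕ) : Set (CP d) := unitSphere d ∩ (affinePart d)ᶜ

/-- The homogeneous equation of the hypersphere `∑ (xᵢ - cᵢ)² = ρ` in `ℂᵈ`. -/
def sphereForm {d : ℕ} (c : Fin d → ℂ) (ρ : ℂ) : MvPolynomial (Fin (d + 1)) ℂ :=
  ∑ i : Fin d, (MvPolynomial.X i.succ - MvPolynomial.C (c i) * MvPolynomial.X 0) ^ 2
    - MvPolynomial.C ρ * MvPolynomial.X 0 ^ 2

/-- The multiplicity with which the curve `X` contains the point `p` of `Σ_∞`. Every hypersphere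
contains `Σ_∞`; the multiplicity is the least intersection multiplicity at `p` of `X` with a
hypersphere, which is attained by the general hypersphere. For `d = 2` it is the
multiplicity of `X` at the circular point `p`. -/
def multAtInfinity {d : ℕ} (X : Set (CP d)) (p : CP d) : ℕ∞ :=
  ⨅ s : {s : (Fin d → ℂ) × ℂ // s.2 ≠ 0}, intersectionMult X (sphereForm s.1.1 s.1.2) p

/-- Complex conjugation of points. -/
def CP.conj {n : ℕ} (p : CP n) : CP n :=
  CP.mk (fun i => (starRingEnd ℂ) (p.rep i)) (fun h => p.rep_ne_zero (by
    funext i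
    simpa using congrFun h i))

open scoped Classical in
/-- `X` is an `ℓ`-spherical curve: a real curve containing exactly `ℓ` pairs `{p, p̄}` of complex
conjugate points, counted with multiplicity, on `Σ_∞`. The multiset `s` picks one point out of
each of the `ℓ` pairs. -/
def IsSpherical {d : ℕ} (ℓ : ℕ) (X : Set (CP d)) : Prop :=
  IsRealCurve X ∧ ∃ s : Multiset (CP d), s.card = ℓ ∧ (∀ p ∈ s, p ∈ sphereAtInfinity d) ∧
    ∀ p ∈ sphereAtInfinity d, multAtInfinity X p = s.count p + s.count p.conj

/-- `X` is a real curve of spherical degree `k`, that is, `X` is `ℓ`-spherical of degree `e` with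
`k = e - ℓ`. -/
def HasSphericalDegree {d : ℕ} (X : Set (CP d)) (k : ℤ) : Prop :=
  ∃ e ℓ : ℕ, HasDegree X e ∧ IsSpherical ℓ X ∧ k = (e : ℤ) - ℓ

/-! ### Stereographic projection and inversion -/

/-- The tangent hyperplane `x_{d+1} = x₀` to the unit sphere at the north pole. -/
def northTangent (d : ℕ) : Set (CP (d + 1)) := {p | p.rep (Fin.last (d + 1)) = p.rep 0}

/-- The south pole `[1, 0, …, 0, -1]`. -/
def southPole (d : ℕ) : CP (d + 1) := affinePoint (Fin.snoc (0 : Fin d → ℂ) (-1))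

/-- `π(s) = x` for the stereographic projection `π` from the north pole `N = [1, 0, …, 0, 1]`: the
point `s` lies on the sphere, and `x` is the intersection of the line `N s` with `x_{d+1} = 0`,
that is, `x = [y₀ - y_{d+1}, y₁, …, y_d]` if `s = [y₀, …, y_{d+1}]`. (This vector is zero exactly
if `s = N`, and then no `x` qualifies.) -/
def IsStereo {d : ℕ} (s : CP (d + 1)) (x : CP d) : Prop :=
  s ∈ unitSphere (d + 1) ∧
    x.HasCoords (Fin.cons (s.rep 0 - s.rep (Fin.last (d + 1)))
      (fun j : Fin d => s.rep j.succ.castSucc))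

/-- The image `π(A)` of a set under stereographic projection. -/
def stereoImage {d : ℕ} (A : Set (CP (d + 1))) : Set (CP d) := {x | ∃ s ∈ A, IsStereo s x}

/-- The preimage `π⁻¹(B)` of a set under stereographic projection. -/
def stereoPreimage {d : ℕ} (B : Set (CP d)) : Set (CP (d + 1)) := {s | ∃ x ∈ B, IsStereo s x}

/-- The reflection `ρ` in the hyperplane `x_{d+1} = 0`. -/
def reflection {d : ℕ} (s : CP (d + 1)) : CP (d + 1) :=
  CP.mk (Fin.snoc (fun j : Fin (d + 1) => s.rep j.castSucc) (-s.rep (Fin.last (d + 1))))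
    (fun h => s.rep_ne_zero (by
      funext i
      refine Fin.lastCases ?_ (fun j => ?_) i
      · simpa using congrFun h (Fin.last (d + 1))
      · simpa using congrFun h j.castSucc))

/-- The translation `τ_r : x ↦ x + r`, extended to projective space. -/
def translation {d : ℕ} (r : Fin d → ℂ) (p : CP d) : CP d :=
  CP.mk (Fin.cons (p.rep 0) (fun j : Fin d => p.rep j.succ + p.rep 0 * r j))
    (fun h => p.rep_ne_zero (by
      have h0 : p.rep 0 = 0 := by simpa using congrFun h 0
      funext i
      refine Fin.cases h0 (fun j => ?_) i
      simpa [h0] using congrFun h j.succ))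

/-- The lift of a curve to the sphere: the Zariski closure of `π⁻¹(X \ Σ_∞)`. -/
def sphereLift {d : ℕ} (X : Set (CP d)) : Set (CP (d + 1)) :=
  closure (stereoPreimage (X \ sphereAtInfinity d))

/-- The Zariski closure of `π(ρ(Y))`. -/
def reflectedProjection {d : ℕ} (Y : Set (CP (d + 1))) : Set (CP d) :=
  closure (stereoImage (reflection '' Y))

/-- The inverse of `X` in the point `r` of `ℂᵈ`: the Zariski closure of the image under
`ι_r = τ_r ∘ (π ∘ ρ ∘ π⁻¹) ∘ τ_{-r}` of the affine points of `X` other than `r`. -/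
def inverse {d : ℕ} (r : Fin d → ℂ) (X : Set (CP d)) : Set (CP d) :=
  closure (translation r '' stereoImage (reflection '' stereoPreimage
    (translation (-r) '' ((X ∩ affinePart d) \ {affinePoint r}))))

end SphericalCurve

end

open SphericalCurve

noncomputable section

/-! ### Forms, homogeneous ideals and the Zariski topology. -/

namespace SphericalCurve

open MvPolynomial

attribute [local instance] MvPolynomial.gradedAlgebra

/-! Everything rests on one degree count. Projection from the pole [1, 0, …, 0, σ] with σ² = 1,
combined with translation by r, and the inverse of this map have pullbacks `fromSphere σ r` (linear)
and `toSphere σ r` (quadratic). They are mutually inverse between the sphere off its tangent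
hyperplane at the pole and the affine space x₀ ≠ 0. As π ∘ ρ is the projection from the opposite
pole, the two signs cover π, π ∘ ρ and ι_r, the last being a lift from σ = 1 followed by a
projection from σ = -1. `Corr` records what the argument needs of such a pair.

Let a curve V of degree e be mapped to W by forms of degree s. By Bézout the pullback of a general
hyperplane h meets V with total multiplicity s·e. The intersections where the map is invertible
correspond, with the same local lengths, to those of W with h and contribute deg W; the remaining
ones sit at base points (`Corr.exists_hasDegree`).

For the lift, pullbacks of general hyperplanes are hyperspheres and the base points lie on Σ_∞, so
2e = deg W + 2ℓ and deg W = 2(e - ℓ) (`lift_spec`). For the projection from a pole of multiplicity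
m, that pole is the only base point, so the degree drops from 2k to 2k - m (`proj_spec`). Lifting
the projected curve returns the original one, hence the first count, read backwards, gives 2(2k - m)
= 2k + 2ℓ' and ℓ' = k - m without any direct study of the projected curve at infinity
(`proj_isSpherical`). Inversion composes the two: r lifts to the south pole with unchanged
multiplicity (`pointMult_lift`), and this multiplicity is 1 at a smooth point
(`IsSmoothPoint.pointMult_eq_one`).

The supporting algebra: a homogeneous ideal with finitely many zeros has eventual Hilbert function
the sum of its local lengths (`IsHomog.eventually_hilbert_eq`), because both are additive along the
sequences S/(J : x) → S/J → S/(J + x); Bézout follows. Multiplicities are infima over hyperplanes or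
hyperspheres; `locLength_le_of_general` shows that the general member of the linear system attains
the infimum, being a reduction of the ideal of the system. Conjugation preserves real curves and has
no fixed points on Σ_∞, so being ℓ-spherical only means that the total multiplicity there is 2ℓ
(`isSpherical_iff`). Dimension one is obtained from linear growth of the Hilbert function, which
passes to images (`HasLinearGrowth.finite_of_ssubset`). -/

/-- The homogeneous coordinate ring of projective `n`-space. -/
abbrev Coord (n : ℕ) : Type := MvPolynomial (Fin (n + 1)) ℂ

/-! ### Homogeneous coordinates and homogeneous forms -/

theorem eval_smul_of_isHomogeneous {n e : ℕ} {f : Coord n} (hf : f.IsHomogeneous e)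
    (c : ℂ) (v : Fin (n + 1) → ℂ) : eval (c • v) f = c ^ e * eval v f := by
  rw [eval_eq, eval_eq, Finset.mul_sum]
  refine Finset.sum_congr rfl fun d hd => ?_
  have hdeg := hf.degree_eq_sum_deg_support hd
  simp only [Pi.smul_apply, smul_eq_mul, mul_pow, Finset.prod_mul_distrib,
    Finset.prod_pow_eq_pow_sum]
  have : ∑ i ∈ d.support, d i = e := hdeg.symm
  rw [this]; ring

theorem CP.hasCoords_rep {n : ℕ} (p : CP n) : p.HasCoords p.rep :=
  ⟨p.rep_ne_zero, Projectivization.mk_rep p⟩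

theorem CP.hasCoords_mk {n : ℕ} (v : Fin (n + 1) → ℂ) (hv : v ≠ 0) : (CP.mk v hv).HasCoords v :=
  ⟨hv, rfl⟩

theorem CP.HasCoords.ne_zero {n : ℕ} {p : CP n} {v : Fin (n + 1) → ℂ} (h : p.HasCoords v) :
    v ≠ 0 := h.1

theorem CP.HasCoords.eq_mk {n : ℕ} {p : CP n} {v : Fin (n + 1) → ℂ} (h : p.HasCoords v) :
    p = CP.mk v h.ne_zero := h.2.symm

theorem CP.HasCoords.smul {n : ℕ} {p : CP n} {v : Fin (n + 1) → ℂ} (h : p.HasCoords v) {c : ℂ}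
    (hc : c ≠ 0) : p.HasCoords (c • v) := by
  obtain ⟨hv, rfl⟩ := h
  refine ⟨smul_ne_zero hc hv, ?_⟩
  rw [Projectivization.mk_eq_mk_iff']
  exact ⟨c, rfl⟩

theorem CP.HasCoords.eq_smul {n : ℕ} {p : CP n} {v w : Fin (n + 1) → ℂ} (h : p.HasCoords v)
    (h' : p.HasCoords w) : ∃ c : ℂ, c ≠ 0 ∧ w = c • v := by
  obtain ⟨hv, rfl⟩ := h
  obtain ⟨hw, h'⟩ := h'
  rw [Projectivization.mk_eq_mk_iff'] at h'
  obtain ⟨c, hc⟩ := h'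
  exact ⟨c, fun h0 => hw (by rw [← hc, h0, zero_smul]), hc.symm⟩

theorem CP.HasCoords.unique {n : ℕ} {p q : CP n} {v : Fin (n + 1) → ℂ} (h : p.HasCoords v)
    (h' : q.HasCoords v) : p = q := by
  rw [h.eq_mk, h'.eq_mk]

theorem CP.HasCoords.unique_smul {n : ℕ} {p q : CP n} {v w : Fin (n + 1) → ℂ}
    (h : p.HasCoords v) (h' : q.HasCoords w) {c : ℂ} (hc : w = c • v) : p = q := by
  have : c ≠ 0 := fun h0 => h'.ne_zero (by rw [hc, h0, zero_smul])
  exact (hc ▸ h.smul this).unique h'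

theorem CP.HasCoords.eval_eq_zero_iff {n e : ℕ} {p : CP n} {v : Fin (n + 1) → ℂ}
    (h : p.HasCoords v) {f : Coord n} (hf : f.IsHomogeneous e) :
    eval p.rep f = 0 ↔ eval v f = 0 := by
  obtain ⟨c, hc, hv⟩ := p.hasCoords_rep.eq_smul h
  rw [hv, eval_smul_of_isHomogeneous hf]
  simp [hc]

/-! ### Homogeneous ideals -/

/-- An ideal generated by forms. -/
def IsHomog {n : ℕ} (J : Ideal (Coord n)) : Prop :=
  ∀ f ∈ J, ∀ i, homogeneousComponent i f ∈ J

theorem isHomog_iff {n : ℕ} {J : Ideal (Coord n)} :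
    IsHomog J ↔ J.IsHomogeneous (homogeneousSubmodule (Fin (n + 1)) ℂ) := by
  constructor
  · intro h i f hf
    have := decomposition.decompose'_apply f i
    have h2 := h f hf i
    rw [← this] at h2
    exact h2
  · intro h f hf i
    exact homogeneousComponent_mem_of_mem h hf i

theorem IsHomog.sup {n : ℕ} {I J : Ideal (Coord n)} (hI : IsHomog I) (hJ : IsHomog J) :
    IsHomog (I ⊔ J) :=
  isHomog_iff.2 ((isHomog_iff.1 hI).sup (isHomog_iff.1 hJ))

theorem isHomog_span_singleton {n e : ℕ} {f : Coord n} (hf : f.IsHomogeneous e) :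
    IsHomog (Ideal.span {f}) :=
  isHomog_iff.2 (Ideal.homogeneous_span _ _ (by
    rintro x rfl
    exact ⟨e, hf⟩))

theorem homogeneousComponent_mul_of_isHomogeneous {n e : ℕ} {f g : Coord n}
    (hf : f.IsHomogeneous e) (i : ℕ) :
    homogeneousComponent (i + e) (g * f) = homogeneousComponent i g * f := by
  conv_lhs => rw [← sum_homogeneousComponent g, Finset.sum_mul, map_sum]
  have key : ∀ j, homogeneousComponent (i + e) (homogeneousComponent j g * f) =
      if j = i then homogeneousComponent i g * f else 0 := by
    intro j
    rw [homogeneousComponent_of_mem (n := j + e)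
      (((homogeneousComponent_isHomogeneous j g)).mul hf)]
    by_cases h : j = i
    · simp [h]
    · rw [if_neg h, if_neg (by omega)]
  simp only [key, Finset.sum_ite_eq', Finset.mem_range]
  split_ifs with h
  · rfl
  · rw [homogeneousComponent_eq_zero _ _ (by omega), zero_mul]

theorem IsHomog.le_of_forall {n : ℕ} {I J : Ideal (Coord n)} (hI : IsHomog I)
    (h : ∀ e, ∀ f ∈ I, f.IsHomogeneous e → f ∈ J) : I ≤ J := by
  intro f hf
  rw [← sum_homogeneousComponent f]
  exact Ideal.sum_mem _ fun i _ => h i _ (hI f hf i) (homogeneousComponent_isHomogeneous i f)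

theorem IsHomog.isPrime {n : ℕ} {I : Ideal (Coord n)} (hI : IsHomog I) (h1 : I ≠ ⊤)
    (h : ∀ {a b : ℕ} {f g : Coord n}, f.IsHomogeneous a → g.IsHomogeneous b → f * g ∈ I →
      f ∈ I ∨ g ∈ I) : I.IsPrime := by
  refine (isHomog_iff.1 hI).isPrime_of_homogeneous_mem_or_mem h1 ?_
  rintro x y ⟨a, ha⟩ ⟨b, hb⟩ hxy
  exact h ha hb hxy

/-- A polynomial vanishing at all multiples of `v` has all its components vanishing at `v`. -/
theorem eval_homogeneousComponent_eq_zero {n : ℕ} {f : Coord n} {v : Fin (n + 1) → ℂ}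
    (h : ∀ c : ℂ, c ≠ 0 → eval (c • v) f = 0) (i : ℕ) :
    eval v (homogeneousComponent i f) = 0 := by
  -- As a function of c, the value of f at c • v is this polynomial, whose coefficients are the
  -- values of the components of f. It has infinitely many roots.
  let P : Polynomial ℂ := ∑ j ∈ Finset.range (f.totalDegree + 1),
    Polynomial.C (eval v (homogeneousComponent j f)) * Polynomial.X ^ j
  have hP : P = 0 := by
    refine Polynomial.eq_zero_of_infinite_isRoot P (Set.Infinite.mono (s := {0}ᶜ) ?_
      (Set.finite_singleton (0 : ℂ)).infinite_compl)
    intro c hc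
    have := h c hc
    rw [← sum_homogeneousComponent f, map_sum] at this
    simp only [Set.mem_ofPred_eq, Polynomial.IsRoot.def, P, Polynomial.eval_finsetSum,
      Polynomial.eval_mul, Polynomial.eval_C, Polynomial.eval_pow, Polynomial.eval_X]
    rw [← this]
    refine Finset.sum_congr rfl fun j _ => ?_
    rw [eval_smul_of_isHomogeneous (homogeneousComponent_isHomogeneous j f), mul_comm]
  by_cases hi : i < f.totalDegree + 1
  · have := congrArg (fun Q => Polynomial.coeff Q i) hP
    simpa [P, Polynomial.finsetSum_coeff, Polynomial.coeff_C_mul, Polynomial.coeff_X_pow, hi]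
      using this
  · rw [homogeneousComponent_eq_zero _ _ (by omega), map_zero]

/-! ### The ideal of a set of points -/

theorem mem_idealOf {n : ℕ} {X : Set (CP n)} {f : Coord n} :
    f ∈ idealOf X ↔ ∀ p ∈ X, ∀ v, p.HasCoords v → eval v f = 0 := by
  simp only [idealOf, mem_vanishingIdeal_iff, Set.mem_ofPred_eq, aeval_eq_eval]
  constructor
  · intro h p hp v hv
    exact h v ⟨p, hp, hv⟩
  · rintro h v ⟨p, hp, hv⟩
    exact h p hp v hv

theorem mem_idealOf_of_isHomogeneous {n e : ℕ} {X : Set (CP n)} {f : Coord n}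
    (hf : f.IsHomogeneous e) : f ∈ idealOf X ↔ ∀ p ∈ X, eval p.rep f = 0 := by
  rw [mem_idealOf]
  refine forall₂_congr fun p _ => ⟨fun h => h _ p.hasCoords_rep, fun h v hv => ?_⟩
  exact (hv.eval_eq_zero_iff hf).1 h

theorem isHomog_idealOf {n : ℕ} (X : Set (CP n)) : IsHomog (idealOf X) := by
  intro f hf i
  rw [mem_idealOf] at *
  intro p hp v hv
  exact eval_homogeneousComponent_eq_zero (fun c hc => hf p hp _ (hv.smul hc)) i

theorem idealOf_anti {n : ℕ} {X Y : Set (CP n)} (h : X ⊆ Y) : idealOf Y ≤ idealOf X :=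
  vanishingIdeal_anti_mono fun _ ⟨p, hp, hv⟩ => ⟨p, h hp, hv⟩

theorem mem_idealOf_sUnion {n : ℕ} {𝒵 : Set (Set (CP n))} {f : Coord n} :
    f ∈ idealOf (⋃₀ 𝒵) ↔ ∀ Z ∈ 𝒵, f ∈ idealOf Z := by
  simp only [mem_idealOf, Set.mem_sUnion]
  exact ⟨fun h Z hZ p hp => h p ⟨Z, hZ, hp⟩, fun h p ⟨Z, hZ, hp⟩ => h Z hZ p hp⟩

/-! ### The Zariski topology -/

theorem isTopologicalBasis_zariski (n : ℕ) : TopologicalSpace.IsTopologicalBasis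
    {U : Set (CP n) | ∃ (e : ℕ) (f : Coord n), f.IsHomogeneous e ∧
      U = {p : CP n | eval p.rep f ≠ 0}} := by
  refine TopologicalSpace.isTopologicalBasis_of_subbasis_of_finiteInter rfl ⟨?_, ?_⟩
  · exact ⟨0, 1, isHomogeneous_one _ _, by simp⟩
  · rintro _ ⟨a, f, hf, rfl⟩ _ ⟨b, g, hg, rfl⟩
    refine ⟨a + b, f * g, hf.mul hg, ?_⟩
    ext p
    simp [not_or]

theorem isClosed_iff_forall_exists {n : ℕ} {X : Set (CP n)} :
    IsClosed X ↔ ∀ p ∉ X, ∃ (e : ℕ) (f : Coord n), f.IsHomogeneous e ∧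
      (∀ q ∈ X, eval q.rep f = 0) ∧ eval p.rep f ≠ 0 := by
  rw [← isOpen_compl_iff, (isTopologicalBasis_zariski n).isOpen_iff]
  refine forall₂_congr fun p hp => ⟨?_, ?_⟩
  · rintro ⟨U, ⟨e, f, hf, rfl⟩, hpU, hU⟩
    exact ⟨e, f, hf, fun q hq => by_contra fun h => hU h hq, hpU⟩
  · rintro ⟨e, f, hf, hq, hpf⟩
    exact ⟨_, ⟨e, f, hf, rfl⟩, hpf, fun q hqf hqX => hqf (hq q hqX)⟩

theorem isClosed_zeros {n e : ℕ} {f : Coord n} (hf : f.IsHomogeneous e) :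
    IsClosed {p : CP n | eval p.rep f = 0} :=
  isClosed_iff_forall_exists.2 fun _ hp => ⟨e, f, hf, fun _ hq => hq, hp⟩

theorem mem_of_forall_mem_idealOf {n : ℕ} {X : Set (CP n)} (hX : IsClosed X) {p : CP n}
    (h : ∀ (e : ℕ) (f : Coord n), f.IsHomogeneous e → f ∈ idealOf X → eval p.rep f = 0) :
    p ∈ X := by
  by_contra hp
  obtain ⟨e, f, hf, hfX, hfp⟩ := isClosed_iff_forall_exists.1 hX p hp
  exact hfp (h e f hf ((mem_idealOf_of_isHomogeneous hf).2 hfX))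

theorem idealOf_closure {n : ℕ} (X : Set (CP n)) : idealOf (closure X) = idealOf X := by
  refine le_antisymm (idealOf_anti subset_closure) ((isHomog_idealOf X).le_of_forall ?_)
  intro e f hf hfe
  rw [mem_idealOf_of_isHomogeneous hfe] at *
  intro p hp
  exact closure_minimal (t := {p : CP n | eval p.rep f = 0}) hf (isClosed_zeros hfe) hp

theorem subset_of_idealOf_le {n : ℕ} {X Y : Set (CP n)} (hY : IsClosed Y)
    (h : idealOf Y ≤ idealOf X) : X ⊆ Y := fun p hp =>
  mem_of_forall_mem_idealOf hY fun _ _ hf hfY =>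
    (mem_idealOf_of_isHomogeneous hf).1 (h hfY) p hp

theorem eq_of_idealOf_eq {n : ℕ} {X Y : Set (CP n)} (hX : IsClosed X) (hY : IsClosed Y)
    (h : idealOf X = idealOf Y) : X = Y :=
  (subset_of_idealOf_le hY h.ge).antisymm (subset_of_idealOf_le hX h.le)

/-- A closed set is determined by its ideal, so closed sets embed, order reversed, into the ideals
of a Noetherian ring. -/
instance (n : ℕ) : TopologicalSpace.NoetherianSpace (CP n) := by
  refine ((TopologicalSpace.noetherianSpace_TFAE (CP n)).out 0 1).2 ?_
  let F : TopologicalSpace.Closeds (CP n) → (Ideal (Coord n))ᵒᵈ :=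
    fun Z => OrderDual.toDual (idealOf (Z : Set (CP n)))
  have hF : StrictMono F := by
    refine Monotone.strictMono_of_injective (fun Z W h => ?_) (fun Z W h => ?_)
    · exact idealOf_anti (n := n) h
    · exact TopologicalSpace.Closeds.ext (eq_of_idealOf_eq Z.2 W.2 h)
  exact hF.wellFoundedLT

theorem idealOf_isPrime {n : ℕ} {Z : Set (CP n)} (hZ : IsIrreducible Z) :
    (idealOf Z).IsPrime := by
  refine (isHomog_idealOf Z).isPrime ?_ ?_
  · obtain ⟨p, hp⟩ := hZ.nonempty
    intro h
    have : (1 : Coord n) ∈ idealOf Z := h ▸ Submodule.mem_top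
    simpa using mem_idealOf.1 this p hp _ p.hasCoords_rep
  · intro a b f g hf hg hfg
    rw [mem_idealOf_of_isHomogeneous hf, mem_idealOf_of_isHomogeneous hg]
    have h := (mem_idealOf_of_isHomogeneous (hf.mul hg)).1 hfg
    refine (isPreirreducible_iff_isClosed_union_isClosed.1 hZ.isPreirreducible)
      {p | eval p.rep f = 0} {p | eval p.rep g = 0} (isClosed_zeros hf) (isClosed_zeros hg) ?_
    intro p hp
    simpa using h p hp

/-! ### The ideal of a point -/

theorem mem_pointIdeal {n : ℕ} {p : CP n} {f : Coord n} :
    f ∈ pointIdeal p ↔ ∀ c : ℂ, eval (c • p.rep) f = 0 := by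
  have key : ∀ c : ℂ, eval (c • p.rep) f = Polynomial.eval c (aeval
      (fun i => Polynomial.C (p.rep i) * Polynomial.X : Fin (n + 1) → Polynomial ℂ) f) := by
    intro c
    have : eval (c • p.rep) = (Polynomial.evalRingHom c).comp (aeval
      (fun i => Polynomial.C (p.rep i) * Polynomial.X : Fin (n + 1) → Polynomial ℂ)).toRingHom := by
      refine MvPolynomial.ringHom_ext (fun a => ?_) (fun i => ?_)
      · simp
      · simp only [eval_X, RingHom.comp_apply, AlgHom.toRingHom_eq_coe, RingHom.coe_coe, aeval_X,
          Polynomial.coe_evalRingHom, Polynomial.eval_mul, Polynomial.eval_C, Polynomial.eval_X,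
          Pi.smul_apply, smul_eq_mul, mul_comm]
    rw [this]; rfl
  rw [pointIdeal, RingHom.mem_ker]
  constructor
  · intro h c
    rw [key]
    erw [h]
    simp
  · intro h
    refine Polynomial.funext fun c => ?_
    erw [← key, h c]
    simp

theorem mem_pointIdeal_of_isHomogeneous {n e : ℕ} {p : CP n} {f : Coord n}
    (hf : f.IsHomogeneous e) : f ∈ pointIdeal p ↔ eval p.rep f = 0 := by
  rw [mem_pointIdeal]
  refine ⟨fun h => by simpa using h 1, fun h c => ?_⟩
  rw [eval_smul_of_isHomogeneous hf, h, mul_zero]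

theorem idealOf_le_pointIdeal {n : ℕ} {X : Set (CP n)} {p : CP n} (hp : p ∈ X) :
    idealOf X ≤ pointIdeal p :=
  (isHomog_idealOf X).le_of_forall fun _ _ hf hfe =>
    (mem_pointIdeal_of_isHomogeneous hfe).2 ((mem_idealOf_of_isHomogeneous hfe).1 hf p hp)

theorem mem_of_idealOf_le_pointIdeal {n : ℕ} {X : Set (CP n)} (hX : IsClosed X) {p : CP n}
    (h : idealOf X ≤ pointIdeal p) : p ∈ X :=
  mem_of_forall_mem_idealOf hX fun _ _ hf hfX =>
    (mem_pointIdeal_of_isHomogeneous hf).1 (h hfX)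

/-- If all the minors pᵢ xⱼ - pⱼ xᵢ, for an i with pᵢ ≠ 0, vanished at q, then q would be
proportional to p. -/
theorem exists_linear_ne {n : ℕ} {p q : CP n} (h : p ≠ q) :
    ∃ f : Coord n, f.IsHomogeneous 1 ∧ eval p.rep f = 0 ∧ eval q.rep f ≠ 0 := by
  obtain ⟨i, hi⟩ : ∃ i, p.rep i ≠ 0 := Function.ne_iff.1 p.rep_ne_zero
  by_contra! hc
  refine h (p.hasCoords_rep.unique_smul q.hasCoords_rep (c := q.rep i / p.rep i) ?_)
  funext j
  have := hc (C (p.rep i) * X j - C (p.rep j) * X i)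
    ((isHomogeneous_C_mul_X _ _).sub (isHomogeneous_C_mul_X _ _)) (by simp; ring)
  simp only [map_sub, map_mul, eval_C, eval_X] at this
  simp only [Pi.smul_apply, smul_eq_mul]
  field_simp
  linear_combination this

theorem isClosed_singleton_CP {n : ℕ} (p : CP n) : IsClosed ({p} : Set (CP n)) :=
  isClosed_iff_forall_exists.2 fun q hq => by
    obtain ⟨f, hf, h1, h2⟩ := exists_linear_ne (p := p) (q := q) (fun h => hq h.symm)
    exact ⟨1, f, hf, fun r hr => by rw [Set.mem_singleton_iff.1 hr, h1], h2⟩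

instance (n : ℕ) : T1Space (CP n) := ⟨isClosed_singleton_CP⟩

end SphericalCurve

/-! ### Hilbert functions and local lengths of homogeneous ideals. -/

namespace SphericalCurve

open MvPolynomial

/-! ### Hilbert functions of ideals -/

instance (n t : ℕ) : Module.Finite ℂ (homogeneousSubmodule (Fin (n + 1)) ℂ t) :=
  Module.Finite.iff_fg.2 (homogeneousSubmodule_fg _ _ t)

/-- The elements of degree `t` of an ideal. -/
def gradedPiece {n : ℕ} (J : Ideal (Coord n)) (t : ℕ) :
    Submodule ℂ (homogeneousSubmodule (Fin (n + 1)) ℂ t) :=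
  (J.restrictScalars ℂ).comap (homogeneousSubmodule (Fin (n + 1)) ℂ t).subtype

/-- The Hilbert function of `S / J`. -/
def hilbert {n : ℕ} (J : Ideal (Coord n)) (t : ℕ) : ℕ :=
  Module.finrank ℂ (homogeneousSubmodule (Fin (n + 1)) ℂ t ⧸ gradedPiece J t)

theorem hilbertFunction_eq {n : ℕ} (X : Set (CP n)) (t : ℕ) :
    hilbertFunction X t = hilbert (idealOf X) t := rfl

theorem mem_gradedPiece {n : ℕ} {J : Ideal (Coord n)} {t : ℕ}
    {f : homogeneousSubmodule (Fin (n + 1)) ℂ t} : f ∈ gradedPiece J t ↔ (f : Coord n) ∈ J :=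
  Iff.rfl

theorem hilbert_le_of_map {n m t t' : ℕ} {A : Ideal (Coord n)} {B : Ideal (Coord m)}
    (L : Coord m →ₗ[ℂ] Coord n) (hL : ∀ F, F.IsHomogeneous t → (L F).IsHomogeneous t')
    (h : ∀ F, F.IsHomogeneous t → L F ∈ A → F ∈ B) : hilbert B t ≤ hilbert A t' := by
  let L' : homogeneousSubmodule (Fin (m + 1)) ℂ t →ₗ[ℂ] homogeneousSubmodule (Fin (n + 1)) ℂ t' :=
    L.restrict hL
  have hle : (gradedPiece A t').comap L' ≤ gradedPiece B t := fun F hF => h F.1 F.2 hF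
  have h1 : hilbert B t ≤ Module.finrank ℂ
      (homogeneousSubmodule (Fin (m + 1)) ℂ t ⧸ (gradedPiece A t').comap L') :=
    LinearMap.finrank_le_finrank_of_surjective (f := Submodule.factor hle)
      (Submodule.factor_surjective hle)
  refine h1.trans ?_
  refine LinearMap.finrank_le_finrank_of_injective
    (f := Submodule.mapQ ((gradedPiece A t').comap L') (gradedPiece A t') L' le_rfl) ?_
  rw [← LinearMap.ker_eq_bot, Submodule.ker_mapQ]
  simp

/-- The two rings and the two degrees may differ because the maps compared later have degree one or
two. -/
theorem hilbert_eq_of_map {n m t t' : ℕ} {A : Ideal (Coord n)} {B : Ideal (Coord m)}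
    (L : Coord m →ₗ[ℂ] Coord n) (hL : ∀ F, F.IsHomogeneous t → (L F).IsHomogeneous t')
    (h : ∀ F, F.IsHomogeneous t → (L F ∈ A ↔ F ∈ B))
    (hsurj : ∀ g, g.IsHomogeneous t' → ∃ F, F.IsHomogeneous t ∧ g - L F ∈ A) :
    hilbert B t = hilbert A t' := by
  refine le_antisymm (hilbert_le_of_map L hL fun F hF => (h F hF).1) ?_
  let L' : homogeneousSubmodule (Fin (m + 1)) ℂ t →ₗ[ℂ] homogeneousSubmodule (Fin (n + 1)) ℂ t' :=
    L.restrict hL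
  have hle : gradedPiece B t ≤ (gradedPiece A t').comap L' := fun F hF => (h F.1 F.2).2 hF
  refine LinearMap.finrank_le_finrank_of_surjective
    (f := Submodule.mapQ (gradedPiece B t) (gradedPiece A t') L' hle) ?_
  intro y
  obtain ⟨g, rfl⟩ := Submodule.mkQ_surjective _ y
  obtain ⟨F, hF, hFA⟩ := hsurj g.1 g.2
  refine ⟨(gradedPiece B t).mkQ ⟨F, hF⟩, ?_⟩
  simp only [Submodule.mkQ_apply, Submodule.mapQ_apply]
  rw [eq_comm, Submodule.Quotient.eq]
  exact hFA

theorem hilbert_anti {n : ℕ} {I J : Ideal (Coord n)} (h : I ≤ J) (t : ℕ) :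
    hilbert J t ≤ hilbert I t :=
  hilbert_le_of_map LinearMap.id (fun _ h => h) fun _ _ hF => h hF

theorem hilbert_eq_zero {n t : ℕ} {J : Ideal (Coord n)}
    (h : ∀ f : Coord n, f.IsHomogeneous t → f ∈ J) : hilbert J t = 0 := by
  have : gradedPiece J t = ⊤ := eq_top_iff.2 fun f _ => h f.1 f.2
  rw [hilbert, this]
  exact Module.finrank_zero_of_subsingleton

theorem hilbert_pointIdeal {n : ℕ} (p : CP n) (t : ℕ) : hilbert (pointIdeal p) t = 1 := by
  let ev : homogeneousSubmodule (Fin (n + 1)) ℂ t →ₗ[ℂ] ℂ :=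
    (aeval (R := ℂ) p.rep).toLinearMap.domRestrict _
  have hev : ∀ f, ev f = eval p.rep (f : Coord n) := fun f => by
    simp [ev, aeval_eq_eval]
  have hker : gradedPiece (pointIdeal p) t = LinearMap.ker ev := by
    ext f
    rw [mem_gradedPiece, mem_pointIdeal_of_isHomogeneous f.2, LinearMap.mem_ker, hev]
  have hsurj : Function.Surjective ev := by
    obtain ⟨i, hi⟩ : ∃ i, p.rep i ≠ 0 := Function.ne_iff.1 p.rep_ne_zero
    intro c
    refine ⟨⟨C (c / p.rep i ^ t) * X i ^ t, ?_⟩, ?_⟩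
    · exact isHomogeneous_C_mul_X_pow _ _ _
    · rw [hev]
      simp [hi]
  rw [hilbert, hker, (ev.quotKerEquivOfSurjective hsurj).finrank_eq, Module.finrank_self]

theorem IsHomog.exists_of_mem_sup_span {n e t : ℕ} {J : Ideal (Coord n)} (hJ : IsHomog J)
    {x y : Coord n} (hx : x.IsHomogeneous e) (hy : y.IsHomogeneous (t + e))
    (h : y ∈ J ⊔ Ideal.span {x}) : ∃ a, a.IsHomogeneous t ∧ y - a * x ∈ J := by
  obtain ⟨j, hj, z, hz, rfl⟩ := Submodule.mem_sup.1 h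
  obtain ⟨a, rfl⟩ := Ideal.mem_span_singleton'.1 hz
  refine ⟨homogeneousComponent t a, homogeneousComponent_isHomogeneous t a, ?_⟩
  have := homogeneousComponent_of_mem (m := t + e) (n := t + e) hy
  rw [if_pos rfl, map_add, homogeneousComponent_mul_of_isHomogeneous hx] at this
  rw [← this, add_sub_cancel_right]
  exact hJ j hj _

theorem IsHomog.colon {n e : ℕ} {J : Ideal (Coord n)} (hJ : IsHomog J) {x : Coord n}
    (hx : x.IsHomogeneous e) : IsHomog (J.colon {x}) := by
  intro f hf i
  rw [Submodule.mem_colon_singleton, smul_eq_mul] at *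
  rw [← homogeneousComponent_mul_of_isHomogeneous hx]
  exact hJ _ hf _

/-- Multiplication by x gives the exact sequence 0 → S/(J : x) → S/J → S/(J + (x)) → 0, which shifts
degrees by e in its first map. -/
theorem hilbert_add_eq {n e : ℕ} {J : Ideal (Coord n)} (hJ : IsHomog J) {x : Coord n}
    (hx : x.IsHomogeneous e) (t : ℕ) :
    hilbert J (t + e) = hilbert (J ⊔ Ideal.span {x}) (t + e) + hilbert (J.colon {x}) t := by
  let M : homogeneousSubmodule (Fin (n + 1)) ℂ t →ₗ[ℂ]
      homogeneousSubmodule (Fin (n + 1)) ℂ (t + e) :=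
    (LinearMap.mulRight ℂ x).restrict (fun f hf => IsHomogeneous.mul hf hx)
  have hM : ∀ f, (M f : Coord n) = f * x := fun f => rfl
  have hcomap : gradedPiece (J.colon {x}) t = (gradedPiece J (t + e)).comap M := by
    ext f
    rw [mem_gradedPiece, Submodule.mem_comap, mem_gradedPiece, hM, Submodule.mem_colon_singleton,
      smul_eq_mul]
  have hle : gradedPiece J (t + e) ≤ gradedPiece (J ⊔ Ideal.span {x}) (t + e) :=
    fun f hf => (le_sup_left : J ≤ _) hf
  let g := Submodule.factor hle
  let f := Submodule.mapQ (gradedPiece (J.colon {x}) t) (gradedPiece J (t + e)) M hcomap.le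
  have hf : Function.Injective f := by
    rw [← LinearMap.ker_eq_bot, Submodule.ker_mapQ, ← hcomap]
    simp
  have hker : LinearMap.ker g = LinearMap.range f := by
    ext y
    obtain ⟨y, rfl⟩ := Submodule.mkQ_surjective _ y
    simp only [LinearMap.mem_ker, LinearMap.mem_range]
    constructor
    · intro h
      have h1 : (y : Coord n) ∈ J ⊔ Ideal.span {x} := by
        have h2 : (Submodule.Quotient.mk y : _ ⧸ gradedPiece (J ⊔ Ideal.span {x}) (t + e)) = 0 := h
        rwa [Submodule.Quotient.mk_eq_zero] at h2
      obtain ⟨a, ha, hay⟩ := hJ.exists_of_mem_sup_span hx y.2 h1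
      refine ⟨Submodule.Quotient.mk ⟨a, ha⟩, ?_⟩
      change Submodule.Quotient.mk (M ⟨a, ha⟩) = Submodule.Quotient.mk y
      rw [eq_comm, Submodule.Quotient.eq]
      exact hay
    · rintro ⟨z, hz⟩
      obtain ⟨z, rfl⟩ := Submodule.mkQ_surjective _ z
      rw [← hz]
      change Submodule.Quotient.mk (M z) = _
      rw [Submodule.Quotient.mk_eq_zero]
      exact Ideal.mem_sup_right (Ideal.mem_span_singleton'.2 ⟨z, rfl⟩)
  have h1 := LinearMap.finrank_range_add_finrank_ker g
  rw [hker, LinearMap.finrank_range_of_inj hf,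
    LinearMap.range_eq_top.2 (Submodule.factor_surjective hle), finrank_top] at h1
  exact h1.symm

/-! ### Local lengths -/

/-- The length of `S / J` at the point `p`. -/
def locLength {n : ℕ} (J : Ideal (Coord n)) (p : CP n) : ℕ∞ :=
  Module.length (Localization.AtPrime (pointIdeal p))
    (Localization.AtPrime (pointIdeal p) ⧸
      J.map (algebraMap (Coord n) (Localization.AtPrime (pointIdeal p))))

theorem intersectionMult_eq {n : ℕ} (X : Set (CP n)) (f : Coord n) (p : CP n) :
    intersectionMult X f p = locLength (idealOf X ⊔ Ideal.span {f}) p := rfl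

theorem length_quotient_eq_add_colon {R : Type*} [CommRing R] (𝔞 : Ideal R) (x : R) :
    Module.length R (R ⧸ 𝔞) =
      Module.length R (R ⧸ 𝔞.colon {x}) + Module.length R (R ⧸ (𝔞 ⊔ Ideal.span {x})) := by
  have hcomap : 𝔞.colon {x} = Submodule.comap (LinearMap.mulRight R x) 𝔞 := by
    ext a
    rw [Submodule.mem_colon_singleton]
    rfl
  have hle : 𝔞 ≤ 𝔞 ⊔ Ideal.span {x} := le_sup_left
  refine Module.length_eq_add_of_exact
    (Submodule.mapQ (𝔞.colon {x}) 𝔞 (LinearMap.mulRight R x) hcomap.le)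
    (Submodule.factor hle) ?_ (Submodule.factor_surjective hle) ?_
  · rw [← LinearMap.ker_eq_bot, Submodule.ker_mapQ, ← hcomap]
    simp
  · intro y
    obtain ⟨y, rfl⟩ := Submodule.mkQ_surjective _ y
    simp only [Set.mem_range]
    constructor
    · intro h
      have h2 : (Submodule.Quotient.mk y : R ⧸ (𝔞 ⊔ Ideal.span {x})) = 0 := h
      rw [Submodule.Quotient.mk_eq_zero] at h2
      obtain ⟨j, hj, z, hz, rfl⟩ := Submodule.mem_sup.1 h2
      obtain ⟨a, rfl⟩ := Ideal.mem_span_singleton'.1 hz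
      refine ⟨Submodule.Quotient.mk a, ?_⟩
      change Submodule.Quotient.mk (a * x) = Submodule.Quotient.mk _
      rw [eq_comm, Submodule.Quotient.eq]
      simpa using hj
    · rintro ⟨z, hz⟩
      obtain ⟨z, rfl⟩ := Submodule.mkQ_surjective _ z
      rw [← hz]
      change Submodule.Quotient.mk (z * x) = (0 : R ⧸ (𝔞 ⊔ Ideal.span {x}))
      rw [Submodule.Quotient.mk_eq_zero]
      exact Ideal.mem_sup_right (Ideal.mem_span_singleton'.2 ⟨z, rfl⟩)

theorem map_colon_singleton {R R' : Type*} [CommRing R] [CommRing R'] [Algebra R R']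
    (M : Submonoid R) [IsLocalization M R'] (J : Ideal R) (x : R) :
    (J.colon {x}).map (algebraMap R R') = (J.map (algebraMap R R')).colon {algebraMap R R' x} := by
  refine le_antisymm (Ideal.map_le_iff_le_comap.2 fun a ha => ?_) fun z hz => ?_
  · rw [Ideal.mem_comap, Submodule.mem_colon_singleton, smul_eq_mul, ← map_mul]
    exact Ideal.mem_map_of_mem _ (Submodule.mem_colon_singleton.1 ha)
  · obtain ⟨a, s, rfl⟩ := IsLocalization.exists_mk'_eq M z
    rw [Submodule.mem_colon_singleton, smul_eq_mul, mul_comm, IsLocalization.mul_mk'_eq_mk'_of_mul,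
      IsLocalization.mk'_mem_map_algebraMap_iff] at hz
    rw [IsLocalization.mk'_mem_map_algebraMap_iff]
    obtain ⟨c, hc, h⟩ := hz
    refine ⟨c, hc, ?_⟩
    rw [Submodule.mem_colon_singleton, smul_eq_mul]
    convert h using 1; ring

/-- The local counterpart of `hilbert_add_eq`. Colon ideals commute with localization, so both
invariants split along the same sequence. -/
theorem locLength_eq_add {n : ℕ} (J : Ideal (Coord n)) (x : Coord n) (p : CP n) :
    locLength J p = locLength (J.colon {x}) p + locLength (J ⊔ Ideal.span {x}) p := by
  rw [locLength, length_quotient_eq_add_colon _ (algebraMap _ _ x),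
    ← map_colon_singleton (pointIdeal p).primeCompl, locLength, locLength, Ideal.map_sup,
    Ideal.map_span, Set.image_singleton]

theorem locLength_eq_zero_iff {n : ℕ} {J : Ideal (Coord n)} {p : CP n} :
    locLength J p = 0 ↔ ¬ J ≤ pointIdeal p := by
  rw [locLength, Module.length_eq_zero_iff, Ideal.Quotient.subsingleton_iff, Ideal.eq_top_iff_one,
    ← map_one (algebraMap (Coord n) (Localization.AtPrime (pointIdeal p))),
    IsLocalization.algebraMap_mem_map_algebraMap_iff (pointIdeal p).primeCompl, SetLike.not_le_iff_exists]
  simp only [mul_one]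
  exact ⟨fun ⟨m, h1, h2⟩ => ⟨m, h2, h1⟩, fun ⟨m, h1, h2⟩ => ⟨m, h2, h1⟩⟩

theorem locLength_pointIdeal {n : ℕ} (p : CP n) : locLength (pointIdeal p) p = 1 := by
  rw [locLength, Localization.AtPrime.map_eq_maximalIdeal, Module.length_eq_one_iff,
    isSimpleModule_iff_isCoatom]
  exact Ideal.isMaximal_def.1 inferInstance

theorem pointIdeal_le_iff {n : ℕ} {p q : CP n} : pointIdeal p ≤ pointIdeal q ↔ p = q := by
  refine ⟨fun h => ?_, fun h => h ▸ le_rfl⟩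
  by_contra hne
  obtain ⟨f, hf, h1, h2⟩ := exists_linear_ne hne
  exact h2 ((mem_pointIdeal_of_isHomogeneous hf).1
    (h ((mem_pointIdeal_of_isHomogeneous hf).2 h1)))

/-! ### Homogeneous ideals with finitely many zeros -/

/-- An associated prime: among the ideals J : x, with x a form outside J, a maximal one is prime. -/
theorem IsHomog.exists_colon_isPrime {n : ℕ} {J : Ideal (Coord n)} (hJ : IsHomog J)
    (h1 : J ≠ ⊤) : ∃ (e : ℕ) (x : Coord n), x.IsHomogeneous e ∧ x ∉ J ∧
      (J.colon {x}).IsPrime := by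
  let 𝒮 : Set (Ideal (Coord n)) :=
    {Q | ∃ (e : ℕ) (x : Coord n), x.IsHomogeneous e ∧ x ∉ J ∧ J.colon {x} = Q}
  have hne : 𝒮.Nonempty := ⟨_, 0, 1, isHomogeneous_one _ _, (Ideal.ne_top_iff_one J).1 h1, rfl⟩
  obtain ⟨_, ⟨e, x, hx, hxJ, rfl⟩, hmax⟩ :=
    set_has_maximal_iff_noetherian.2 (inferInstance : IsNoetherian (Coord n) (Coord n)) 𝒮 hne
  refine ⟨e, x, hx, hxJ, (hJ.colon hx).isPrime ?_ ?_⟩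
  · rw [Ideal.ne_top_iff_one, Submodule.mem_colon_singleton, one_smul]
    exact hxJ
  · intro a b f g hf hg hfg
    by_contra! hcon
    have hgx : g * x ∉ J := by
      have := hcon.2
      rwa [Submodule.mem_colon_singleton, smul_eq_mul] at this
    refine hmax _ ⟨b + e, g * x, hg.mul hx, hgx, rfl⟩ ?_
    refine lt_of_le_of_ne (fun c hc => ?_) fun h => hcon.1 ?_
    · rw [Submodule.mem_colon_singleton, smul_eq_mul] at *
      convert J.mul_mem_left g hc using 1; ring
    · rw [h, Submodule.mem_colon_singleton, smul_eq_mul]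
      rw [Submodule.mem_colon_singleton, smul_eq_mul] at hfg
      convert hfg using 1; ring

theorem CP.HasCoords.mem_pointIdeal_iff {n : ℕ} {p : CP n} {v : Fin (n + 1) → ℂ}
    (h : p.HasCoords v) {f : Coord n} (hf : f ∈ pointIdeal p) : eval v f = 0 := by
  obtain ⟨c, -, rfl⟩ := p.hasCoords_rep.eq_smul h
  exact mem_pointIdeal.1 hf c

theorem IsHomog.le_pointIdeal {n : ℕ} {J : Ideal (Coord n)} (hJ : IsHomog J) {p : CP n}
    {v : Fin (n + 1) → ℂ} (h : p.HasCoords v) (hv : ∀ f ∈ J, eval v f = 0) : J ≤ pointIdeal p :=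
  hJ.le_of_forall fun e f hf hfe => by
    rw [mem_pointIdeal_of_isHomogeneous hfe, h.eval_eq_zero_iff hfe]
    exact hv f hf

/-- Nullstellensatz: otherwise some form variable times a product of elements outside Q, one for
each point of E, vanishes at every zero of Q, hence lies in Q, against primality. -/
theorem IsHomog.eq_pointIdeal_or {n : ℕ} {Q : Ideal (Coord n)} (hQ : IsHomog Q) [Q.IsPrime]
    {E : Finset (CP n)} (hE : ∀ p, Q ≤ pointIdeal p → p ∈ E) :
    (∃ p ∈ E, Q = pointIdeal p) ∨ ∀ i, X i ∈ Q := by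
  by_contra! hcon
  obtain ⟨hne, i, hi⟩ := hcon
  have : ∀ p : CP n, ∃ g : Coord n, p ∈ E → g ∉ Q ∧ (Q ≤ pointIdeal p → g ∈ pointIdeal p) := by
    intro p
    by_cases hp : p ∈ E
    · by_cases hle : Q ≤ pointIdeal p
      · obtain ⟨g, hg, hgQ⟩ := SetLike.not_le_iff_exists.1
          (fun h => hne p hp (le_antisymm hle h))
        exact ⟨g, fun _ => ⟨hgQ, fun _ => hg⟩⟩
      · exact ⟨1, fun _ => ⟨(Ideal.ne_top_iff_one Q).1 (Ideal.IsPrime.ne_top inferInstance),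
          fun h => absurd h hle⟩⟩
    · exact ⟨0, fun h => absurd h hp⟩
  choose g hg using this
  have hprod : (∏ p ∈ E, g p) ∉ Q := by
    rw [Ideal.IsPrime.prod_mem_iff]
    push Not
    exact fun p hp => (hg p hp).1
  refine (Ideal.IsPrime.mem_or_mem (I := Q) inferInstance ?_).elim hprod hi
  rw [← IsPrime.vanishingIdeal_zeroLocus (K := ℂ) Q, mem_vanishingIdeal_iff]
  intro v hv
  rw [map_mul]
  by_cases h0 : v = 0
  · simp [h0]
  · have hpc := CP.hasCoords_mk v h0
    have hle := hQ.le_pointIdeal hpc fun f hf => by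
      simpa [aeval_eq_eval] using mem_zeroLocus_iff.1 hv f hf
    have hpE := hE _ hle
    have : eval v (g (CP.mk v h0)) = 0 := hpc.mem_pointIdeal_iff ((hg _ hpE).2 hle)
    rw [map_prod, Finset.prod_eq_zero hpE (by simpa [aeval_eq_eval] using this), zero_mul]

theorem isHomogeneous_mem_of_X_mem {n : ℕ} {Q : Ideal (Coord n)} (h : ∀ i, X i ∈ Q) {t : ℕ}
    (ht : 0 < t) {f : Coord n} (hf : f.IsHomogeneous t) : f ∈ Q := by
  rw [← support_sum_monomial_coeff f]
  refine Ideal.sum_mem _ fun d hd => ?_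
  have hdeg := hf.degree_eq_sum_deg_support hd
  have hd0 : d ≠ 0 := by
    rintro rfl
    simp at hdeg
    omega
  obtain ⟨i, hi⟩ := Finsupp.ne_iff.1 hd0
  have : (monomial d (coeff d f) : Coord n) =
      monomial (d - Finsupp.single i 1) (coeff d f) * X i := by
    rw [X, monomial_mul, mul_one, tsub_add_cancel_of_le]
    simpa [Nat.one_le_iff_ne_zero] using hi
  rw [this]
  exact Q.mul_mem_left _ (h i)

/-- The Hilbert polynomial of a homogeneous ideal with finitely many zeros is the sum of the
local lengths. -/
theorem IsHomog.eventually_hilbert_eq {n : ℕ} {J : Ideal (Coord n)} (hJ : IsHomog J)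
    {E : Finset (CP n)} (hE : ∀ p, J ≤ pointIdeal p → p ∈ E) :
    ∀ᶠ t in Filter.atTop, (hilbert J t : ℕ∞) = ∑ p ∈ E, locLength J p := by
  classical
  -- Noetherian induction: J + (x) is larger than J, and Q = J : x is prime. Either Q is the ideal
  -- of a point, with Hilbert function and local length both 1 there, or it contains all variables
  -- and contributes nothing to either side in large degree.
  induction J using WellFoundedGT.induction with
  | ind J ih =>
  by_cases h1 : J = ⊤
  · refine Filter.Eventually.of_forall fun t => ?_
    rw [hilbert_eq_zero (fun f _ => h1 ▸ Submodule.mem_top), Finset.sum_eq_zero]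
    · rfl
    · intro p _
      rw [locLength_eq_zero_iff, h1]
      exact fun h => (Ideal.IsPrime.ne_top (I := pointIdeal p) inferInstance) (top_le_iff.1 h)
  obtain ⟨e, x, hx, hxJ, hprime⟩ := hJ.exists_colon_isPrime h1
  have hlt : J < J ⊔ Ideal.span {x} := by
    refine lt_of_le_of_ne le_sup_left fun h => hxJ ?_
    rw [h]
    exact Ideal.mem_sup_right (Ideal.mem_span_singleton_self x)
  have ih' := ih _ hlt (hJ.sup (isHomog_span_singleton hx))
    (fun p hp => hE p (le_sup_left.trans hp))
  have hJQ : J ≤ J.colon {x} := fun a ha => by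
    rw [Submodule.mem_colon_singleton, smul_eq_mul]
    exact J.mul_mem_right _ ha
  have hQ : ∀ᶠ t in Filter.atTop,
      (hilbert (J.colon {x}) t : ℕ∞) = ∑ p ∈ E, locLength (J.colon {x}) p := by
    rcases (hJ.colon hx).eq_pointIdeal_or (fun p hp => hE p (hJQ.trans hp)) with ⟨p, hp, h⟩ | h
    · refine Filter.Eventually.of_forall fun t => ?_
      rw [h, hilbert_pointIdeal, Finset.sum_eq_single p, locLength_pointIdeal]
      · rfl
      · intro q _ hq
        rw [locLength_eq_zero_iff, pointIdeal_le_iff]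
        exact fun h => hq h.symm
      · exact fun h => absurd hp h
    · filter_upwards [Filter.eventually_gt_atTop 0] with t ht
      rw [hilbert_eq_zero (fun f hf => isHomogeneous_mem_of_X_mem h ht hf), Finset.sum_eq_zero]
      · rfl
      · intro p _
        rw [locLength_eq_zero_iff]
        obtain ⟨i, hi⟩ : ∃ i, p.rep i ≠ 0 := Function.ne_iff.1 p.rep_ne_zero
        intro hle
        exact hi (by simpa using (mem_pointIdeal_of_isHomogeneous (isHomogeneous_X _ i)).1 (hle (h i)))
  filter_upwards [ih', (Filter.tendsto_sub_atTop_nat e).eventually hQ,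
    Filter.eventually_ge_atTop e] with t h2 h3 ht
  have h4 := hilbert_add_eq hJ hx (t - e)
  rw [Nat.sub_add_cancel ht] at h4
  rw [h4, Nat.cast_add, h2, h3, add_comm, ← Finset.sum_add_distrib]
  exact Finset.sum_congr rfl fun p _ => (locLength_eq_add J x p).symm

end SphericalCurve

/-! ### Curves: growth of the Hilbert function, components, regular forms and Bézout. -/

namespace SphericalCurve

open MvPolynomial Filter

theorem hilbert_eq_zero_iff {n t : ℕ} {J : Ideal (Coord n)} :
    hilbert J t = 0 ↔ ∀ f : Coord n, f.IsHomogeneous t → f ∈ J := by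
  refine ⟨fun h f hf => ?_, hilbert_eq_zero⟩
  have : Subsingleton (homogeneousSubmodule (Fin (n + 1)) ℂ t ⧸ gradedPiece J t) :=
    Module.finrank_zero_iff.1 h
  have h2 : (⟨f, hf⟩ : homogeneousSubmodule (Fin (n + 1)) ℂ t) ∈ gradedPiece J t := by
    rw [← Submodule.Quotient.mk_eq_zero]
    exact Subsingleton.elim _ _
  exact h2

/-- A homogeneous ideal without zeros contains all forms of large degree. -/
theorem IsHomog.eventually_mem {n : ℕ} {J : Ideal (Coord n)} (hJ : IsHomog J)
    (h : ∀ p, ¬ J ≤ pointIdeal p) :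
    ∀ᶠ t in atTop, ∀ f : Coord n, f.IsHomogeneous t → f ∈ J := by
  have := hJ.eventually_hilbert_eq (E := ∅) (fun p hp => absurd hp (h p))
  filter_upwards [this] with t ht
  rw [← hilbert_eq_zero_iff]
  simpa using ht

/-- If `J` has no zeros on the hyperplane `ζ = 0`, every form of large degree is a multiple of a
power of `ζ` modulo `J`. -/
theorem IsHomog.eventually_exists_sub_mem {n : ℕ} {J : Ideal (Coord n)} (hJ : IsHomog J)
    {ζ : Coord n} (hζ : ζ.IsHomogeneous 1) (h : ∀ p, J ≤ pointIdeal p → eval p.rep ζ ≠ 0) :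
    ∀ᶠ t in atTop, ∀ (M : ℕ) (f : Coord n), f.IsHomogeneous (t + M) →
      ∃ g, g.IsHomogeneous t ∧ f - ζ ^ M * g ∈ J := by
  have hmem := (hJ.sup (isHomog_span_singleton hζ)).eventually_mem (fun p hp => by
    rw [sup_le_iff, Ideal.span_singleton_le_iff_mem, mem_pointIdeal_of_isHomogeneous hζ] at hp
    exact h p hp.1 hp.2)
  obtain ⟨t₀, ht₀⟩ := eventually_atTop.1 hmem
  filter_upwards [eventually_ge_atTop t₀] with t ht M
  induction M with
  | zero => exact fun f hf => ⟨f, hf, by simp⟩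
  | succ M ih =>
    intro f hf
    obtain ⟨a, ha, haf⟩ := hJ.exists_of_mem_sup_span hζ (t := t + M) hf
      (ht₀ (t + (M + 1)) (by omega) f hf)
    obtain ⟨g, hg, hga⟩ := ih a ha
    refine ⟨g, hg, ?_⟩
    have : f - ζ ^ (M + 1) * g = (f - a * ζ) + ζ * (a - ζ ^ M * g) := by ring
    rw [this]
    exact J.add_mem haf (J.mul_mem_left _ hga)

/-! ### Linear growth of the Hilbert function -/

/-- The Hilbert function of `X` is bounded by a linear function. -/
def HasLinearGrowth {n : ℕ} (X : Set (CP n)) : Prop :=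
  ∃ C D : ℕ, ∀ᶠ t in atTop, hilbertFunction X t ≤ C * t + D

theorem HasLinearGrowth.mono {n : ℕ} {X Y : Set (CP n)} (h : HasLinearGrowth Y) (hXY : X ⊆ Y) :
    HasLinearGrowth X := by
  obtain ⟨C, D, h⟩ := h
  exact ⟨C, D, h.mono fun t ht => (hilbert_anti (idealOf_anti hXY) t).trans ht⟩

theorem HasDegree.hasLinearGrowth {n e : ℕ} {X : Set (CP n)} (h : HasDegree X e) :
    HasLinearGrowth X := by
  obtain ⟨c, h⟩ := h
  refine ⟨e, c.natAbs, h.mono fun t ht => ?_⟩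
  zify
  rw [ht]
  gcongr
  exact le_abs_self c

theorem idealOf_colon_of_isPrime {n : ℕ} {Z : Set (CP n)} (hZ : IsIrreducible Z) {f : Coord n}
    (hf : f ∉ idealOf Z) : (idealOf Z).colon {f} = idealOf Z := by
  have := idealOf_isPrime hZ
  ext g
  rw [Submodule.mem_colon_singleton, smul_eq_mul]
  exact ⟨fun h => (this.mem_or_mem h).resolve_right hf, fun h => Ideal.mul_mem_right _ _ h⟩

theorem card_le_hilbert_idealOf {n : ℕ} (F : Finset (CP n)) :
    ∀ᶠ t in atTop, F.card ≤ hilbert (idealOf (F : Set (CP n))) t := by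
  have hcl : IsClosed (F : Set (CP n)) := F.finite_toSet.isClosed
  have := (isHomog_idealOf (F : Set (CP n))).eventually_hilbert_eq (E := F)
    (fun p hp => mem_of_idealOf_le_pointIdeal hcl hp)
  filter_upwards [this] with t ht
  have h1 : ((F.card : ℕ) : ℕ∞) ≤ hilbert (idealOf (F : Set (CP n))) t := by
    rw [ht, Finset.card_eq_sum_ones, Nat.cast_sum]
    refine Finset.sum_le_sum fun p hp => ?_
    rw [Nat.cast_one, Order.one_le_iff_pos, pos_iff_ne_zero, Ne, locLength_eq_zero_iff, not_not]
    exact idealOf_le_pointIdeal hp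
  exact_mod_cast h1

/-- A substitute for dimension theory: a form vanishing on W but not on Z is a nonzerodivisor modulo
I(Z), and each multiplication by it enlarges the Hilbert function by at least the number of points
available in W. An infinite W would make the growth exceed any linear bound. -/
theorem HasLinearGrowth.finite_of_ssubset {n : ℕ} {Z W : Set (CP n)} (hg : HasLinearGrowth Z)
    (hZ : IsIrreducible Z) (hW : IsClosed W) (hWZ : W ⊂ Z) : W.Finite := by
  by_contra hinf
  obtain ⟨C, D, hCD⟩ := hg
  obtain ⟨p, hpZ, hpW⟩ := Set.exists_of_ssubset hWZ
  obtain ⟨m, f, hf, hfW, hfp⟩ := isClosed_iff_forall_exists.1 hW p hpW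
  have hfZ : f ∉ idealOf Z := fun h => hfp ((mem_idealOf_of_isHomogeneous hf).1 h p hpZ)
  -- With C m + 1 points, each shift of the degree by m gains more than the C m that the bound
  -- allows.
  obtain ⟨F, hFW, hFc⟩ := Set.Infinite.exists_subset_card_eq hinf (C * m + 1)
  have hle : idealOf Z ⊔ Ideal.span {f} ≤ idealOf (F : Set (CP n)) := by
    rw [sup_le_iff, Ideal.span_singleton_le_iff_mem]
    exact ⟨idealOf_anti (hFW.trans hWZ.subset),
      (mem_idealOf_of_isHomogeneous hf).2 fun q hq => hfW q (hFW hq)⟩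
  obtain ⟨t₀, ht₀⟩ := eventually_atTop.1 ((card_le_hilbert_idealOf F).and hCD)
  have step : ∀ t, t₀ ≤ t → hilbert (idealOf Z) t + (C * m + 1) ≤ hilbert (idealOf Z) (t + m) := by
    intro t ht
    rw [hilbert_add_eq (isHomog_idealOf Z) hf t, idealOf_colon_of_isPrime hZ hfZ]
    have h1 := (ht₀ (t + m) (by omega)).1
    have h2 := hilbert_anti hle (t + m)
    omega
  have many : ∀ j, j * (C * m + 1) ≤ hilbert (idealOf Z) (t₀ + j * m) := by
    intro j
    induction j with
    | zero => simp
    | succ j ih =>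
      have := step (t₀ + j * m) (by omega)
      rw [show t₀ + (j + 1) * m = t₀ + j * m + m by ring]
      linarith
  -- Each shift beats the bound by one, so this many of them exceed the initial slack C t₀ + D.
  have h1 := many (C * t₀ + D + 1)
  have h2 := (ht₀ (t₀ + (C * t₀ + D + 1) * m) (by omega)).2
  rw [hilbertFunction_eq] at h2
  nlinarith

/-! ### Curves as finite unions of irreducible closed sets -/

/-- `X` is a finite union of irreducible closed sets with infinitely many real points. -/
def HasRealComponents {n : ℕ} (X : Set (CP n)) : Prop :=
  ∃ 𝒵 : Set (Set (CP n)), 𝒵.Finite ∧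
    (∀ Z ∈ 𝒵, IsClosed Z ∧ IsIrreducible Z ∧ (Z ∩ realPoints n).Infinite) ∧ X = ⋃₀ 𝒵

theorem exists_subset_of_isIrreducible {n : ℕ} {𝒵 : Set (Set (CP n))} (hfin : 𝒵.Finite)
    (hcl : ∀ Z ∈ 𝒵, IsClosed Z) {W : Set (CP n)} (hW : IsIrreducible W) (h : W ⊆ ⋃₀ 𝒵) :
    ∃ Z ∈ 𝒵, W ⊆ Z := by
  lift 𝒵 to Finset (Set (CP n)) using hfin
  exact isIrreducible_iff_sUnion_isClosed.1 hW 𝒵 hcl h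

/-- The maximal members of any finite decomposition into irreducible closed sets are irreducible
components, so they inherit the infinitely many real points. -/
theorem IsRealCurve.hasRealComponents {n : ℕ} {X : Set (CP n)} (h : IsRealCurve X) :
    HasRealComponents X := by
  obtain ⟨S, hSfin, hScl, hSirr, rfl⟩ :=
    TopologicalSpace.NoetherianSpace.exists_finite_set_isClosed_irreducible h.isClosed
  refine ⟨{Z | Maximal (· ∈ S) Z}, hSfin.subset fun Z hZ => hZ.prop, fun Z hZ => ?_, ?_⟩
  · refine ⟨hScl Z hZ.prop, hSirr Z hZ.prop, h.infinite_real Z ⟨⟨hSirr Z hZ.prop,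
      Set.subset_sUnion_of_mem hZ.prop⟩, fun W hW hZW => ?_⟩⟩
    obtain ⟨T, hT, hWT⟩ := exists_subset_of_isIrreducible hSfin hScl hW.1 hW.2
    exact hWT.trans (hZ.le_of_ge hT (hZW.trans hWT))
  · refine Set.Subset.antisymm ?_ (Set.sUnion_subset_sUnion fun Z hZ => hZ.prop)
    rintro p ⟨Z, hZ, hp⟩
    obtain ⟨T, hZT, hT⟩ := hSfin.exists_le_maximal hZ
    exact ⟨T, hT, hZT hp⟩

theorem HasRealComponents.isClosed {n : ℕ} {X : Set (CP n)} (h : HasRealComponents X) :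
    IsClosed X := by
  obtain ⟨𝒵, hfin, h𝒵, rfl⟩ := h
  rw [Set.sUnion_eq_biUnion]
  exact hfin.isClosed_biUnion fun Z hZ => (h𝒵 Z hZ).1

/-- A finite irreducible set in a T1 space is a single point, so every maximal chain of irreducible
closed sets is a point inside T. -/
theorem topologicalKrullDim_eq_one {n : ℕ} {T : Set (CP n)} (hcl : IsClosed T)
    (hirr : IsIrreducible T) (hinf : T.Infinite)
    (hfin : ∀ W : Set (CP n), IsClosed W → W ⊂ T → W.Finite) : topologicalKrullDim T = 1 := by
  refine le_antisymm (Order.krullDim_le_one_iff.2 fun A => ?_) (Order.one_le_krullDim_iff.2 ?_)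
  · by_cases hA : (A : Set T) = Set.univ
    · right
      intro B _ x _
      have : x ∈ (A : Set T) := hA ▸ Set.mem_univ x
      exact this
    · left
      have hAcl : IsClosed ((↑) '' (A : Set T) : Set (CP n)) :=
        hcl.isClosedEmbedding_subtypeVal.isClosedMap _ A.isClosed'
      have hAfin : (A : Set T).Finite := by
        refine Set.Finite.of_finite_image (hfin _ hAcl ?_) Subtype.val_injective.injOn
        refine ⟨by rintro _ ⟨x, -, rfl⟩; exact x.2, fun h => hA (Set.eq_univ_of_forall fun x => ?_)⟩
        obtain ⟨y, hy, hyx⟩ := h x.2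
        rwa [← Subtype.ext hyx]
      obtain ⟨a, hAa⟩ : ∃ a, (A : Set T) ⊆ {a} := by
        classical
        obtain ⟨z, hz, hAz⟩ := isIrreducible_iff_sUnion_isClosed.1 A.isIrreducible'
          (hAfin.toFinset.image fun a => {a}) (by
            intro z hz
            obtain ⟨a, -, rfl⟩ := Finset.mem_image.1 hz
            exact isClosed_singleton) (fun a ha => ⟨{a}, Finset.mem_coe.2
            (Finset.mem_image_of_mem _ (hAfin.mem_toFinset.2 ha)), rfl⟩)
        obtain ⟨a, -, rfl⟩ := Finset.mem_image.1 hz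
        exact ⟨a, hAz⟩
      intro B hBA
      obtain ⟨b, hb⟩ := B.isIrreducible'.nonempty
      intro x hx
      have h1 := hAa hx
      have h2 := hAa (hBA hb)
      rw [Set.mem_singleton_iff] at h1 h2
      rw [h1, ← h2]
      exact hb
  · have : IrreducibleSpace T := isIrreducible_iff_irreducibleSpace.1 hirr
    obtain ⟨p, hp⟩ := hirr.nonempty
    refine ⟨⟨{⟨p, hp⟩}, isIrreducible_singleton, isClosed_singleton⟩,
      ⟨Set.univ, IrreducibleSpace.isIrreducible_univ _, isClosed_univ⟩, ?_⟩
    refine lt_of_le_of_ne (fun _ _ => Set.mem_univ _) fun h => ?_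
    have h1 : ({⟨p, hp⟩} : Set T) = Set.univ := congrArg TopologicalSpace.IrreducibleCloseds.carrier h
    refine hinf ((Set.finite_singleton p).subset fun q hq => ?_)
    have : (⟨q, hq⟩ : T) ∈ ({⟨p, hp⟩} : Set T) := h1 ▸ Set.mem_univ _
    exact congrArg Subtype.val (Set.mem_singleton_iff.1 this)

theorem HasRealComponents.isRealCurve {n : ℕ} {X : Set (CP n)} (h : HasRealComponents X)
    (hne : X.Nonempty) (hg : HasLinearGrowth X) : IsRealCurve X := by
  have hcl := h.isClosed
  obtain ⟨𝒵, hfin, h𝒵, rfl⟩ := h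
  have key : ∀ Z ∈ components (⋃₀ 𝒵), Z ∈ 𝒵 := by
    intro Z (hZ : Maximal (fun W : Set (CP n) => IsIrreducible W ∧ W ⊆ ⋃₀ 𝒵) Z)
    obtain ⟨T, hT, hZT⟩ := exists_subset_of_isIrreducible hfin (fun Z hZ => (h𝒵 Z hZ).1)
      hZ.prop.1 hZ.prop.2
    rwa [hZT.antisymm (hZ.le_of_ge ⟨(h𝒵 T hT).2.1, Set.subset_sUnion_of_mem hT⟩ hZT)]
  refine { isClosed := hcl, nonempty := hne, dim_eq_one := fun Z hZ => ?_,
           infinite_real := fun Z hZ => (h𝒵 Z (key Z hZ)).2.2 }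
  obtain ⟨h1, h2, h3⟩ := h𝒵 Z (key Z hZ)
  exact topologicalKrullDim_eq_one h1 h2 (h3.mono Set.inter_subset_left) fun W hW hWZ =>
    (hg.mono (Set.subset_sUnion_of_mem (key Z hZ))).finite_of_ssubset h2 hW hWZ

/-! ### Regular forms on a curve -/

/-- `f` is a nonzerodivisor on the homogeneous coordinate ring of `X`. -/
def IsRegularOn {n : ℕ} (f : Coord n) (X : Set (CP n)) : Prop :=
  ∀ g, g * f ∈ idealOf X → g ∈ idealOf X

theorem IsRegularOn.colon {n : ℕ} {f : Coord n} {X : Set (CP n)} (h : IsRegularOn f X) :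
    (idealOf X).colon {f} = idealOf X := by
  ext g
  rw [Submodule.mem_colon_singleton, smul_eq_mul]
  exact ⟨h g, fun hg => Ideal.mul_mem_right _ _ hg⟩

theorem IsRegularOn.mul {n : ℕ} {f g : Coord n} {X : Set (CP n)} (hf : IsRegularOn f X)
    (hg : IsRegularOn g X) : IsRegularOn (f * g) X :=
  fun a ha => hf a (hg _ (by rwa [mul_assoc]))

theorem IsRegularOn.pow_mul_mem {n : ℕ} {f g : Coord n} {X : Set (CP n)} (hf : IsRegularOn f X)
    {k : ℕ} (h : f ^ k * g ∈ idealOf X) : g ∈ idealOf X := by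
  induction k with
  | zero => simpa using h
  | succ k ih => exact ih (hf _ (by convert h using 1; ring))

theorem hasFiniteZeros_of_forall {n : ℕ} {𝒵 : Set (Set (CP n))} (hfin : 𝒵.Finite)
    (h𝒵 : ∀ Z ∈ 𝒵, IsClosed Z ∧ IsIrreducible Z) (hg : HasLinearGrowth (⋃₀ 𝒵)) {e : ℕ}
    {f : Coord n} (hf : f.IsHomogeneous e) (hne : ∀ Z ∈ 𝒵, ∃ z ∈ Z, eval z.rep f ≠ 0) :
    {p | p ∈ ⋃₀ 𝒵 ∧ eval p.rep f = 0}.Finite := by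
  have : {p | p ∈ ⋃₀ 𝒵 ∧ eval p.rep f = 0} = ⋃ Z ∈ 𝒵, Z ∩ {p | eval p.rep f = 0} := by
    ext p
    simp only [Set.mem_sUnion, Set.mem_ofPred_eq, Set.mem_iUnion, Set.mem_inter_iff, exists_prop]
    tauto
  rw [this]
  refine hfin.biUnion fun Z hZ => ?_
  refine (hg.mono (Set.subset_sUnion_of_mem hZ)).finite_of_ssubset (h𝒵 Z hZ).2
    ((h𝒵 Z hZ).1.inter (isClosed_zeros hf)) ⟨Set.inter_subset_left, fun h => ?_⟩
  obtain ⟨z, hz, hzf⟩ := hne Z hZ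
  exact hzf (h hz).2

/-- There are finitely many real points, outside a given finite set, such that a form that
vanishes at none of them is regular and has finitely many zeros on `X`. -/
theorem HasRealComponents.exists_test_points {n : ℕ} {X : Set (CP n)} (h : HasRealComponents X)
    (hg : HasLinearGrowth X) {B : Set (CP n)} (hB : B.Finite) :
    ∃ P : Set (CP n), P.Finite ∧ P ⊆ X ∩ realPoints n ∧ Disjoint P B ∧ (X.Nonempty → P.Nonempty) ∧
      ∀ (e : ℕ) (f : Coord n), f.IsHomogeneous e → (∀ z ∈ P, eval z.rep f ≠ 0) →
        IsRegularOn f X ∧ {p | p ∈ X ∧ eval p.rep f = 0}.Finite := by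
  obtain ⟨𝒵, hfin, h𝒵, rfl⟩ := h
  have : ∀ Z : Set (CP n), ∃ z, Z ∈ 𝒵 → z ∈ (Z ∩ realPoints n) \ B := by
    intro Z
    by_cases hZ : Z ∈ 𝒵
    · obtain ⟨z, hz⟩ := ((h𝒵 Z hZ).2.2.sdiff hB).nonempty
      exact ⟨z, fun _ => hz⟩
    · exact ⟨CP.mk (fun _ => 1) (fun h => one_ne_zero (congrFun h 0)), fun h => absurd h hZ⟩
  choose z hz using this
  refine ⟨z '' 𝒵, hfin.image z, ?_, ?_, ?_, ?_⟩
  · rintro _ ⟨Z, hZ, rfl⟩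
    exact ⟨⟨Z, hZ, (hz Z hZ).1.1⟩, (hz Z hZ).1.2⟩
  · rw [Set.disjoint_left]
    rintro _ ⟨Z, hZ, rfl⟩
    exact (hz Z hZ).2
  · rintro ⟨p, Z, hZ, -⟩
    exact ⟨_, Z, hZ, rfl⟩
  · intro e f hf hne
    have hne' : ∀ Z ∈ 𝒵, ∃ z ∈ Z, eval z.rep f ≠ 0 := fun Z hZ =>
      ⟨z Z, (hz Z hZ).1.1, hne _ ⟨Z, hZ, rfl⟩⟩
    refine ⟨fun g hgf => ?_, hasFiniteZeros_of_forall hfin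
      (fun Z hZ => ⟨(h𝒵 Z hZ).1, (h𝒵 Z hZ).2.1⟩) hg hf hne'⟩
    rw [mem_idealOf_sUnion] at *
    intro Z hZ
    obtain ⟨z, hzZ, hzf⟩ := hne' Z hZ
    exact ((idealOf_isPrime (h𝒵 Z hZ).2.1).mem_or_mem (hgf Z hZ)).resolve_right fun h =>
      hzf ((mem_idealOf_of_isHomogeneous hf).1 h z hzZ)

/-! ### Bézout's theorem -/

theorem sup_span_le_pointIdeal_iff {n e : ℕ} {X : Set (CP n)} (hX : IsClosed X) {f : Coord n}
    (hf : f.IsHomogeneous e) {p : CP n} :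
    idealOf X ⊔ Ideal.span {f} ≤ pointIdeal p ↔ p ∈ X ∧ eval p.rep f = 0 := by
  rw [sup_le_iff, Ideal.span_singleton_le_iff_mem, mem_pointIdeal_of_isHomogeneous hf]
  exact and_congr_left' ⟨mem_of_idealOf_le_pointIdeal hX, idealOf_le_pointIdeal⟩

theorem HasDegree.eventually_hilbert_sup_span {n e s : ℕ} {X : Set (CP n)} (h : HasDegree X e)
    {f : Coord n} (hf : f.IsHomogeneous s) (hreg : IsRegularOn f X) :
    ∀ᶠ t in atTop, hilbert (idealOf X ⊔ Ideal.span {f}) t = s * e := by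
  obtain ⟨c, hc⟩ := h
  filter_upwards [hc, (tendsto_sub_atTop_nat s).eventually hc, eventually_ge_atTop s] with t h1 h2 ht
  have h3 := hilbert_add_eq (isHomog_idealOf X) hf (t - s)
  rw [hreg.colon, Nat.sub_add_cancel ht] at h3
  rw [hilbertFunction_eq] at h1 h2
  zify [ht] at h3 h1 h2 ⊢
  rw [h1, h2] at h3
  linear_combination -h3

/-- A converse to the count in Bézout: the Hilbert function of a regular hyperplane section is the
first difference of that of X, so if it is eventually constant, its value is the slope. -/
theorem hasDegree_of_eventually_hilbert_sup_span {n N : ℕ} {X : Set (CP n)} {h : Coord n}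
    (hh : h.IsHomogeneous 1) (hreg : IsRegularOn h X)
    (hN : ∀ᶠ t in atTop, hilbert (idealOf X ⊔ Ideal.span {h}) t = N) : HasDegree X N := by
  obtain ⟨t₀, ht₀⟩ := eventually_atTop.1 hN
  refine ⟨hilbertFunction X t₀ - N * t₀, eventually_atTop.2 ⟨t₀, fun t ht => ?_⟩⟩
  induction t, ht using Nat.le_induction with
  | base => ring
  | succ t ht ih =>
    have h3 := hilbert_add_eq (isHomog_idealOf X) hh t
    rw [hreg.colon, ht₀ (t + 1) (by omega)] at h3
    rw [hilbertFunction_eq] at *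
    rw [h3]
    push_cast
    rw [ih]
    ring

/-- Bézout's theorem for a curve and a hypersurface. -/
theorem HasDegree.sum_intersectionMult {n e s : ℕ} {X : Set (CP n)} (h : HasDegree X e)
    (hX : IsClosed X) {f : Coord n} (hf : f.IsHomogeneous s) (hreg : IsRegularOn f X)
    {E : Finset (CP n)} (hE : ∀ p ∈ X, eval p.rep f = 0 → p ∈ E) :
    ∑ p ∈ E, intersectionMult X f p = (s * e : ℕ) := by
  have h1 := ((isHomog_idealOf X).sup (isHomog_span_singleton hf)).eventually_hilbert_eq (E := E)
    (fun p hp => by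
      rw [sup_span_le_pointIdeal_iff hX hf] at hp
      exact hE p hp.1 hp.2)
  obtain ⟨t, h2, h3⟩ := (h1.and (h.eventually_hilbert_sup_span hf hreg)).exists
  rw [← h3, h2]
  rfl

theorem HasDegree.unique {n e e' : ℕ} {X : Set (CP n)} (h : HasDegree X e)
    (h' : HasDegree X e') : e = e' := by
  obtain ⟨c, hc⟩ := h
  obtain ⟨c', hc'⟩ := h'
  have h1 := hc.and hc'
  obtain ⟨t₀, ht₀⟩ := eventually_atTop.1 h1
  have h2 := ht₀ t₀ le_rfl
  have h3 := ht₀ (t₀ + 1) (by omega)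
  zify
  push_cast at *
  linarith [h2.1, h2.2, h3.1, h3.2]

end SphericalCurve

/-! ### Localization at a point within the graded ring, and birational correspondences. -/

namespace SphericalCurve

open MvPolynomial Filter

/-! ### The part of a homogeneous ideal at a point -/

/-- The forms that lie in `J` up to a factor that does not vanish at `p`. -/
def localPart {n : ℕ} (J : Ideal (Coord n)) (p : CP n) : Ideal (Coord n) where
  carrier := {g | ∃ (e : ℕ) (s : Coord n), s.IsHomogeneous e ∧ s ∉ pointIdeal p ∧ s * g ∈ J}
  zero_mem' := ⟨0, 1, isHomogeneous_one _ _,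
    (Ideal.ne_top_iff_one _).1 (Ideal.IsPrime.ne_top inferInstance), by simp⟩
  add_mem' := by
    rintro a b ⟨e, s, hs, hsp, hsa⟩ ⟨e', s', hs', hsp', hsb⟩
    refine ⟨e + e', s * s', hs.mul hs', fun h =>
      ((inferInstance : (pointIdeal p).IsPrime).mem_or_mem h).elim hsp hsp', ?_⟩
    have : s * s' * (a + b) = s' * (s * a) + s * (s' * b) := by ring
    rw [this]
    exact J.add_mem (J.mul_mem_left _ hsa) (J.mul_mem_left _ hsb)
  smul_mem' := by
    rintro c a ⟨e, s, hs, hsp, hsa⟩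
    refine ⟨e, s, hs, hsp, ?_⟩
    rw [smul_eq_mul, mul_left_comm]
    exact J.mul_mem_left _ hsa

theorem le_localPart {n : ℕ} (J : Ideal (Coord n)) (p : CP n) : J ≤ localPart J p :=
  fun g hg => ⟨0, 1, isHomogeneous_one _ _,
    (Ideal.ne_top_iff_one _).1 (Ideal.IsPrime.ne_top inferInstance), by simpa using hg⟩

theorem IsHomog.localPart {n : ℕ} {J : Ideal (Coord n)} (hJ : IsHomog J) (p : CP n) :
    IsHomog (localPart J p) := by
  rintro g ⟨e, s, hs, hsp, hsg⟩ i
  refine ⟨e, s, hs, hsp, ?_⟩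
  rw [mul_comm, ← homogeneousComponent_mul_of_isHomogeneous hs, mul_comm]
  exact hJ _ hsg _

theorem mem_localPart_of_mul_mem {n e : ℕ} {J : Ideal (Coord n)} {p : CP n} {s g : Coord n}
    (hs : s.IsHomogeneous e) (hsp : s ∉ pointIdeal p) (h : s * g ∈ localPart J p) :
    g ∈ localPart J p := by
  obtain ⟨e', s', hs', hsp', h'⟩ := h
  exact ⟨e' + e, s' * s, hs'.mul hs, fun h =>
    ((inferInstance : (pointIdeal p).IsPrime).mem_or_mem h).elim hsp' hsp, by rwa [mul_assoc]⟩

theorem IsHomog.mem_localPart_of_isHomogeneous {n e : ℕ} {J : Ideal (Coord n)} (hJ : IsHomog J)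
    {p : CP n} {s g : Coord n} (hg : g.IsHomogeneous e) (hsp : s ∉ pointIdeal p)
    (h : s * g ∈ J) : g ∈ SphericalCurve.localPart J p := by
  obtain ⟨i, hi⟩ : ∃ i, homogeneousComponent i s ∉ pointIdeal p := by
    by_contra! hcon
    exact hsp (by
      rw [← sum_homogeneousComponent s]
      exact Ideal.sum_mem _ fun i _ => hcon i)
  exact ⟨i, _, homogeneousComponent_isHomogeneous i s, hi, by
    rw [← homogeneousComponent_mul_of_isHomogeneous hg]; exact hJ _ h _⟩

theorem locLength_congr {n : ℕ} {I J : Ideal (Coord n)} {p : CP n}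
    (h1 : ∀ f ∈ I, ∃ s ∉ pointIdeal p, s * f ∈ J) (h2 : ∀ f ∈ J, ∃ s ∉ pointIdeal p, s * f ∈ I) :
    locLength I p = locLength J p := by
  have key : ∀ {I J : Ideal (Coord n)}, (∀ f ∈ I, ∃ s ∉ pointIdeal p, s * f ∈ J) →
      I.map (algebraMap (Coord n) (Localization.AtPrime (pointIdeal p))) ≤
        J.map (algebraMap (Coord n) (Localization.AtPrime (pointIdeal p))) := by
    intro I J h
    refine Ideal.map_le_iff_le_comap.2 fun f hf => ?_
    rw [Ideal.mem_comap,
      IsLocalization.algebraMap_mem_map_algebraMap_iff (pointIdeal p).primeCompl]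
    obtain ⟨s, hs, hsf⟩ := h f hf
    exact ⟨s, hs, hsf⟩
  rw [locLength, locLength, (key h1).antisymm (key h2)]

theorem locLength_localPart {n : ℕ} (J : Ideal (Coord n)) (p : CP n) :
    locLength (localPart J p) p = locLength J p :=
  locLength_congr (fun _ ⟨_, s, _, hsp, h⟩ => ⟨s, hsp, h⟩) fun f hf =>
    ⟨1, (Ideal.ne_top_iff_one _).1 (Ideal.IsPrime.ne_top inferInstance), by
      rw [one_mul]; exact le_localPart _ _ hf⟩

/-- Finite length makes the local quotient Artinian, so f ^ N = f ^ (N + 1) y there for some y, and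
1 - f y is a unit because f vanishes at p. -/
theorem IsHomog.exists_pow_mem_localPart {n e : ℕ} {J : Ideal (Coord n)} (hJ : IsHomog J)
    {p : CP n} (hfin : locLength J p ≠ ⊤) {f : Coord n} (hf : f.IsHomogeneous e)
    (hfp : f ∈ pointIdeal p) : ∃ N, f ^ N ∈ SphericalCurve.localPart J p := by
  rw [locLength, Module.length_ne_top_iff, isFiniteLength_iff_isNoetherian_isArtinian] at hfin
  obtain ⟨-, hart⟩ := hfin
  let R := Localization.AtPrime (pointIdeal p)
  let 𝔞 := J.map (algebraMap (Coord n) R)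
  obtain ⟨N, y, hy⟩ := IsArtinian.exists_pow_succ_smul_dvd (algebraMap (Coord n) R f)
    (Submodule.Quotient.mk 1 : R ⧸ 𝔞)
  obtain ⟨y, rfl⟩ := Submodule.mkQ_surjective _ y
  rw [Submodule.mkQ_apply, ← Submodule.Quotient.mk_smul, ← Submodule.Quotient.mk_smul, eq_comm,
    Submodule.Quotient.eq, smul_eq_mul, smul_eq_mul, mul_one] at hy
  have hunit : IsUnit (1 - algebraMap (Coord n) R f * y) := by
    refine IsLocalRing.isUnit_one_sub_self_of_mem_nonunits _ ?_
    refine (IsLocalRing.mem_maximalIdeal _).1 (Ideal.mul_mem_right _ _ ?_)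
    rw [← Localization.AtPrime.map_eq_maximalIdeal]
    exact Ideal.mem_map_of_mem _ hfp
  have hmem : algebraMap (Coord n) R (f ^ N) ∈ 𝔞 := by
    have h2 : algebraMap (Coord n) R (f ^ N) * (1 - algebraMap (Coord n) R f * y) ∈ 𝔞 := by
      have h3 : algebraMap (Coord n) R (f ^ N) * (1 - algebraMap (Coord n) R f * y) =
          algebraMap (Coord n) R f ^ N - algebraMap (Coord n) R f ^ N.succ * y := by
        rw [map_pow, pow_succ]; ring
      rw [h3]
      exact hy
    obtain ⟨u, hu⟩ := hunit
    rw [← hu] at h2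
    simpa using 𝔞.mul_mem_right (↑u⁻¹ : R) h2
  rw [IsLocalization.algebraMap_mem_map_algebraMap_iff (pointIdeal p).primeCompl] at hmem
  obtain ⟨s, hs, hsf⟩ := hmem
  exact ⟨N, hJ.mem_localPart_of_isHomogeneous (hf.pow N) hs hsf⟩

theorem eq_of_localPart_le {n : ℕ} {J : Ideal (Coord n)} {p q : CP n}
    (hpow : ∀ f : Coord n, f.IsHomogeneous 1 → f ∈ pointIdeal p → ∃ N, f ^ N ∈ localPart J p)
    (h : localPart J p ≤ pointIdeal q) : q = p := by
  by_contra hne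
  obtain ⟨f, hf, h1, h2⟩ := exists_linear_ne (p := p) (q := q) (fun h => hne h.symm)
  obtain ⟨N, hN⟩ := hpow f hf ((mem_pointIdeal_of_isHomogeneous hf).2 h1)
  exact h2 ((mem_pointIdeal_of_isHomogeneous hf).1
    ((inferInstance : (pointIdeal q).IsPrime).mem_of_pow_mem N (h hN)))

/-- Under `hpow` the local part has no zero besides p, so the sum of local lengths has a single
term. Local lengths can thus be compared through Hilbert functions, without a map between local
rings. -/
theorem IsHomog.eventually_hilbert_localPart {n : ℕ} {J : Ideal (Coord n)} (hJ : IsHomog J)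
    {p : CP n}
    (hpow : ∀ f : Coord n, f.IsHomogeneous 1 → f ∈ pointIdeal p →
      ∃ N, f ^ N ∈ SphericalCurve.localPart J p) :
    ∀ᶠ t in atTop, (hilbert (SphericalCurve.localPart J p) t : ℕ∞) = locLength J p := by
  have := (hJ.localPart p).eventually_hilbert_eq (E := {p})
    (fun q hq => Finset.mem_singleton.2 (eq_of_localPart_le hpow hq))
  simpa [locLength_localPart] using this

/-! ### Birational correspondences -/

theorem aeval_mul_of_isHomogeneous {n t : ℕ} {A : Type*} [CommRing A] [Algebra ℂ A]
    {f : Coord n} (hf : f.IsHomogeneous t) (c : A) (v : Fin (n + 1) → A) :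
    aeval (fun i => c * v i) f = c ^ t * aeval v f := by
  rw [aeval_def, aeval_def, eval₂_eq, eval₂_eq, Finset.mul_sum]
  refine Finset.sum_congr rfl fun d hd => ?_
  have hdeg := hf.degree_eq_sum_deg_support hd
  simp only [mul_pow, Finset.prod_mul_distrib, Finset.prod_pow_eq_pow_sum]
  have : ∑ i ∈ d.support, d i = t := hdeg.symm
  rw [this]; ring

theorem isHomogeneous_map {n m s t : ℕ} {φ : Coord m →ₐ[ℂ] Coord n}
    (hφ : ∀ j, (φ (X j)).IsHomogeneous s) {F : Coord m} (hF : F.IsHomogeneous t) :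
    (φ F).IsHomogeneous (s * t) := by
  rw [aeval_unique φ]
  exact hF.aeval _ hφ

theorem eval_eval_map {n m : ℕ} (φ : Coord m →ₐ[ℂ] Coord n) (v : Fin (n + 1) → ℂ) (F : Coord m) :
    eval (fun j => eval v (φ (X j))) F = eval v (φ F) := by
  have : (aeval (R := ℂ) fun j => eval v (φ (X j))) = (aeval v).comp φ :=
    MvPolynomial.algHom_ext fun i => by simp [aeval_eq_eval]
  simpa [aeval_eq_eval] using DFunLike.congr_fun this F

/-- Modulo I the map ψ scales every variable by θ, hence a form of degree t by θ ^ t. -/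
theorem sub_pow_mul_mem {n t : ℕ} {I : Ideal (Coord n)} {ψ : Coord n →ₐ[ℂ] Coord n} {θ : Coord n}
    (h : ∀ i, ψ (X i) - θ * X i ∈ I) {G : Coord n} (hG : G.IsHomogeneous t) :
    ψ G - θ ^ t * G ∈ I := by
  rw [← Ideal.Quotient.eq_zero_iff_mem, map_sub, sub_eq_zero]
  have h1 : (Ideal.Quotient.mkₐ ℂ I).comp ψ =
      aeval (fun i => Ideal.Quotient.mk I θ * Ideal.Quotient.mk I (X i)) :=
    MvPolynomial.algHom_ext fun i => by
      rw [AlgHom.comp_apply, aeval_X, Ideal.Quotient.mkₐ_eq_mk, ← map_mul, ← sub_eq_zero, ← map_sub,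
        Ideal.Quotient.eq_zero_iff_mem]
      exact h i
  have h2 : Ideal.Quotient.mkₐ ℂ I = aeval (fun i => Ideal.Quotient.mk I (X i)) :=
    MvPolynomial.algHom_ext fun i => by simp
  have h3 := DFunLike.congr_fun h1 G
  rw [aeval_mul_of_isHomogeneous hG, ← h2] at h3
  simpa using h3

/-- `φ` and `χ` induce mutually inverse maps between the part of `X` where `θ` does not vanish and
the part of `Y` where `ζ` does not vanish. -/
structure Corr {n m : ℕ} (φ : Coord m →ₐ[ℂ] Coord n) (χ : Coord n →ₐ[ℂ] Coord m)
    (θ : Coord n) (ζ : Coord m) (s s' : ℕ) (V : Set (CP n)) (W : Set (CP m)) : Prop where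
  isHomogeneous_φ : ∀ j, (φ (X j)).IsHomogeneous s
  isHomogeneous_χ : ∀ i, (χ (X i)).IsHomogeneous s'
  isHomogeneous_θ : θ.IsHomogeneous 1
  isHomogeneous_ζ : ζ.IsHomogeneous 1
  -- The composites send a variable to a linear form times that variable, which has degree two.
  mul_eq_two : s * s' = 2
  map_ζ : φ ζ = θ ^ s
  map_θ : χ θ = ζ ^ s'
  φ_χ : ∀ i, φ (χ (X i)) - θ * X i ∈ idealOf V
  χ_φ : ∀ j, χ (φ (X j)) - ζ * X j ∈ idealOf W
  -- The factor θ is needed since the points of V on θ = 0 need not have an image in W.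
  mul_φ_mem : ∀ F ∈ idealOf W, θ * φ F ∈ idealOf V
  mul_χ_mem : ∀ G ∈ idealOf V, ζ * χ G ∈ idealOf W

namespace Corr

variable {n m : ℕ} {φ : Coord m →ₐ[ℂ] Coord n} {χ : Coord n →ₐ[ℂ] Coord m}
    {θ : Coord n} {ζ : Coord m} {s s' : ℕ} {V : Set (CP n)} {W : Set (CP m)}

theorem symm (c : Corr φ χ θ ζ s s' V W) : Corr χ φ ζ θ s' s W V where
  isHomogeneous_φ := c.isHomogeneous_χ
  isHomogeneous_χ := c.isHomogeneous_φ
  isHomogeneous_θ := c.isHomogeneous_ζ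
  isHomogeneous_ζ := c.isHomogeneous_θ
  mul_eq_two := by rw [mul_comm]; exact c.mul_eq_two
  map_ζ := c.map_θ
  map_θ := c.map_ζ
  φ_χ := c.χ_φ
  χ_φ := c.φ_χ
  mul_φ_mem := c.mul_χ_mem
  mul_χ_mem := c.mul_φ_mem

theorem one_le (c : Corr φ χ θ ζ s s' V W) : 1 ≤ s :=
  Nat.one_le_iff_ne_zero.2 fun h => by simpa [h] using c.mul_eq_two

theorem φ_χ_form (c : Corr φ χ θ ζ s s' V W) {t : ℕ} {G : Coord n} (hG : G.IsHomogeneous t) :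
    φ (χ G) - θ ^ t * G ∈ idealOf V :=
  sub_pow_mul_mem (ψ := φ.comp χ) c.φ_χ hG

theorem hasCoords (c : Corr φ χ θ ζ s s' V W) {p : CP n} {q : CP m} (hp : p ∈ V)
    (hθ : eval p.rep θ ≠ 0) (hq : q.HasCoords fun j => eval p.rep (φ (X j))) :
    p.HasCoords fun i => eval q.rep (χ (X i)) := by
  obtain ⟨a, ha, hv⟩ := hq.eq_smul q.hasCoords_rep
  have : (fun i => eval q.rep (χ (X i))) = (a ^ s' * eval p.rep θ) • p.rep := by
    funext i
    have h1 := mem_idealOf.1 (c.φ_χ i) p hp _ p.hasCoords_rep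
    rw [map_sub, map_mul, eval_X, sub_eq_zero] at h1
    rw [hv, eval_smul_of_isHomogeneous (c.isHomogeneous_χ i), eval_eval_map, h1]
    simp [mul_assoc]
  rw [this]
  exact p.hasCoords_rep.smul (mul_ne_zero (pow_ne_zero _ ha) hθ)

theorem eval_ζ_ne_zero (c : Corr φ χ θ ζ s s' V W) {p : CP n} {q : CP m}
    (hθ : eval p.rep θ ≠ 0) (hq : q.HasCoords fun j => eval p.rep (φ (X j))) :
    eval q.rep ζ ≠ 0 := by
  rw [Ne, hq.eval_eq_zero_iff c.isHomogeneous_ζ, eval_eval_map, c.map_ζ, map_pow]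
  exact pow_ne_zero _ hθ

theorem exists_image (c : Corr φ χ θ ζ s s' V W) {p : CP n} (hθ : eval p.rep θ ≠ 0) :
    ∃ q : CP m, q.HasCoords fun j => eval p.rep (φ (X j)) := by
  refine ⟨_, CP.hasCoords_mk _ fun h => ?_⟩
  have h1 := eval_eval_map φ p.rep ζ
  have h2 : eval (0 : Fin (m + 1) → ℂ) ζ = 0 := by
    have := eval_smul_of_isHomogeneous c.isHomogeneous_ζ 0 (0 : Fin (m + 1) → ℂ)
    simpa using this
  rw [h, h2, c.map_ζ, map_pow] at h1
  exact pow_ne_zero _ hθ h1.symm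

theorem mem_of_mem (c : Corr φ χ θ ζ s s' V W) (hW : IsClosed W) {p : CP n} {q : CP m}
    (hp : p ∈ V) (hθ : eval p.rep θ ≠ 0) (hq : q.HasCoords fun j => eval p.rep (φ (X j))) :
    q ∈ W := by
  refine mem_of_forall_mem_idealOf hW fun e F hF hFW => ?_
  have := mem_idealOf.1 (c.mul_φ_mem F hFW) p hp _ p.hasCoords_rep
  rw [map_mul] at this
  rw [hq.eval_eq_zero_iff hF, eval_eval_map]
  exact (mul_eq_zero.1 this).resolve_left hθ

theorem mem_pointIdeal_iff (c : Corr φ χ θ ζ s s' V W) {p : CP n} {q : CP m}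
    (hq : q.HasCoords fun j => eval p.rep (φ (X j))) {t : ℕ} {F : Coord m}
    (hF : F.IsHomogeneous t) : F ∈ pointIdeal q ↔ φ F ∈ pointIdeal p := by
  rw [mem_pointIdeal_of_isHomogeneous hF, hq.eval_eq_zero_iff hF, eval_eval_map,
    mem_pointIdeal_of_isHomogeneous (isHomogeneous_map c.isHomogeneous_φ hF)]

theorem mul_φ_mem_sup (c : Corr φ χ θ ζ s s' V W) {h G : Coord m}
    (hG : G ∈ idealOf W ⊔ Ideal.span {h}) : θ * φ G ∈ idealOf V ⊔ Ideal.span {φ h} := by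
  obtain ⟨j, hj, z, hz, rfl⟩ := Submodule.mem_sup.1 hG
  obtain ⟨a, rfl⟩ := Ideal.mem_span_singleton'.1 hz
  rw [map_add, mul_add, map_mul, ← mul_assoc]
  exact Ideal.add_mem _ (Ideal.mem_sup_left (c.mul_φ_mem j hj))
    (Ideal.mem_sup_right (Ideal.mem_span_singleton'.2 ⟨_, rfl⟩))

theorem mul_χ_mem_sup (c : Corr φ χ θ ζ s s' V W) {a : ℕ} {h : Coord m} (hh : h.IsHomogeneous a)
    {G : Coord n} (hG : G ∈ idealOf V ⊔ Ideal.span {φ h}) :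
    ζ * χ G ∈ idealOf W ⊔ Ideal.span {h} := by
  obtain ⟨j, hj, z, hz, rfl⟩ := Submodule.mem_sup.1 hG
  obtain ⟨b, rfl⟩ := Ideal.mem_span_singleton'.1 hz
  have h1 := c.symm.φ_χ_form hh
  have h2 : ζ * χ (j + b * φ h) =
      (ζ * χ j + ζ * χ b * (χ (φ h) - ζ ^ a * h)) + ζ * χ b * ζ ^ a * h := by
    rw [map_add, map_mul]; ring
  rw [h2]
  exact Ideal.add_mem _ (Ideal.mem_sup_left (Ideal.add_mem _ (c.mul_χ_mem j hj)
    (Ideal.mul_mem_left _ _ h1))) (Ideal.mem_sup_right (Ideal.mem_span_singleton'.2 ⟨_, rfl⟩))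

/-- The factors θ and ζ, which measure the failure of φ and χ to be inverse ring maps, do not vanish
at p and q and can be absorbed into the multipliers allowed by `localPart`. -/
theorem φ_mem_localPart_iff (c : Corr φ χ θ ζ s s' V W) {p : CP n} {q : CP m} (hp : p ∈ V)
    (hθ : eval p.rep θ ≠ 0) (hq : q.HasCoords fun j => eval p.rep (φ (X j))) {a t : ℕ}
    {h F : Coord m} (hh : h.IsHomogeneous a) (hF : F.IsHomogeneous t) :
    φ F ∈ localPart (idealOf V ⊔ Ideal.span {φ h}) p ↔
      F ∈ localPart (idealOf W ⊔ Ideal.span {h}) q := by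
  have hθp : θ ∉ pointIdeal p := by rwa [mem_pointIdeal_of_isHomogeneous c.isHomogeneous_θ]
  have hζq : ζ ∉ pointIdeal q := by
    rw [mem_pointIdeal_of_isHomogeneous c.isHomogeneous_ζ]
    exact c.eval_ζ_ne_zero hθ hq
  have hpr := (inferInstance : (pointIdeal p).IsPrime)
  have hqr := (inferInstance : (pointIdeal q).IsPrime)
  constructor
  · rintro ⟨e, σ, hσ, hσp, h1⟩
    have h2 := c.mul_χ_mem_sup hh h1
    have h3 := c.symm.φ_χ_form hF
    refine ⟨_, ζ * χ σ * ζ ^ t, (c.isHomogeneous_ζ.mul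
      (isHomogeneous_map c.isHomogeneous_χ hσ)).mul (c.isHomogeneous_ζ.pow t), fun h4 => ?_, ?_⟩
    · rcases hqr.mem_or_mem h4 with h5 | h5
      · rcases hqr.mem_or_mem h5 with h6 | h6
        · exact hζq h6
        · rw [← c.symm.mem_pointIdeal_iff (c.hasCoords hp hθ hq) hσ] at h6
          exact hσp h6
      · exact hζq (hqr.mem_of_pow_mem _ h5)
    · have h4 : ζ * χ σ * ζ ^ t * F =
          ζ * χ (σ * φ F) - ζ * χ σ * (χ (φ F) - ζ ^ t * F) := by
        rw [map_mul]; ring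
      rw [h4]
      exact Ideal.sub_mem _ h2 (Ideal.mul_mem_left _ _ (Ideal.mem_sup_left h3))
  · rintro ⟨e, σ, hσ, hσq, h1⟩
    have h2 := c.mul_φ_mem_sup h1
    refine ⟨_, θ * φ σ, c.isHomogeneous_θ.mul (isHomogeneous_map c.isHomogeneous_φ hσ),
      fun h3 => ?_, by rwa [mul_assoc, ← map_mul]⟩
    rcases hpr.mem_or_mem h3 with h4 | h4
    · exact hθp h4
    · rw [← c.mem_pointIdeal_iff hq hσ] at h4
      exact hσq h4

theorem mem_localPart_of_χ_mem (c : Corr φ χ θ ζ s s' V W) {p : CP n} {q : CP m} (hp : p ∈ V)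
    (hθ : eval p.rep θ ≠ 0) (hq : q.HasCoords fun j => eval p.rep (φ (X j))) {a t : ℕ}
    {h : Coord m} {G : Coord n} (hh : h.IsHomogeneous a) (hG : G.IsHomogeneous t)
    (hχG : χ G ∈ localPart (idealOf W ⊔ Ideal.span {h}) q) :
    G ∈ localPart (idealOf V ⊔ Ideal.span {φ h}) p := by
  rw [← c.φ_mem_localPart_iff hp hθ hq hh (isHomogeneous_map c.isHomogeneous_χ hG)] at hχG
  have h1 := le_localPart _ p (Ideal.mem_sup_left (c.φ_χ_form hG) :
    _ ∈ idealOf V ⊔ Ideal.span {φ h})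
  refine mem_localPart_of_mul_mem (s := θ ^ t) (c.isHomogeneous_θ.pow t) (fun h2 => hθ ?_) ?_
  · exact (mem_pointIdeal_of_isHomogeneous c.isHomogeneous_θ).1
      ((inferInstance : (pointIdeal p).IsPrime).mem_of_pow_mem _ h2)
  · simpa using Ideal.sub_mem _ hχG h1

/-- Corresponding points have the same local lengths. -/
theorem locLength_eq (c : Corr φ χ θ ζ s s' V W) {p : CP n} {q : CP m} (hp : p ∈ V)
    (hθ : eval p.rep θ ≠ 0) (hq : q.HasCoords fun j => eval p.rep (φ (X j))) {a : ℕ}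
    {h : Coord m} (hh : h.IsHomogeneous a)
    (hfin : locLength (idealOf V ⊔ Ideal.span {φ h}) p ≠ ⊤ ∨
      locLength (idealOf W ⊔ Ideal.span {h}) q ≠ ⊤) :
    locLength (idealOf V ⊔ Ideal.span {φ h}) p = locLength (idealOf W ⊔ Ideal.span {h}) q := by
  have hJV : IsHomog (idealOf V ⊔ Ideal.span {φ h}) :=
    (isHomog_idealOf V).sup (isHomog_span_singleton (isHomogeneous_map c.isHomogeneous_φ hh))
  have hJW : IsHomog (idealOf W ⊔ Ideal.span {h}) :=
    (isHomog_idealOf W).sup (isHomog_span_singleton hh)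
  -- Finiteness on one side makes the linear forms through that point nilpotent locally; φ or χ
  -- carries this nilpotency to the other side.
  obtain ⟨hA, hB⟩ : (∀ f : Coord n, f.IsHomogeneous 1 → f ∈ pointIdeal p →
        ∃ N, f ^ N ∈ localPart (idealOf V ⊔ Ideal.span {φ h}) p) ∧
      (∀ F : Coord m, F.IsHomogeneous 1 → F ∈ pointIdeal q →
        ∃ N, F ^ N ∈ localPart (idealOf W ⊔ Ideal.span {h}) q) := by
    rcases hfin with hfin | hfin
    · refine ⟨fun f hf hfp => hJV.exists_pow_mem_localPart hfin hf hfp, fun F hF hFq => ?_⟩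
      obtain ⟨N, hN⟩ := hJV.exists_pow_mem_localPart hfin
        (isHomogeneous_map c.isHomogeneous_φ hF) ((c.mem_pointIdeal_iff hq hF).1 hFq)
      exact ⟨N, (c.φ_mem_localPart_iff hp hθ hq hh (hF.pow N)).1 (by rwa [map_pow])⟩
    · refine ⟨fun f hf hfp => ?_, fun F hF hFq => hJW.exists_pow_mem_localPart hfin hF hFq⟩
      obtain ⟨N, hN⟩ := hJW.exists_pow_mem_localPart hfin
        (isHomogeneous_map c.isHomogeneous_χ hf)
        ((c.symm.mem_pointIdeal_iff (c.hasCoords hp hθ hq) hf).1 hfp)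
      exact ⟨N, c.mem_localPart_of_χ_mem hp hθ hq hh (hf.pow N) (by rwa [map_pow])⟩
  -- The only zero of the local part is q, where ζ does not vanish, so in large degree every form is
  -- divisible by powers of ζ modulo it.
  have hdiv := (hJW.localPart q).eventually_exists_sub_mem c.isHomogeneous_ζ (fun q' hq' => by
    rw [eq_of_localPart_le hB hq']
    exact c.eval_ζ_ne_zero hθ hq)
  have h1 := hJV.eventually_hilbert_localPart hA
  have h2 := hJW.eventually_hilbert_localPart hB
  have hst : Tendsto (fun t : ℕ => s * t) atTop atTop :=
    tendsto_atTop_mono (fun t => Nat.le_mul_of_pos_left t c.one_le) tendsto_id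
  obtain ⟨t, h3, h4, h5⟩ := (hdiv.and ((hst.eventually h1).and h2)).exists
  rw [← h4, ← h5]
  congr 1
  refine (hilbert_eq_of_map φ.toLinearMap
    (fun F hF => isHomogeneous_map c.isHomogeneous_φ hF)
    (fun F hF => c.φ_mem_localPart_iff hp hθ hq hh hF) fun g hg => ?_).symm
  have hχg : (χ g).IsHomogeneous (t + t) := by
    have := isHomogeneous_map c.isHomogeneous_χ hg
    rwa [← mul_assoc, mul_comm s', c.mul_eq_two, two_mul] at this
  -- Surjectivity of φ in degree t: χ g has degree s' s t = 2t, and dividing it by ζ ^ t gives a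
  -- form G of degree t. Applying φ yields θ ^ (s t) g ≡ θ ^ (s t) φ G, and θ may be cancelled
  -- locally.
  obtain ⟨G, hG, hGm⟩ := h3 t (χ g) hχg
  refine ⟨G, hG, ?_⟩
  rw [← c.φ_mem_localPart_iff hp hθ hq hh
    (hχg.sub ((by simpa using c.isHomogeneous_ζ.pow t : (ζ ^ t).IsHomogeneous t).mul hG)),
    map_sub, map_mul, map_pow, c.map_ζ, ← pow_mul] at hGm
  have h6 := le_localPart _ p (Ideal.mem_sup_left (c.φ_χ_form hg) :
    _ ∈ idealOf V ⊔ Ideal.span {φ h})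
  refine mem_localPart_of_mul_mem (s := θ ^ (s * t)) (c.isHomogeneous_θ.pow _)
    (fun h2 => hθ ?_) ?_
  · exact (mem_pointIdeal_of_isHomogeneous c.isHomogeneous_θ).1
      ((inferInstance : (pointIdeal p).IsPrime).mem_of_pow_mem _ h2)
  · have h7 : θ ^ (s * t) * (g - φ G) =
        (φ (χ g) - θ ^ (s * t) * φ G) - (φ (χ g) - θ ^ (s * t) * g) := by ring
    change θ ^ (s * t) * (g - φ G) ∈ _
    rw [h7]
    exact Ideal.sub_mem _ hGm h6

end Corr

end SphericalCurve

/-! ### Least intersection multiplicities of linear systems, and images of curves. -/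

namespace SphericalCurve

open MvPolynomial Filter

/-! ### Comparison of lengths by a reduction -/

section Length

variable {R : Type*} [CommRing R]

theorem length_quotient_anti {𝔞 𝔟 : Ideal R} (h : 𝔞 ≤ 𝔟) :
    Module.length R (R ⧸ 𝔟) ≤ Module.length R (R ⧸ 𝔞) :=
  Module.length_le_of_surjective (Submodule.factor h) (Submodule.factor_surjective h)

theorem length_quotient_pow_ne_top {𝔞 : Ideal R} {x : R}
    (h : Module.length R (R ⧸ (𝔞 ⊔ Ideal.span {x})) ≠ ⊤) (k : ℕ) :
    Module.length R (R ⧸ (𝔞 ⊔ Ideal.span {x ^ k})) ≠ ⊤ := by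
  induction k with
  | zero =>
    have : 𝔞 ⊔ Ideal.span {x ^ 0} = ⊤ := by simp
    rw [this, Module.length_eq_zero]
    exact ENat.zero_ne_top
  | succ k ih =>
    rw [length_quotient_eq_add_colon _ x]
    refine WithTop.add_ne_top.2 ⟨ne_top_of_le_ne_top ih (length_quotient_anti (sup_le ?_ ?_)),
      ne_top_of_le_ne_top h (length_quotient_anti (sup_le_sup_right le_sup_left _))⟩
    · intro a ha
      rw [Submodule.mem_colon_singleton, smul_eq_mul]
      exact Ideal.mem_sup_left (Ideal.mul_mem_right _ _ ha)
    · rw [Ideal.span_singleton_le_iff_mem, Submodule.mem_colon_singleton, smul_eq_mul, ← pow_succ]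
      exact Ideal.mem_sup_right (Ideal.mem_span_singleton_self _)

/-- Compare R/(𝔞 + x𝔧) with R/(𝔞 + y𝔧), the latter being at least as long. Since (𝔞 + x𝔧) : x = 𝔧 by
regularity of x, the first length is ℓ(R/𝔧) + ℓ(R/(𝔞 + x)); since (𝔞 + y𝔧) : y ⊇ 𝔧, the second is at
most ℓ(R/𝔧) + ℓ(R/(𝔞 + y)). The common term is finite because 𝔧 contains a power of y, and can be
cancelled. -/
theorem length_quotient_le_of_reduction {𝔞 𝔧 : Ideal R} (h𝔧 : 𝔞 ≤ 𝔧) {x y : R}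
    (hx : ∀ a, a * x ∈ 𝔞 → a ∈ 𝔞) (hxy : Ideal.span {y} * 𝔧 ≤ 𝔞 ⊔ Ideal.span {x} * 𝔧) {k : ℕ}
    (hk : y ^ k ∈ 𝔧) :
    Module.length R (R ⧸ (𝔞 ⊔ Ideal.span {x})) ≤ Module.length R (R ⧸ (𝔞 ⊔ Ideal.span {y})) := by
  by_cases htop : Module.length R (R ⧸ (𝔞 ⊔ Ideal.span {y})) = ⊤
  · rw [htop]; exact le_top
  have hfin : Module.length R (R ⧸ 𝔧) ≠ ⊤ :=
    ne_top_of_le_ne_top (length_quotient_pow_ne_top htop k) (length_quotient_anti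
      (sup_le h𝔧 ((Ideal.span_singleton_le_iff_mem _).2 hk)))
  have hsup : ∀ z : R, 𝔞 ⊔ Ideal.span {z} * 𝔧 ⊔ Ideal.span {z} = 𝔞 ⊔ Ideal.span {z} := fun z => by
    rw [sup_assoc, sup_eq_right.2 (Ideal.mul_le_left : Ideal.span {z} * 𝔧 ≤ Ideal.span {z})]
  have h1 := length_quotient_eq_add_colon (𝔞 ⊔ Ideal.span {x} * 𝔧) x
  have h2 := length_quotient_eq_add_colon (𝔞 ⊔ Ideal.span {y} * 𝔧) y
  rw [hsup] at h1 h2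
  have hc1 : (𝔞 ⊔ Ideal.span {x} * 𝔧).colon {x} = 𝔧 := by
    refine le_antisymm (fun a ha => ?_) fun a ha => ?_
    · rw [Submodule.mem_colon_singleton, smul_eq_mul] at ha
      obtain ⟨i, hi, z, hz, h⟩ := Submodule.mem_sup.1 ha
      obtain ⟨b, hb, rfl⟩ := Ideal.mem_span_singleton_mul.1 hz
      have := hx (a - b) (by
        rw [sub_mul, ← h, mul_comm b x, add_sub_cancel_right]
        exact hi)
      simpa using 𝔧.add_mem (h𝔧 this) hb
    · rw [Submodule.mem_colon_singleton, smul_eq_mul, mul_comm a]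
      exact Ideal.mem_sup_right (Ideal.mul_mem_mul (Ideal.mem_span_singleton_self x) ha)
  have hc2 : 𝔧 ≤ (𝔞 ⊔ Ideal.span {y} * 𝔧).colon {y} := fun a ha => by
    rw [Submodule.mem_colon_singleton, smul_eq_mul, mul_comm a]
    exact Ideal.mem_sup_right (Ideal.mul_mem_mul (Ideal.mem_span_singleton_self y) ha)
  rw [hc1] at h1
  have h3 : Module.length R (R ⧸ (𝔞 ⊔ Ideal.span {x} * 𝔧)) ≤
      Module.length R (R ⧸ (𝔞 ⊔ Ideal.span {y} * 𝔧)) :=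
    length_quotient_anti (sup_le le_sup_left hxy)
  rw [h1, h2] at h3
  have h4 := h3.trans (add_le_add_left (length_quotient_anti hc2) _)
  exact (ENat.add_le_add_iff_left hfin).1 h4

end Length

theorem isHomog_comap {n m s : ℕ} {φ : Coord m →ₐ[ℂ] Coord n} (hs : 1 ≤ s)
    (hφ : ∀ j, (φ (X j)).IsHomogeneous s) {I : Ideal (Coord n)} (hI : IsHomog I) :
    IsHomog (I.comap φ) := by
  intro f hf i
  rw [Ideal.mem_comap] at *
  have h1 : homogeneousComponent (s * i) (φ f) = φ (homogeneousComponent i f) := by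
    conv_lhs => rw [← sum_homogeneousComponent f, map_sum, map_sum]
    have key : ∀ j, homogeneousComponent (s * i) (φ (homogeneousComponent j f)) =
        if j = i then φ (homogeneousComponent i f) else 0 := by
      intro j
      rw [homogeneousComponent_of_mem (n := s * j)
        (isHomogeneous_map hφ (homogeneousComponent_isHomogeneous j f))]
      by_cases h : j = i
      · simp [h]
      · rw [if_neg h, if_neg (fun h' => h (Nat.eq_of_mul_eq_mul_left hs h').symm)]
    simp only [key, Finset.sum_ite_eq', Finset.mem_range]
    split_ifs with h
    · rfl
    · rw [homogeneousComponent_eq_zero _ _ (by omega), map_zero]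
  rw [← h1]
  exact hI _ hf _

/-- A form of the linear system `φ` whose hyperplane avoids the points of the image of `V` on
`ζ = 0` has least intersection multiplicity with `V` at the base points of the system. -/
theorem locLength_le_of_general {n m s : ℕ} {φ : Coord m →ₐ[ℂ] Coord n} (hs : 1 ≤ s)
    (hφ : ∀ j, (φ (X j)).IsHomogeneous s) {V : Set (CP n)} {p : CP n} {ζ h h' : Coord m}
    (hζ : ζ.IsHomogeneous 1) (hh : h.IsHomogeneous 1) (hh' : h'.IsHomogeneous 1)
    (hK : ∀ q, (idealOf V).comap φ ≤ pointIdeal q → eval q.rep ζ = 0 → eval q.rep h ≠ 0)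
    (hb : ∃ w ∉ pointIdeal p,
      w * φ ζ ∈ pointIdeal p * Ideal.span (Set.range fun j => φ (X j)) ⊔ idealOf V)
    (hreg : IsRegularOn (φ h) V) :
    locLength (idealOf V ⊔ Ideal.span {φ h}) p ≤ locLength (idealOf V ⊔ Ideal.span {φ h'}) p := by
  let R := Localization.AtPrime (pointIdeal p)
  let al := algebraMap (Coord n) R
  have hKh := isHomog_comap hs hφ (isHomog_idealOf V)
  -- The ideal φ⁻¹(I(V)) + (ζ, h) has no zeros by `hK`, so it contains all forms of degree t₀ and
  -- more.
  obtain ⟨t₀, ht₀⟩ := eventually_atTop.1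
    (((hKh.sup (isHomog_span_singleton hζ)).sup (isHomog_span_singleton hh)).eventually_mem
      (fun q hq => by
        rw [sup_le_iff, sup_le_iff, Ideal.span_singleton_le_iff_mem,
          Ideal.span_singleton_le_iff_mem, mem_pointIdeal_of_isHomogeneous hζ,
          mem_pointIdeal_of_isHomogeneous hh] at hq
        exact hK q hq.1.1 hq.1.2 hq.2))
  -- Locally, 𝔧 t is I(V) plus the t-th power of the ideal of the linear system. The goal is that φ
  -- h generates a reduction: 𝔧 (t₀ + 1) ⊆ 𝔞 + φ h · 𝔧 t₀.
  let 𝔧 : ℕ → Ideal R := fun t =>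
    (idealOf V ⊔ Ideal.span (φ '' {F | F.IsHomogeneous t})).map al
  let 𝔞 : Ideal R := (idealOf V).map al
  have hmem : ∀ {t : ℕ} {F : Coord m}, F.IsHomogeneous t → al (φ F) ∈ 𝔧 t := fun hF =>
    Ideal.mem_map_of_mem _ (Ideal.mem_sup_right (Ideal.subset_span ⟨_, hF, rfl⟩))
  have h𝔞 : ∀ t, 𝔞 ≤ 𝔧 t := fun t => Ideal.map_mono le_sup_left
  have hspan : ∀ t, 𝔧 t = 𝔞 ⊔ Ideal.span ((fun F => al (φ F)) '' {F | F.IsHomogeneous t}) := by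
    intro t
    simp only [𝔧, 𝔞]
    rw [Ideal.map_sup, Ideal.map_span, Set.image_image]
  have hmul : ∀ {t : ℕ} {F : Coord m}, F.IsHomogeneous 1 →
      Ideal.span {al (φ F)} * 𝔧 t ≤ 𝔧 (t + 1) := by
    intro t F hF
    rw [hspan t, Ideal.mul_sup]
    refine sup_le (Ideal.mul_le_right.trans (h𝔞 _)) ?_
    rw [Ideal.span_mul_span', Ideal.span_le, Set.singleton_mul]
    rintro _ ⟨_, ⟨G, hG, rfl⟩, rfl⟩
    have := hmem (hF.mul hG)
    rw [add_comm 1 t, map_mul, map_mul] at this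
    exact this
  -- By `hb`, up to a unit, φ ζ lies in the maximal ideal times the ideal of the system, modulo
  -- I(V). Its products are therefore negligible for Nakayama.
  have hζmem : ∀ {t : ℕ} {G : Coord m}, G.IsHomogeneous t →
      al (φ ζ * φ G) ∈ 𝔞 ⊔ IsLocalRing.maximalIdeal R • 𝔧 (t + 1) := by
    intro t G hG
    obtain ⟨w, hw, hwζ⟩ := hb
    have hunit : IsUnit (al w) := IsLocalization.map_units R (⟨w, hw⟩ : (pointIdeal p).primeCompl)
    have h1 : al (w * φ ζ) * al (φ G) ∈ 𝔞 ⊔ IsLocalRing.maximalIdeal R • 𝔧 (t + 1) := by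
      have h2 := Ideal.mul_mem_mul (Ideal.mem_map_of_mem al hwζ)
        (Ideal.mem_span_singleton_self (al (φ G)))
      refine (?_ : _ ≤ 𝔞 ⊔ IsLocalRing.maximalIdeal R • 𝔧 (t + 1)) h2
      rw [Ideal.map_sup, Ideal.sup_mul, Ideal.map_mul, Localization.AtPrime.map_eq_maximalIdeal,
        mul_assoc, Ideal.map_span, Ideal.span_mul_span']
      refine sup_le (le_sup_of_le_right ?_) (le_sup_of_le_left Ideal.mul_le_left)
      rw [smul_eq_mul]
      refine Ideal.mul_mono_right ?_
      rw [Ideal.span_le, Set.mul_singleton]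
      rintro _ ⟨_, ⟨_, ⟨j, rfl⟩, rfl⟩, rfl⟩
      have := hmem ((isHomogeneous_X ℂ j).mul hG)
      rw [add_comm 1 t, map_mul, map_mul] at this
      exact this
    obtain ⟨u, hu⟩ := hunit
    have h2 := Ideal.mul_mem_left _ (↑u⁻¹ : R) h1
    rw [map_mul, ← hu] at h2
    rw [map_mul]
    convert h2 using 1
    rw [mul_assoc, Units.inv_mul_cancel_left]
  -- A form of degree t₀ + 1 is b h + a ζ modulo φ⁻¹(I(V)). The ζ part is absorbed by Nakayama's
  -- lemma.
  have hnak : 𝔧 (t₀ + 1) ≤ 𝔞 ⊔ Ideal.span {al (φ h)} * 𝔧 t₀ := by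
    refine Submodule.le_of_le_smul_of_le_jacobson_bot (I := IsLocalRing.maximalIdeal R)
      (IsNoetherian.noetherian _) (IsLocalRing.maximalIdeal_le_jacobson _) ?_
    conv_lhs => rw [hspan]
    refine sup_le (le_sup_of_le_left le_sup_left) (Ideal.span_le.2 ?_)
    rintro _ ⟨F, hF, rfl⟩
    obtain ⟨b, hb', hFb⟩ := (hKh.sup (isHomog_span_singleton hζ)).exists_of_mem_sup_span hh hF
      (ht₀ (t₀ + 1) (by omega) F hF)
    obtain ⟨a, ha', hFa⟩ := hKh.exists_of_mem_sup_span hζ (hF.sub (hb'.mul hh)) hFb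
    rw [Ideal.mem_comap] at hFa
    have h1 : al (φ F) = al (φ (F - b * h - a * ζ)) + al (φ ζ * φ a) + al (φ h) * al (φ b) := by
      simp only [map_sub, map_mul]; ring
    change al (φ F) ∈ _
    rw [h1]
    refine Ideal.add_mem _ (Ideal.add_mem _ ?_ ?_) ?_
    · exact Ideal.mem_sup_left (Ideal.mem_sup_left (Ideal.mem_map_of_mem al hFa))
    · have h2 : 𝔞 ⊔ IsLocalRing.maximalIdeal R • 𝔧 (t₀ + 1) ≤
          𝔞 ⊔ Ideal.span {al (φ h)} * 𝔧 t₀ ⊔ IsLocalRing.maximalIdeal R • 𝔧 (t₀ + 1) :=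
        sup_le_sup_right le_sup_left _
      exact h2 (hζmem ha')
    · exact Ideal.mem_sup_left (Ideal.mem_sup_right
        (Ideal.mul_mem_mul (Ideal.mem_span_singleton_self _) (hmem hb')))
  have hregR : ∀ a : R, a * al (φ h) ∈ 𝔞 → a ∈ 𝔞 := by
    intro a ha
    have h1 := map_colon_singleton (R' := R) (pointIdeal p).primeCompl (idealOf V) (φ h)
    rw [hreg.colon] at h1
    change a ∈ (idealOf V).map (algebraMap (Coord n) R)
    rw [h1, Submodule.mem_colon_singleton]
    exact ha
  have := length_quotient_le_of_reduction (h𝔞 t₀) hregR ((hmul hh').trans hnak) (k := t₀) (by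
    have h1 := hmem (hh'.pow t₀)
    rwa [one_mul, map_pow, map_pow] at h1)
  rw [locLength, locLength, Ideal.map_sup, Ideal.map_sup, Ideal.map_span, Ideal.map_span,
    Set.image_singleton, Set.image_singleton]
  exact this

theorem isRegularOn_of_forall {n e : ℕ} {f : Coord n} {X : Set (CP n)} (hf : f.IsHomogeneous e)
    (h : ∀ t, ∀ g : Coord n, g.IsHomogeneous t → g * f ∈ idealOf X → g ∈ idealOf X) :
    IsRegularOn f X := by
  intro g hg
  rw [← sum_homogeneousComponent g]
  refine Ideal.sum_mem _ fun i _ => h i _ (homogeneousComponent_isHomogeneous i g) ?_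
  rw [← homogeneousComponent_mul_of_isHomogeneous hf]
  exact isHomog_idealOf X _ hg _

/-- The degree of the image of a curve under a birational correspondence. -/
theorem Corr.exists_hasDegree {n m : ℕ} {φ : Coord m →ₐ[ℂ] Coord n} {χ : Coord n →ₐ[ℂ] Coord m}
    {θ : Coord n} {ζ : Coord m} {s s' : ℕ} {V : Set (CP n)} {W : Set (CP m)}
    (c : Corr φ χ θ ζ s s' V W) (hV : IsClosed V) (hW : IsClosed W) (hζW : IsRegularOn ζ W)
    {e : ℕ} (he : HasDegree V e) {h : Coord m} (hh : h.IsHomogeneous 1)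
    (hreg : IsRegularOn (φ h) V) (hfin : {p | p ∈ V ∧ eval p.rep (φ h) = 0}.Finite)
    (hinf : ∀ q ∈ W, eval q.rep ζ = 0 → eval q.rep h ≠ 0)
    {E : Finset (CP n)} (hE : ∀ p ∈ V, eval p.rep (φ h) = 0 → eval p.rep θ = 0 → p ∈ E)
    (hEθ : ∀ p ∈ E, eval p.rep θ = 0) :
    ∃ N : ℕ, HasDegree W N ∧ ((s * e : ℕ) : ℕ∞) = N + ∑ p ∈ E, intersectionMult V (φ h) p := by
  classical
  have hφh : (φ h).IsHomogeneous s := by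
    have := isHomogeneous_map c.isHomogeneous_φ hh
    rwa [mul_one] at this
  -- Regularity is transported: F h ∈ I(W) puts θ φ(F) φ(h), hence θ φ(F), in I(V); applying χ
  -- returns a power of ζ times F, and ζ is regular on W.
  have hregW : IsRegularOn h W := isRegularOn_of_forall hh fun t F hF hFh => by
    have h1 : φ F * θ * φ h ∈ idealOf V := by
      have := c.mul_φ_mem _ hFh
      rw [map_mul] at this
      convert this using 1; ring
    have h2 := c.mul_χ_mem _ (hreg _ h1)
    have h3 : ζ ^ (1 + s' + t) * F ∈ idealOf W := by
      have h4 : ζ ^ (1 + s' + t) * F =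
          ζ * χ (φ F * θ) - ζ * ζ ^ s' * (χ (φ F) - ζ ^ t * F) := by
        rw [map_mul, c.map_θ]; ring
      rw [h4]
      exact Ideal.sub_mem _ h2 (Ideal.mul_mem_left _ _ (c.symm.φ_χ_form hF))
    exact hζW.pow_mul_mem h3
  let E' : Finset (CP n) := hfin.toFinset.filter fun p => eval p.rep θ ≠ 0
  have hE' : ∀ {p}, p ∈ E' ↔ (p ∈ V ∧ eval p.rep (φ h) = 0) ∧ eval p.rep θ ≠ 0 := by
    intro p
    simp [E']
  have hdisj : Disjoint E' E := Finset.disjoint_left.2 fun p hp hpE => (hE'.1 hp).2 (hEθ p hpE)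
  have hbez := he.sum_intersectionMult hV hφh hreg (E := E' ∪ E) fun p hp hp0 => by
    by_cases hθ : eval p.rep θ = 0
    · exact Finset.mem_union_right _ (hE p hp hp0 hθ)
    · exact Finset.mem_union_left _ (hE'.2 ⟨⟨hp, hp0⟩, hθ⟩)
  rw [Finset.sum_union hdisj] at hbez
  have hfinE' : ∑ p ∈ E', intersectionMult V (φ h) p ≠ ⊤ := fun h => by
    rw [h, top_add] at hbez
    exact ENat.top_ne_natCast _ hbez
  have himg : ∀ p : CP n, ∃ q : CP m, eval p.rep θ ≠ 0 →
      q.HasCoords fun j => eval p.rep (φ (X j)) := by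
    intro p
    by_cases hθ : eval p.rep θ = 0
    · exact ⟨CP.mk (fun _ => 1) (fun h => one_ne_zero (congrFun h 0)), fun h => absurd hθ h⟩
    · obtain ⟨q, hq⟩ := c.exists_image hθ
      exact ⟨q, fun _ => hq⟩
  choose im him using himg
  have hinj : Set.InjOn im E' := by
    intro p hp p' hp' hpp
    obtain ⟨⟨hpV, -⟩, hθ⟩ := hE'.1 hp
    obtain ⟨⟨hpV', -⟩, hθ'⟩ := hE'.1 hp'
    have h1 := c.hasCoords hpV hθ (him p hθ)
    have h2 := c.hasCoords hpV' hθ' (him p' hθ')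
    rw [hpp] at h1
    exact h1.unique h2
  -- The hyperplane h misses the points of W on ζ = 0, so each point of the section comes from
  -- exactly one intersection point of V off θ = 0.
  have hcover : ∀ q, idealOf W ⊔ Ideal.span {h} ≤ pointIdeal q → q ∈ E'.image im := by
    intro q hq
    rw [sup_span_le_pointIdeal_iff hW hh] at hq
    obtain ⟨hqW, hqh⟩ := hq
    have hζ : eval q.rep ζ ≠ 0 := fun h0 => hinf q hqW h0 hqh
    obtain ⟨p, hp⟩ := c.symm.exists_image hζ
    have hpV := c.symm.mem_of_mem hV hqW hζ hp
    have hθ := c.symm.eval_ζ_ne_zero hζ hp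
    have hq2 := c.symm.hasCoords hqW hζ hp
    refine Finset.mem_image.2 ⟨p, hE'.2 ⟨⟨hpV, ?_⟩, hθ⟩, (him p hθ).unique hq2⟩
    rwa [← eval_eval_map, ← hq2.eval_eq_zero_iff hh]
  have hhil := ((isHomog_idealOf W).sup (isHomog_span_singleton hh)).eventually_hilbert_eq hcover
  rw [Finset.sum_image hinj] at hhil
  have hsum : ∑ p ∈ E', locLength (idealOf W ⊔ Ideal.span {h}) (im p) =
      ∑ p ∈ E', intersectionMult V (φ h) p := by
    refine Finset.sum_congr rfl fun p hp => ?_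
    obtain ⟨⟨hpV, -⟩, hθ⟩ := hE'.1 hp
    refine (c.locLength_eq hpV hθ (him p hθ) hh (Or.inl ?_)).symm
    exact ne_top_of_le_ne_top hfinE'
      (Finset.single_le_sum (f := fun p => intersectionMult V (φ h) p) (fun _ _ => zero_le) hp)
  rw [hsum] at hhil
  obtain ⟨N, hN⟩ := ENat.ne_top_iff_exists.1 hfinE'
  refine ⟨N, hasDegree_of_eventually_hilbert_sup_span hh hregW ?_, by rw [hN, hbez]⟩
  filter_upwards [hhil] with t ht
  rw [← hN] at ht
  exact_mod_cast ht

/-! ### Images of curves -/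

/-- The image under the forms `φ` of the part of `V` where `θ` does not vanish. -/
def imageOf {n m : ℕ} (φ : Coord m →ₐ[ℂ] Coord n) (θ : Coord n) (V : Set (CP n)) : Set (CP m) :=
  {q | ∃ p ∈ V, eval p.rep θ ≠ 0 ∧ q.HasCoords fun j => eval p.rep (φ (X j))}

section Image

variable {n m s s' : ℕ} {φ : Coord m →ₐ[ℂ] Coord n} {χ : Coord n →ₐ[ℂ] Coord m}
  {θ : Coord n} {ζ : Coord m} {V : Set (CP n)}

theorem HasCoords_map {p : CP n} {q : CP m} (hφ : ∀ j, (φ (X j)).IsHomogeneous s)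
    (hq : q.HasCoords fun j => eval p.rep (φ (X j))) {v : Fin (n + 1) → ℂ} (hv : p.HasCoords v) :
    q.HasCoords fun j => eval v (φ (X j)) := by
  obtain ⟨c, hc, rfl⟩ := p.hasCoords_rep.eq_smul hv
  have : (fun j => eval (c • p.rep) (φ (X j))) = c ^ s • fun j => eval p.rep (φ (X j)) := by
    funext j
    rw [eval_smul_of_isHomogeneous (hφ j)]
    rfl
  rw [this]
  exact hq.smul (pow_ne_zero _ hc)

theorem mul_φ_mem_of_mem_idealOf_imageOf {e : ℕ} (hφ : ∀ j, (φ (X j)).IsHomogeneous s)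
    (hθ : θ.IsHomogeneous e)
    (hne : ∀ p ∈ V, eval p.rep θ ≠ 0 → (fun j => eval p.rep (φ (X j))) ≠ 0) {F : Coord m}
    (hF : F ∈ idealOf (imageOf φ θ V)) : θ * φ F ∈ idealOf V := by
  rw [mem_idealOf] at *
  intro p hp v hv
  rw [map_mul]
  by_cases h : eval p.rep θ = 0
  · rw [(hv.eval_eq_zero_iff hθ).1 h, zero_mul]
  · have hq := CP.hasCoords_mk _ (hne p hp h)
    rw [← eval_eval_map, hF _ ⟨p, hp, h, hq⟩ _ (HasCoords_map hφ hq hv), mul_zero]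

theorem mem_idealOf_imageOf {F : Coord m} (hF : ∀ t, homogeneousComponent t F ∈ (idealOf V).comap φ) :
    F ∈ idealOf (imageOf φ θ V) := by
  rw [← sum_homogeneousComponent F]
  refine Ideal.sum_mem _ fun t _ => ?_
  rw [mem_idealOf_of_isHomogeneous (homogeneousComponent_isHomogeneous t F)]
  rintro q ⟨p, hp, -, hq⟩
  rw [hq.eval_eq_zero_iff (homogeneousComponent_isHomogeneous t F), eval_eval_map]
  exact mem_idealOf.1 (hF t) p hp _ p.hasCoords_rep

theorem Corr.of_closure (hφ : ∀ j, (φ (X j)).IsHomogeneous s)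
    (hχ : ∀ i, (χ (X i)).IsHomogeneous s') (hθ : θ.IsHomogeneous 1) (hζ : ζ.IsHomogeneous 1)
    (hmul : s * s' = 2) (hφζ : φ ζ = θ ^ s) (hχθ : χ θ = ζ ^ s')
    (hφχ : ∀ i, φ (χ (X i)) - θ * X i ∈ idealOf V)
    (hχφ : ∀ j, χ (φ (X j)) - ζ * X j ∈ idealOf (imageOf φ θ V)) :
    Corr φ χ θ ζ s s' V (closure (imageOf φ θ V)) where
  isHomogeneous_φ := hφ
  isHomogeneous_χ := hχ
  isHomogeneous_θ := hθ
  isHomogeneous_ζ := hζ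
  mul_eq_two := hmul
  map_ζ := hφζ
  map_θ := hχθ
  φ_χ := hφχ
  χ_φ := by rwa [idealOf_closure]
  mul_φ_mem := by
    intro F hF
    rw [idealOf_closure] at hF
    refine mul_φ_mem_of_mem_idealOf_imageOf hφ hθ (fun p hp h h0 => ?_) hF
    have h1 := eval_eval_map φ p.rep ζ
    have h2 : eval (0 : Fin (m + 1) → ℂ) ζ = 0 := by
      have := eval_smul_of_isHomogeneous hζ 0 (0 : Fin (m + 1) → ℂ)
      simpa using this
    rw [h0, h2, hφζ, map_pow] at h1
    exact pow_ne_zero _ h h1.symm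
  mul_χ_mem := by
    intro G hG
    rw [idealOf_closure, mem_idealOf]
    rintro q ⟨p, hp, hθp, hq⟩ v hv
    obtain ⟨a, ha, rfl⟩ := hq.eq_smul hv
    have h1 : (fun i => eval (a • fun j => eval p.rep (φ (X j))) (χ (X i))) =
        (a ^ s' * eval p.rep θ) • p.rep := by
      funext i
      have h1 := mem_idealOf.1 (hφχ i) p hp _ p.hasCoords_rep
      rw [map_sub, map_mul, eval_X, sub_eq_zero] at h1
      rw [eval_smul_of_isHomogeneous (hχ i), eval_eval_map, h1]
      simp [mul_assoc]
    rw [map_mul, ← eval_eval_map χ, h1,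
      mem_idealOf.1 hG p hp _ (p.hasCoords_rep.smul (mul_ne_zero (pow_ne_zero _ ha) hθp)), mul_zero]

theorem isIrreducible_imageOf {e : ℕ} (hφ : ∀ j, (φ (X j)).IsHomogeneous s)
    (hθ : θ.IsHomogeneous e) {Z : Set (CP n)}
    (hZ : IsIrreducible Z)
    (hvec : ∀ p ∈ Z, eval p.rep θ ≠ 0 → (fun j => eval p.rep (φ (X j))) ≠ 0)
    (hne : (imageOf φ θ Z).Nonempty) : IsIrreducible (imageOf φ θ Z) := by
  refine ⟨hne, isPreirreducible_iff_isClosed_union_isClosed.2 fun z₁ z₂ h₁ h₂ h => ?_⟩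
  -- The preimage of z, enlarged by the locus θ = 0 to make it closed. A cover of the image by two
  -- closed sets thus pulls back to a closed cover of Z.
  let D : Set (CP m) → Set (CP n) := fun z => {p | eval p.rep θ = 0} ∪
    ⋂ (t : ℕ) (F : Coord m) (_ : F.IsHomogeneous t ∧ F ∈ idealOf z), {p | eval p.rep (φ F) = 0}
  have hD : ∀ z, IsClosed (D z) := fun z => (isClosed_zeros hθ).union <|
    isClosed_iInter fun t => isClosed_iInter fun F => isClosed_iInter fun hF =>
      isClosed_zeros (isHomogeneous_map hφ hF.1)
  have hDz : ∀ z, IsClosed z → Z ⊆ D z → imageOf φ θ Z ⊆ z := by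
    rintro z hz hZD q ⟨p, hp, hθp, hq⟩
    refine mem_of_forall_mem_idealOf hz fun t F hF hFz => ?_
    have h1 := (hZD hp).resolve_left hθp
    rw [hq.eval_eq_zero_iff hF, eval_eval_map]
    simp only [Set.mem_iInter] at h1
    exact h1 t F ⟨hF, hFz⟩
  have hzD : ∀ z, ∀ p q, eval p.rep θ ≠ 0 → (q.HasCoords fun j => eval p.rep (φ (X j))) → q ∈ z →
      p ∈ D z := by
    intro z p q _ hq hqz
    right
    simp only [Set.mem_iInter]
    intro t F hF
    have h1 := (mem_idealOf_of_isHomogeneous hF.1).1 hF.2 q hqz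
    rwa [hq.eval_eq_zero_iff hF.1, eval_eval_map] at h1
  have hcov : Z ⊆ D z₁ ∪ D z₂ := by
    intro p hp
    by_cases hθp : eval p.rep θ = 0
    · exact Or.inl (Or.inl hθp)
    have hq := CP.hasCoords_mk _ (hvec p hp hθp)
    rcases h ⟨p, hp, hθp, hq⟩ with h1 | h1
    · exact Or.inl (hzD _ _ _ hθp hq h1)
    · exact Or.inr (hzD _ _ _ hθp hq h1)
  rcases isPreirreducible_iff_isClosed_union_isClosed.1 hZ.isPreirreducible _ _ (hD z₁) (hD z₂) hcov
    with h1 | h1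
  · exact Or.inl (hDz _ h₁ h1)
  · exact Or.inr (hDz _ h₂ h1)

/-- Pulling back by φ embeds the coordinate ring of the image in degree t into that of V in degree s
t. -/
theorem HasLinearGrowth.imageOf (hs : 1 ≤ s) (hφ : ∀ j, (φ (X j)).IsHomogeneous s)
    (h : HasLinearGrowth V) : HasLinearGrowth (closure (imageOf φ θ V)) := by
  obtain ⟨C, D, h⟩ := h
  have hst : Tendsto (fun t : ℕ => s * t) atTop atTop :=
    tendsto_atTop_mono (fun t => Nat.le_mul_of_pos_left t hs) tendsto_id
  refine ⟨C * s, D, (hst.eventually h).mono fun t ht => ?_⟩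
  rw [hilbertFunction_eq, idealOf_closure]
  refine le_trans (hilbert_le_of_map φ.toLinearMap (fun F hF => isHomogeneous_map hφ hF)
    (fun F hF hFV => mem_idealOf_imageOf fun i => ?_)) (ht.trans_eq (by ring))
  exact isHomog_comap hs hφ (isHomog_idealOf V) F hFV i

theorem HasRealComponents.imageOf {e : ℕ} (hV : HasRealComponents V) (hg : HasLinearGrowth V)
    (hφ : ∀ j, (φ (X j)).IsHomogeneous s) (hθ : θ.IsHomogeneous e)
    (hvec : ∀ p ∈ V, eval p.rep θ ≠ 0 → (fun j => eval p.rep (φ (X j))) ≠ 0)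
    (hinj : ∀ p ∈ V, ∀ p' ∈ V, ∀ q : CP m, eval p.rep θ ≠ 0 → eval p'.rep θ ≠ 0 →
      (q.HasCoords fun j => eval p.rep (φ (X j))) →
      (q.HasCoords fun j => eval p'.rep (φ (X j))) → p = p')
    (hreal : ∀ p ∈ realPoints n, ∀ q : CP m,
      (q.HasCoords fun j => eval p.rep (φ (X j))) → q ∈ realPoints m) :
    HasRealComponents (closure (SphericalCurve.imageOf φ θ V)) := by
  obtain ⟨𝒵, hfin, h𝒵, rfl⟩ := hV
  -- Components inside θ = 0 have no image. Any other component loses only finitely many points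
  -- there, so injectivity keeps infinitely many real points.
  let 𝒵' : Set (Set (CP n)) := {Z | Z ∈ 𝒵 ∧ ∃ z ∈ Z, eval z.rep θ ≠ 0}
  have hfin' : 𝒵'.Finite := hfin.subset fun Z hZ => hZ.1
  refine ⟨(fun Z => closure (SphericalCurve.imageOf φ θ Z)) '' 𝒵', hfin'.image _, ?_, ?_⟩
  · rintro _ ⟨Z, ⟨hZ, z, hz, hzθ⟩, rfl⟩
    obtain ⟨hcl, hirr, hinf⟩ := h𝒵 Z hZ
    have hZV : Z ⊆ ⋃₀ 𝒵 := Set.subset_sUnion_of_mem hZ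
    refine ⟨isClosed_closure, (isIrreducible_imageOf hφ hθ hirr (fun p hp => hvec p (hZV hp))
      ⟨_, z, hz, hzθ, CP.hasCoords_mk _ (hvec z (hZV hz) hzθ)⟩).closure, ?_⟩
    have hZθ : (Z ∩ {p | eval p.rep θ = 0}).Finite :=
      (hg.mono hZV).finite_of_ssubset hirr (hcl.inter (isClosed_zeros hθ))
        ⟨Set.inter_subset_left, fun h => hzθ (h hz).2⟩
    have himg : ∀ p : CP n, ∃ q : CP m, p ∈ (Z ∩ realPoints n) \ (Z ∩ {p | eval p.rep θ = 0}) →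
        q.HasCoords fun j => eval p.rep (φ (X j)) := by
      intro p
      by_cases hp : p ∈ (Z ∩ realPoints n) \ (Z ∩ {p | eval p.rep θ = 0})
      · exact ⟨_, fun _ => CP.hasCoords_mk _
          (hvec p (hZV hp.1.1) fun h => hp.2 ⟨hp.1.1, h⟩)⟩
      · exact ⟨CP.mk (fun _ => 1) (fun h => one_ne_zero (congrFun h 0)), fun h => absurd h hp⟩
    choose im him using himg
    refine Set.infinite_of_injOn_mapsTo (f := im) (fun p hp p' hp' hpp => ?_) (fun p hp => ?_)
      (hinf.sdiff hZθ)
    · have h1 := him p hp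
      rw [hpp] at h1
      exact hinj p (hZV hp.1.1) p' (hZV hp'.1.1) _ (fun h => hp.2 ⟨hp.1.1, h⟩)
        (fun h => hp'.2 ⟨hp'.1.1, h⟩) h1 (him p' hp')
    · exact ⟨subset_closure ⟨p, hp.1.1, fun h => hp.2 ⟨hp.1.1, h⟩, him p hp⟩,
        hreal p hp.1.2 _ (him p hp)⟩
  · have : SphericalCurve.imageOf φ θ (⋃₀ 𝒵) = ⋃ Z ∈ 𝒵', SphericalCurve.imageOf φ θ Z := by
      ext q
      simp only [Set.mem_iUnion, exists_prop]
      constructor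
      · rintro ⟨p, ⟨Z, hZ, hp⟩, hθp, hq⟩
        exact ⟨Z, ⟨hZ, p, hp, hθp⟩, p, hp, hθp, hq⟩
      · rintro ⟨Z, ⟨hZ, -⟩, p, hp, hθp, hq⟩
        exact ⟨p, ⟨Z, hZ, hp⟩, hθp, hq⟩
    rw [this, hfin'.closure_biUnion, Set.sUnion_image]

/-- Removing finitely many points does not change the closure of the image of a curve. -/
theorem closure_eq_of_imageOf_subset {e : ℕ} (hφ : ∀ j, (φ (X j)).IsHomogeneous s)
    (hθ : θ.IsHomogeneous e) (hreg : IsRegularOn θ V)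
    (hvec : ∀ p ∈ V, eval p.rep θ ≠ 0 → (fun j => eval p.rep (φ (X j))) ≠ 0)
    {A : Set (CP m)} (h1 : imageOf φ θ V ⊆ A)
    (h2 : ∀ q ∈ A, ∃ p ∈ V, q.HasCoords fun j => eval p.rep (φ (X j))) :
    closure A = closure (imageOf φ θ V) := by
  refine eq_of_idealOf_eq isClosed_closure isClosed_closure ?_
  rw [idealOf_closure, idealOf_closure]
  refine le_antisymm (idealOf_anti h1) ((isHomog_idealOf _).le_of_forall fun t F hF hFt => ?_)
  have h3 := mul_φ_mem_of_mem_idealOf_imageOf hφ hθ hvec hF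
  have h4 := hreg (φ F) (by rwa [mul_comm])
  rw [mem_idealOf_of_isHomogeneous hFt]
  intro q hq
  obtain ⟨p, hp, hpq⟩ := h2 q hq
  rw [hpq.eval_eq_zero_iff hFt, eval_eval_map]
  exact mem_idealOf.1 h4 p hp _ p.hasCoords_rep

theorem closure_setOf_ne_zero {e : ℕ} {f : Coord n} (hf : f.IsHomogeneous e) (hV : IsClosed V)
    (hreg : IsRegularOn f V) : closure {p | p ∈ V ∧ eval p.rep f ≠ 0} = V := by
  refine eq_of_idealOf_eq isClosed_closure hV ?_
  rw [idealOf_closure]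
  refine le_antisymm ((isHomog_idealOf _).le_of_forall fun t F hF hFt => hreg F ?_)
    (idealOf_anti fun p hp => hp.1)
  rw [mem_idealOf_of_isHomogeneous (hFt.mul hf)]
  intro p hp
  by_cases h : eval p.rep f = 0
  · rw [map_mul, h, mul_zero]
  · rw [map_mul, (mem_idealOf_of_isHomogeneous hFt).1 hF p ⟨hp, h⟩, zero_mul]

/-- With `closure_setOf_ne_zero` this shows that mapping a curve forward and back recovers it when θ
is regular. -/
theorem Corr.imageOf_eq {W : Set (CP m)} (c : Corr φ χ θ ζ s s' V W) (hV : IsClosed V)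
    (hW : IsClosed W) : imageOf χ ζ W = {p | p ∈ V ∧ eval p.rep θ ≠ 0} := by
  ext p
  constructor
  · rintro ⟨q, hq, hζ, hp⟩
    exact ⟨c.symm.mem_of_mem hV hq hζ hp, c.symm.eval_ζ_ne_zero hζ hp⟩
  · rintro ⟨hp, hθ⟩
    obtain ⟨q, hq⟩ := c.exists_image hθ
    exact ⟨q, c.mem_of_mem hW hp hθ hq, c.eval_ζ_ne_zero hθ hq, c.hasCoords hp hθ hq⟩

/-- A form that does not vanish on a dense subset of a curve is regular and has finitely many
zeros. -/
theorem HasRealComponents.regular_of_dense {e : ℕ} (h : HasRealComponents V)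
    (hg : HasLinearGrowth V) {f : Coord n} (hf : f.IsHomogeneous e) {A : Set (CP n)}
    (hA : closure A = V) (hAf : ∀ a ∈ A, eval a.rep f ≠ 0) :
    IsRegularOn f V ∧ {p | p ∈ V ∧ eval p.rep f = 0}.Finite := by
  refine ⟨isRegularOn_of_forall hf fun t g hgt hgf => ?_, ?_⟩
  · rw [← hA, idealOf_closure] at *
    rw [mem_idealOf_of_isHomogeneous (hgt.mul hf)] at hgf
    rw [mem_idealOf_of_isHomogeneous hgt]
    intro p hp
    have := hgf p hp
    rw [map_mul] at this
    exact (mul_eq_zero.1 this).resolve_right (hAf p hp)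
  · obtain ⟨𝒵, hfin, h𝒵, rfl⟩ := h
    let 𝒵' : Set (Set (CP n)) := {Z | Z ∈ 𝒵 ∧ ∃ z ∈ Z, eval z.rep f ≠ 0}
    have hfin' : 𝒵'.Finite := hfin.subset fun Z hZ => hZ.1
    have hcl' : IsClosed (⋃₀ 𝒵') := by
      rw [Set.sUnion_eq_biUnion]
      exact hfin'.isClosed_biUnion fun Z hZ => (h𝒵 Z hZ.1).1
    have heq : ⋃₀ 𝒵 = ⋃₀ 𝒵' := by
      refine Set.Subset.antisymm ?_ (Set.sUnion_subset_sUnion fun Z hZ => hZ.1)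
      rw [← hA]
      refine closure_minimal (fun a ha => ?_) hcl'
      have : a ∈ ⋃₀ 𝒵 := hA ▸ subset_closure ha
      obtain ⟨Z, hZ, haZ⟩ := this
      exact ⟨Z, ⟨hZ, a, haZ, hAf a ha⟩, haZ⟩
    rw [heq] at hg ⊢
    exact hasFiniteZeros_of_forall hfin' (fun Z hZ => ⟨(h𝒵 Z hZ.1).1, (h𝒵 Z hZ.1).2.1⟩) hg hf
      fun Z hZ => hZ.2

end Image

end SphericalCurve

/-! ### The stereographic correspondence in coordinates. -/

namespace SphericalCurve

open MvPolynomial Filter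

/-! ### Coordinates on the ambient space of the sphere -/

/-- The vector `(a, b₁, …, b_d, c)`. -/
def sphereVec {R : Type*} {d : ℕ} (a : R) (b : Fin d → R) (c : R) : Fin (d + 2) → R :=
  Fin.snoc (α := fun _ => R) (Fin.cons a b : Fin (d + 1) → R) c

section SphereVec

variable {R : Type*} {d : ℕ} (a : R) (b : Fin d → R) (c : R)

@[simp] theorem sphereVec_zero : sphereVec a b c 0 = a := by
  have : (0 : Fin (d + 2)) = Fin.castSucc (0 : Fin (d + 1)) := rfl
  rw [sphereVec, this, Fin.snoc_castSucc, Fin.cons_zero]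

@[simp] theorem sphereVec_last : sphereVec a b c (Fin.last (d + 1)) = c := by
  rw [sphereVec, Fin.snoc_last]

@[simp] theorem sphereVec_mid (j : Fin d) : sphereVec a b c j.succ.castSucc = b j := by
  rw [sphereVec, Fin.snoc_castSucc, Fin.cons_succ]

theorem forall_fin_sphere {P : Fin (d + 2) → Prop} :
    (∀ i, P i) ↔ P 0 ∧ P (Fin.last (d + 1)) ∧ ∀ j : Fin d, P j.succ.castSucc := by
  refine ⟨fun h => ⟨h _, h _, fun j => h _⟩, fun ⟨h0, h1, h2⟩ i => ?_⟩
  refine Fin.lastCases h1 (fun j => ?_) i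
  refine Fin.cases h0 (fun j => h2 j) j

theorem sum_sphere {M : Type*} [AddCommMonoid M] (f : Fin (d + 2) → M) :
    ∑ i, f i = f 0 + ∑ j : Fin d, f j.succ.castSucc + f (Fin.last (d + 1)) := by
  rw [Fin.sum_univ_castSucc, Fin.sum_univ_succ]
  rfl

end SphereVec

variable {d : ℕ}

theorem mem_unitSphere {p : CP (d + 1)} : p ∈ unitSphere (d + 1) ↔
    p.rep 0 ^ 2 = ∑ j : Fin d, p.rep j.succ.castSucc ^ 2 + p.rep (Fin.last (d + 1)) ^ 2 := by
  have : p ∈ unitSphere (d + 1) ↔ p.rep 0 ^ 2 = ∑ i : Fin (d + 1), p.rep i.succ ^ 2 := Iff.rfl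
  rw [this, Fin.sum_univ_castSucc]
  rfl

/-- The equation of the unit sphere. -/
def sphereEq (d : ℕ) : Coord (d + 1) :=
  X 0 ^ 2 - (∑ j : Fin d, X j.succ.castSucc ^ 2 + X (Fin.last (d + 1)) ^ 2)

theorem isHomogeneous_sphereEq : (sphereEq d).IsHomogeneous 2 :=
  (isHomogeneous_X_pow _ _).sub ((IsHomogeneous.sum _ _ _ fun _ _ => isHomogeneous_X_pow _ _).add
    (isHomogeneous_X_pow _ _))

theorem sphereEq_mem {V : Set (CP (d + 1))} (hV : V ⊆ unitSphere (d + 1)) :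
    sphereEq d ∈ idealOf V := by
  rw [mem_idealOf_of_isHomogeneous isHomogeneous_sphereEq]
  intro p hp
  simpa [sphereEq, sub_eq_zero] using mem_unitSphere.1 (hV hp)

theorem isClosed_unitSphere : IsClosed (unitSphere (d + 1)) := by
  have : unitSphere (d + 1) = {p | eval p.rep (sphereEq d) = 0} := by
    ext p
    rw [mem_unitSphere]
    simp [sphereEq, sub_eq_zero]
  rw [this]
  exact isClosed_zeros isHomogeneous_sphereEq

/-! ### The stereographic correspondence -/

/-- The form `y₀ - σ y_{d+1}`. -/
def poleForm (d : ℕ) (σ : ℂ) : Coord (d + 1) := X 0 - C σ * X (Fin.last (d + 1))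

/-- The form `∑ (xᵢ - rᵢ x₀)²`. -/
def coneForm (r : Fin d → ℂ) : Coord d := ∑ j : Fin d, (X j.succ - C (r j) * X 0) ^ 2

/-- The inverse of the stereographic projection from the pole `[1, 0, …, 0, σ]`, preceded by the
translation by `-r`. -/
def toSphere (σ : ℂ) (r : Fin d → ℂ) : Coord (d + 1) →ₐ[ℂ] Coord d :=
  aeval (sphereVec (C (1 / 2) * (coneForm r + X 0 ^ 2))
    (fun j => X 0 * (X j.succ - C (r j) * X 0)) (C (σ / 2) * (coneForm r - X 0 ^ 2)))

/-- The stereographic projection from the pole `[1, 0, …, 0, σ]`, followed by the translation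
by `r`. -/
def fromSphere (σ : ℂ) (r : Fin d → ℂ) : Coord d →ₐ[ℂ] Coord (d + 1) :=
  aeval (Fin.cons (poleForm d σ) fun j => X j.succ.castSucc + C (r j) * poleForm d σ)

section Maps

variable (σ : ℂ) (r : Fin d → ℂ)

@[simp] theorem toSphere_zero :
    toSphere σ r (X 0) = C (1 / 2) * (coneForm r + X 0 ^ 2) := by simp [toSphere]

@[simp] theorem toSphere_last :
    toSphere σ r (X (Fin.last (d + 1))) = C (σ / 2) * (coneForm r - X 0 ^ 2) := by simp [toSphere]

@[simp] theorem toSphere_mid (j : Fin d) :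
    toSphere σ r (X j.succ.castSucc) = X 0 * (X j.succ - C (r j) * X 0) := by
  rw [toSphere, aeval_X, sphereVec_mid]

@[simp] theorem fromSphere_zero : fromSphere σ r (X 0) = poleForm d σ := by simp [fromSphere]

@[simp] theorem fromSphere_succ (j : Fin d) :
    fromSphere σ r (X j.succ) = X j.succ.castSucc + C (r j) * poleForm d σ := by simp [fromSphere]

theorem isHomogeneous_poleForm : (poleForm d σ).IsHomogeneous 1 :=
  (isHomogeneous_X _ _).sub (isHomogeneous_C_mul_X _ _)

theorem isHomogeneous_sub_C_mul (j : Fin d) :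
    (X j.succ - C (r j) * X 0 : Coord d).IsHomogeneous 1 :=
  (isHomogeneous_X _ _).sub (isHomogeneous_C_mul_X _ _)

theorem isHomogeneous_coneForm : (coneForm r).IsHomogeneous 2 :=
  IsHomogeneous.sum _ _ _ fun j _ => (isHomogeneous_sub_C_mul r j).pow 2

theorem isHomogeneous_toSphere (i : Fin (d + 2)) : (toSphere σ r (X i)).IsHomogeneous 2 := by
  revert i
  rw [forall_fin_sphere]
  refine ⟨?_, ?_, fun j => ?_⟩
  · rw [toSphere_zero]
    exact ((isHomogeneous_coneForm r).add (isHomogeneous_X_pow _ _)).C_mul _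
  · rw [toSphere_last]
    exact ((isHomogeneous_coneForm r).sub (isHomogeneous_X_pow _ _)).C_mul _
  · rw [toSphere_mid]
    exact (isHomogeneous_X _ _).mul (isHomogeneous_sub_C_mul r j)

theorem isHomogeneous_fromSphere (i : Fin (d + 1)) : (fromSphere σ r (X i)).IsHomogeneous 1 := by
  refine Fin.cases ?_ (fun j => ?_) i
  · rw [fromSphere_zero]
    exact isHomogeneous_poleForm σ
  · rw [fromSphere_succ]
    exact (isHomogeneous_X _ _).add ((isHomogeneous_poleForm σ).C_mul _)

variable {σ} (hσ : σ ^ 2 = 1)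
include hσ

/-- The tangent hyperplane at the centre of projection pulls back to the hyperplane at infinity
taken twice. -/
theorem toSphere_poleForm : toSphere σ r (poleForm d σ) = X 0 ^ 2 := by
  have h2 : C σ * C (σ / 2) = (C (1 / 2) : Coord d) := by
    rw [← C_mul]; congr 1; linear_combination (1 / 2) * hσ
  have h3 : (C (1 / 2) + C (1 / 2) : Coord d) = 1 := by
    rw [← C_add, ← C_1]; norm_num
  rw [poleForm, map_sub, map_mul, toSphere_zero, toSphere_last, MvPolynomial.algHom_C,
    MvPolynomial.algebraMap_eq]
  linear_combination (- (coneForm r - X 0 ^ 2)) * h2 + X 0 ^ 2 * h3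

/-- The tangent hyperplane at the opposite pole pulls back to the isotropic cone with vertex r. -/
theorem toSphere_antipole : toSphere σ r (poleForm d (-σ)) = coneForm r := by
  have h2 : C σ * C (σ / 2) = (C (1 / 2) : Coord d) := by
    rw [← C_mul]; congr 1; linear_combination (1 / 2) * hσ
  have h3 : (C (1 / 2) + C (1 / 2) : Coord d) = 1 := by
    rw [← C_add, ← C_1]; norm_num
  rw [poleForm, map_sub, map_mul, toSphere_zero, toSphere_last, MvPolynomial.algHom_C,
    MvPolynomial.algebraMap_eq, C_neg]
  linear_combination (coneForm r - X 0 ^ 2) * h2 + coneForm r * h3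

theorem toSphere_fromSphere (i : Fin (d + 1)) :
    toSphere σ r (fromSphere σ r (X i)) = X 0 * X i := by
  refine Fin.cases ?_ (fun j => ?_) i
  · rw [fromSphere_zero, toSphere_poleForm r hσ, sq]
  · rw [fromSphere_succ, map_add, map_mul, toSphere_poleForm r hσ, toSphere_mid,
      MvPolynomial.algHom_C, MvPolynomial.algebraMap_eq]
    ring

/-- The composite is a scaling only on the sphere: modulo `sphereEq` the pullback of `coneForm r` is
y₀² - y_{d+1}², the product of the two tangent hyperplanes. -/
theorem fromSphere_toSphere (i : Fin (d + 2)) :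
    ∃ c : Coord (d + 1), fromSphere σ r (toSphere σ r (X i)) - poleForm d σ * X i =
      c * sphereEq d := by
  have hC : ∀ a : ℂ, fromSphere σ r (C a) = C a := fun a => by
    rw [MvPolynomial.algHom_C, MvPolynomial.algebraMap_eq]
  have h1 : ∀ j : Fin d, fromSphere σ r (X j.succ - C (r j) * X 0) = X j.succ.castSucc := by
    intro j
    rw [map_sub, map_mul, hC, fromSphere_succ, fromSphere_zero, add_sub_cancel_right]
  have h2 : fromSphere σ r (coneForm r) = X 0 ^ 2 - X (Fin.last (d + 1)) ^ 2 - sphereEq d := by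
    simp only [coneForm, map_sum, map_pow, h1, sphereEq]
    ring
  have hs : (C σ ^ 2 : Coord (d + 1)) = 1 := by rw [← C_pow, hσ, C_1]
  have h3 : (C (1 / 2) * 2 : Coord (d + 1)) = 1 := by
    rw [show (2 : Coord (d + 1)) = C 2 from (map_ofNat C 2).symm, ← C_mul, ← C_1]; norm_num
  have h4 : (C (σ / 2) : Coord (d + 1)) = C σ * C (1 / 2) := by rw [← C_mul]; congr 1; ring
  revert i
  rw [forall_fin_sphere]
  refine ⟨⟨-C (1 / 2), ?_⟩, ⟨-C (σ / 2), ?_⟩, fun j => ⟨0, ?_⟩⟩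
  · rw [toSphere_zero, map_mul, hC, map_add, map_pow, h2, fromSphere_zero, poleForm]
    linear_combination C (1 / 2) * X (Fin.last (d + 1)) ^ 2 * hs +
      (X 0 ^ 2 - C σ * X 0 * X (Fin.last (d + 1))) * h3
  · rw [toSphere_last, map_mul, hC, map_sub, map_pow, h2, fromSphere_zero, poleForm, h4]
    linear_combination (C (1 / 2) * (2 * X 0 * X (Fin.last (d + 1))) - C σ * C (1 / 2) *
      X (Fin.last (d + 1)) ^ 2) * hs +
      (X 0 * X (Fin.last (d + 1)) - C σ * X (Fin.last (d + 1)) ^ 2) * h3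
  · rw [toSphere_mid, map_mul, h1, fromSphere_zero, zero_mul, sub_self]

theorem toSphere_sphereEq : toSphere σ r (sphereEq d) = 0 := by
  have hs : (C (σ / 2) ^ 2 : Coord d) = C (1 / 2) ^ 2 := by
    rw [← C_pow, ← C_pow]; congr 1; linear_combination (1 / 4) * hσ
  have h3 : (C (1 / 2) * 2 : Coord d) = 1 := by
    rw [show (2 : Coord d) = C 2 from (map_ofNat C 2).symm, ← C_mul, ← C_1]; norm_num
  have h4 : ∑ j : Fin d, (X 0 * (X j.succ - C (r j) * X 0) : Coord d) ^ 2 =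
      X 0 ^ 2 * coneForm r := by
    simp only [mul_pow, ← Finset.mul_sum, coneForm]
  simp only [sphereEq, map_sub, map_add, map_pow, map_sum, toSphere_zero, toSphere_last,
    toSphere_mid, h4]
  linear_combination (-(coneForm r - X 0 ^ 2) ^ 2) * hs +
    (X 0 ^ 2 * coneForm r * (C (1 / 2) * 2 + 1)) * h3

end Maps

/-- The lift to the sphere of a subset of projective space. -/
def lift (σ : ℂ) (r : Fin d → ℂ) (V : Set (CP d)) : Set (CP (d + 1)) :=
  closure (imageOf (toSphere σ r) (X 0) V)

/-- The projection from the sphere. -/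
def proj (σ : ℂ) (r : Fin d → ℂ) (V : Set (CP (d + 1))) : Set (CP d) :=
  closure (imageOf (fromSphere σ r) (poleForm d σ) V)

section Corr

variable {σ : ℂ} (hσ : σ ^ 2 = 1) (r : Fin d → ℂ)
include hσ

theorem imageOf_toSphere_subset (V : Set (CP d)) :
    imageOf (toSphere σ r) (X 0) V ⊆ unitSphere (d + 1) := by
  rintro q ⟨p, -, -, hq⟩
  have : eval q.rep (sphereEq d) = 0 := by
    rw [hq.eval_eq_zero_iff isHomogeneous_sphereEq, eval_eval_map, toSphere_sphereEq r hσ, map_zero]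
  rw [mem_unitSphere]
  simpa [sphereEq, sub_eq_zero] using this

theorem lift_subset (V : Set (CP d)) : lift σ r V ⊆ unitSphere (d + 1) :=
  closure_minimal (imageOf_toSphere_subset hσ r V) isClosed_unitSphere

theorem corr_lift (V : Set (CP d)) :
    Corr (toSphere σ r) (fromSphere σ r) (X 0) (poleForm d σ) 2 1 V (lift σ r V) :=
  Corr.of_closure (isHomogeneous_toSphere σ r) (isHomogeneous_fromSphere σ r)
    (isHomogeneous_X _ _) (isHomogeneous_poleForm σ) rfl (toSphere_poleForm r hσ)
    (by rw [fromSphere_zero, pow_one])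
    (fun i => by rw [toSphere_fromSphere r hσ, sub_self]; exact Ideal.zero_mem _)
    (fun j => by
      obtain ⟨c, hc⟩ := fromSphere_toSphere r hσ j
      rw [hc]
      exact Ideal.mul_mem_left _ _ (sphereEq_mem (imageOf_toSphere_subset hσ r V)))

theorem corr_proj {V : Set (CP (d + 1))} (hV : V ⊆ unitSphere (d + 1)) :
    Corr (fromSphere σ r) (toSphere σ r) (poleForm d σ) (X 0) 1 2 V (proj σ r V) :=
  Corr.of_closure (isHomogeneous_fromSphere σ r) (isHomogeneous_toSphere σ r)
    (isHomogeneous_poleForm σ) (isHomogeneous_X _ _) rfl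
    (by rw [fromSphere_zero, pow_one]) (toSphere_poleForm r hσ)
    (fun j => by
      obtain ⟨c, hc⟩ := fromSphere_toSphere r hσ j
      rw [hc]
      exact Ideal.mul_mem_left _ _ (sphereEq_mem hV))
    (fun i => by rw [toSphere_fromSphere r hσ, sub_self]; exact Ideal.zero_mem _)

end Corr

/-! ### Real points -/

/-- A complex vector space is not a finite union of proper subspaces; this supplies every general
hyperplane used below. -/
theorem exists_dot_ne_zero {ι : Type*} [Fintype ι] {F : Set (ι → ℂ)} (hF : F.Finite)
    (h0 : ∀ v ∈ F, v ≠ 0) : ∃ b : ι → ℂ, ∀ v ∈ F, ∑ i, b i * v i ≠ 0 := by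
  classical
  have := hF.to_subtype
  obtain ⟨f, hf⟩ := Module.exists_dual_forall_apply_ne_zero (K := ℂ) (fun v : F => (v : ι → ℂ))
    (fun v => h0 v v.2)
  refine ⟨fun i => f (Pi.single i 1), fun v hv => ?_⟩
  have h1 := hf ⟨v, hv⟩
  have h2 : f v = ∑ i, f (Pi.single i 1) * v i := by
    conv_lhs => rw [← Finset.univ_sum_single v, map_sum]
    refine Finset.sum_congr rfl fun i _ => ?_
    have : (Pi.single i (v i) : ι → ℂ) = v i • Pi.single i 1 := by
      rw [← Pi.single_smul, smul_eq_mul, mul_one]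
    rw [this, map_smul, smul_eq_mul, mul_comm]
  rwa [← h2]

theorem realPoints_of_map {n m s : ℕ} {φ : Coord m →ₐ[ℂ] Coord n}
    (hφ : ∀ j, (φ (X j)).IsHomogeneous s)
    (hreal : ∀ (w : Fin (n + 1) → ℝ) (j : Fin (m + 1)), ∃ a : ℝ,
      eval (fun i => (w i : ℂ)) (φ (X j)) = a) :
    ∀ p ∈ realPoints n, ∀ q : CP m,
      (q.HasCoords fun j => eval p.rep (φ (X j))) → q ∈ realPoints m := by
  rintro p ⟨w, hw⟩ q hq
  choose a ha using hreal w
  refine ⟨a, ?_⟩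
  have := HasCoords_map hφ hq hw
  simpa only [ha] using this

theorem eval_coneForm (r : Fin d → ℂ) (v : Fin (d + 1) → ℂ) :
    eval v (coneForm r) = ∑ j : Fin d, (v j.succ - r j * v 0) ^ 2 := by
  simp [coneForm]

theorem toSphere_real {σ : ℝ} (r : Fin d → ℝ) (w : Fin (d + 1) → ℝ) (j : Fin (d + 2)) :
    ∃ a : ℝ, eval (fun i => (w i : ℂ)) (toSphere (σ : ℂ) (fun i => (r i : ℂ)) (X j)) = a := by
  revert j
  rw [forall_fin_sphere]
  refine ⟨⟨1 / 2 * (∑ j : Fin d, (w j.succ - r j * w 0) ^ 2 + w 0 ^ 2), ?_⟩,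
    ⟨σ / 2 * (∑ j : Fin d, (w j.succ - r j * w 0) ^ 2 - w 0 ^ 2), ?_⟩,
    fun j => ⟨w 0 * (w j.succ - r j * w 0), ?_⟩⟩
  · rw [toSphere_zero]; simp [eval_coneForm]
  · rw [toSphere_last]; simp [eval_coneForm]
  · rw [toSphere_mid]; simp

theorem eval_poleForm (σ : ℂ) (v : Fin (d + 2) → ℂ) :
    eval v (poleForm d σ) = v 0 - σ * v (Fin.last (d + 1)) := by
  simp [poleForm]

theorem fromSphere_real {σ : ℝ} (r : Fin d → ℝ) (w : Fin (d + 2) → ℝ) (j : Fin (d + 1)) :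
    ∃ a : ℝ, eval (fun i => (w i : ℂ)) (fromSphere (σ : ℂ) (fun i => (r i : ℂ)) (X j)) = a := by
  refine Fin.cases ⟨w 0 - σ * w (Fin.last (d + 1)), ?_⟩ (fun j => ⟨w j.succ.castSucc +
    r j * (w 0 - σ * w (Fin.last (d + 1))), ?_⟩) j
  · rw [fromSphere_zero]; simp [eval_poleForm]
  · rw [fromSphere_succ]; simp [eval_poleForm]

/-- A real point of the sphere with vanishing coordinates `y₁, …, y_d` is one of the two poles;
a real point on the tangent hyperplane at a pole is that pole. -/
theorem mid_eq_zero_of_real {p : CP (d + 1)} (hp : p ∈ unitSphere (d + 1))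
    (hreal : p ∈ realPoints (d + 1)) {σ : ℂ} (hσ : σ ^ 2 = 1)
    (h : eval p.rep (poleForm d σ) = 0) (j : Fin d) : p.rep j.succ.castSucc = 0 := by
  obtain ⟨w, hw⟩ := hreal
  have h1 : eval (fun i => (w i : ℂ)) (sphereEq d) = 0 := by
    rw [← hw.eval_eq_zero_iff isHomogeneous_sphereEq]
    simpa [sphereEq, sub_eq_zero] using mem_unitSphere.1 hp
  rw [hw.eval_eq_zero_iff (isHomogeneous_poleForm σ), eval_poleForm, sub_eq_zero] at h
  have h2 : ((∑ j : Fin d, w j.succ.castSucc ^ 2 : ℝ) : ℂ) = 0 := by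
    simp only [sphereEq, map_sub, map_add, map_pow, map_sum, eval_X] at h1
    push_cast
    rw [h] at h1
    linear_combination -h1 + (w (Fin.last (d + 1)) : ℂ) ^ 2 * hσ
  have h3 : ∑ j : Fin d, w j.succ.castSucc ^ 2 = 0 := by exact_mod_cast h2
  have h4 := (Finset.sum_eq_zero_iff_of_nonneg (fun j _ => sq_nonneg _)).1 h3 j (Finset.mem_univ j)
  have h5 : eval p.rep (X j.succ.castSucc) = 0 := by
    rw [hw.eval_eq_zero_iff (isHomogeneous_X _ _), eval_X]
    exact_mod_cast pow_eq_zero_iff (two_ne_zero) |>.1 h4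
  simpa using h5

end SphericalCurve

namespace SphericalCurve

open MvPolynomial Filter

/-! ### The projection from a pole -/

variable {d : ℕ}

/-- The pole `[1, 0, …, 0, σ]`. -/
def pole (d : ℕ) (σ : ℂ) : CP (d + 1) :=
  CP.mk (sphereVec 1 0 σ) fun h => one_ne_zero (α := ℂ) (by simpa using congrFun h 0)

theorem hasCoords_pole (σ : ℂ) : (pole d σ).HasCoords (sphereVec 1 0 σ) := CP.hasCoords_mk _ _

theorem eq_pole {p : CP (d + 1)} {σ : ℂ} (h : eval p.rep (poleForm d σ) = 0 ∨ p.rep (Fin.last (d + 1)) = σ * p.rep 0) (hσ : σ ^ 2 = 1)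
    (hmid : ∀ j : Fin d, p.rep j.succ.castSucc = 0) : p = pole d σ := by
  have h' : p.rep (Fin.last (d + 1)) = σ * p.rep 0 := by
    rcases h with h | h
    · rw [eval_poleForm] at h
      linear_combination (-σ) * h - p.rep (Fin.last (d + 1)) * hσ
    · exact h
  refine (hasCoords_pole σ).unique_smul p.hasCoords_rep (c := p.rep 0) ?_ |>.symm
  funext i
  revert i
  rw [forall_fin_sphere]
  refine ⟨by simp, ?_, fun j => ?_⟩
  · rw [Pi.smul_apply, sphereVec_last, smul_eq_mul, h', mul_comm]
  · rw [Pi.smul_apply, sphereVec_mid, hmid]; simp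

theorem isHomogeneous_sum_mid (b : Fin d → ℂ) :
    (∑ j : Fin d, C (b j) * X j.succ.castSucc : Coord (d + 1)).IsHomogeneous 1 :=
  IsHomogeneous.sum _ _ _ fun _ _ => isHomogeneous_C_mul_X _ _

theorem isHomogeneous_sum_sub (b r : Fin d → ℂ) :
    (∑ j : Fin d, C (b j) * (X j.succ - C (r j) * X 0) : Coord d).IsHomogeneous 1 :=
  IsHomogeneous.sum _ _ _ fun j _ => (isHomogeneous_sub_C_mul r j).C_mul _

theorem fromSphere_sum_sub (σ : ℂ) (b r : Fin d → ℂ) :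
    fromSphere σ r (∑ j : Fin d, C (b j) * (X j.succ - C (r j) * X 0)) =
      ∑ j : Fin d, C (b j) * X j.succ.castSucc := by
  simp only [map_sum, map_mul, map_sub, fromSphere_zero, MvPolynomial.algHom_C,
    MvPolynomial.algebraMap_eq]
  refine Finset.sum_congr rfl fun j _ => ?_
  rw [fromSphere_succ, add_sub_cancel_right]

theorem toSphere_sum_mid (σ : ℂ) (b r : Fin d → ℂ) :
    toSphere σ r (∑ j : Fin d, C (b j) * X j.succ.castSucc) =
      X 0 * ∑ j : Fin d, C (b j) * (X j.succ - C (r j) * X 0) := by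
  simp only [map_sum, map_mul, MvPolynomial.algHom_C, MvPolynomial.algebraMap_eq, Finset.mul_sum]
  refine Finset.sum_congr rfl fun j _ => ?_
  rw [toSphere_mid]; ring

theorem toSphere_vec_ne_zero {σ : ℂ} (hσ : σ ^ 2 = 1) (r : Fin d → ℂ) {p : CP d}
    (hp : eval p.rep (X 0 : Coord d) ≠ 0) :
    (fun j => eval p.rep (toSphere σ r (X j))) ≠ 0 := fun h => by
  have h1 := eval_eval_map (toSphere σ r) p.rep (poleForm d σ)
  rw [h, eval_poleForm, toSphere_poleForm r hσ, map_pow] at h1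
  exact pow_ne_zero 2 hp (by simpa using h1.symm)

theorem fromSphere_vec_ne_zero {σ : ℂ} (r : Fin d → ℂ) {p : CP (d + 1)}
    (hp : eval p.rep (poleForm d σ) ≠ 0) :
    (fun j => eval p.rep (fromSphere σ r (X j))) ≠ 0 := fun h => by
  have h1 := congrFun h 0
  rw [fromSphere_zero] at h1
  exact hp h1

theorem locLength_eq_zero_of_notMem {n : ℕ} {V : Set (CP n)} (hV : IsClosed V) {p : CP n}
    (hp : p ∉ V) (f : Coord n) : intersectionMult V f p = 0 := by
  rw [intersectionMult_eq, locLength_eq_zero_iff]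
  exact fun h => hp (mem_of_idealOf_le_pointIdeal hV (le_sup_left.trans h))

/-- The projection from a pole of a real curve on the sphere. -/
theorem proj_spec {σ : ℝ} (hσ : (σ : ℂ) ^ 2 = 1) (r : Fin d → ℝ) {V : Set (CP (d + 1))}
    (hV : IsRealCurve V) (hVs : V ⊆ unitSphere (d + 1)) {e : ℕ} (he : HasDegree V e) :
    IsRegularOn (poleForm d σ) V ∧ IsRealCurve (proj (σ : ℂ) (fun i => (r i : ℂ)) V) ∧
    ∃ (N : ℕ) (b : Fin d → ℂ), b ≠ 0 ∧ HasDegree (proj (σ : ℂ) (fun i => (r i : ℂ)) V) N ∧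
      pointMult V (pole d σ) =
        intersectionMult V (∑ j : Fin d, C (b j) * X j.succ.castSucc) (pole d σ) ∧
      (e : ℕ∞) = N + pointMult V (pole d σ) := by
  set r' : Fin d → ℂ := fun i => (r i : ℂ) with hr'
  have hc := corr_proj hσ r' hVs
  have hVcl := hV.isClosed
  have hVr := hV.hasRealComponents
  have hVg := he.hasLinearGrowth
  have hσ' : (-(σ : ℂ)) ^ 2 = 1 := by rw [neg_sq, hσ]
  set W := proj (σ : ℂ) r' V with hWdef
  have hWcl : IsClosed W := isClosed_closure
  -- Avoiding both poles makes the coordinates y₁, …, y_d of each test point not all zero. As the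
  -- test points are real, they also avoid the tangent hyperplane at the pole.
  obtain ⟨P, hPfin, hPV, hPB, hPne, hP⟩ := hVr.exists_test_points hVg
    (B := {pole d σ, pole d (-σ)}) (by simp)
  have hmid : ∀ z ∈ P, (fun j : Fin d => z.rep j.succ.castSucc) ≠ 0 := by
    intro z hz h0
    have h1 := mem_unitSphere.1 (hVs (hPV hz).1)
    have h2 : ∀ j : Fin d, z.rep j.succ.castSucc = 0 := fun j => congrFun h0 j
    have h3 : (z.rep (Fin.last (d + 1)) - σ * z.rep 0) *
        (z.rep (Fin.last (d + 1)) - (-σ) * z.rep 0) = 0 := by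
      simp only [h2] at h1
      simp at h1
      linear_combination -h1 - z.rep 0 ^ 2 * hσ
    refine Set.disjoint_left.1 hPB hz ?_
    rcases mul_eq_zero.1 h3 with h4 | h4
    · exact Or.inl (eq_pole (Or.inr (sub_eq_zero.1 h4)) hσ h2)
    · exact Or.inr (eq_pole (Or.inr (sub_eq_zero.1 h4)) hσ' h2)
  have hθP : ∀ z ∈ P, eval z.rep (poleForm d σ) ≠ 0 := fun z hz h0 =>
    hmid z hz (funext fun j => mid_eq_zero_of_real (hVs (hPV hz).1) (hPV hz).2 hσ h0 j)
  have hθreg := (hP 1 _ (isHomogeneous_poleForm _) hθP).1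
  have hWr : HasRealComponents W := hVr.imageOf hVg (isHomogeneous_fromSphere _ r')
    (isHomogeneous_poleForm _) (fun p _ h => fromSphere_vec_ne_zero r' h)
    (fun p hp p' hp' q h h' hq hq' => by
      obtain ⟨c, hc0, hc1⟩ := hq.eq_smul hq'
      have h1 := hc.hasCoords hp h hq
      have h2 := hc.hasCoords hp' h' hq'
      exact h1.unique h2)
    (realPoints_of_map (isHomogeneous_fromSphere _ r') (fromSphere_real r))
  have hWg : HasLinearGrowth W := hVg.imageOf le_rfl (isHomogeneous_fromSphere _ r')
  obtain ⟨hζW, hζfin⟩ := hWr.regular_of_dense hWg (isHomogeneous_X ℂ 0) (A := imageOf _ _ V) rfl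
    (fun q ⟨p, hp, hθ, hq⟩ => hc.eval_ζ_ne_zero hθ hq)
  have hVne := hV.nonempty
  have hWne : W.Nonempty := by
    obtain ⟨z, hz⟩ := hPne hVne
    exact ⟨_, subset_closure ⟨z, (hPV hz).1, hθP z hz,
      CP.hasCoords_mk _ (fromSphere_vec_ne_zero r' (hθP z hz))⟩⟩
  refine ⟨hθreg, hWr.isRealCurve hWne hWg, ?_⟩
  -- The hyperplane h through r must miss the finitely many points of W at infinity, and its
  -- pullback ∑ bⱼ yⱼ, which passes through both poles, must miss the test points.
  obtain ⟨b, hb⟩ := exists_dot_ne_zero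
    (F := (fun q : CP d => fun j : Fin d => q.rep j.succ) '' {q | q ∈ W ∧ eval q.rep (X 0) = 0} ∪
      (fun z : CP (d + 1) => fun j : Fin d => z.rep j.succ.castSucc) '' P)
    ((hζfin.image _).union (hPfin.image _)) (by
      rintro _ (⟨q, hq, rfl⟩ | ⟨z, hz, rfl⟩)
      · intro h0
        refine q.rep_ne_zero (funext fun i => ?_)
        refine Fin.cases (by simpa using hq.2) (fun j => congrFun h0 j) i
      · exact hmid z hz)
  set h : Coord d := ∑ j : Fin d, C (b j) * (X j.succ - C (r' j) * X 0) with hh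
  have hhom : h.IsHomogeneous 1 := isHomogeneous_sum_sub b r'
  have hφh : fromSphere (σ : ℂ) r' h = ∑ j : Fin d, C (b j) * X j.succ.castSucc :=
    fromSphere_sum_sub _ b r'
  have hhinf : ∀ q ∈ W, eval q.rep (X 0 : Coord d) = 0 → eval q.rep h ≠ 0 := by
    intro q hq hq0
    have h1 := hb _ (Or.inl ⟨q, ⟨hq, hq0⟩, rfl⟩)
    rw [eval_X] at hq0
    simpa [hh, hq0] using h1
  have hhP : ∀ z ∈ P, eval z.rep (fromSphere (σ : ℂ) r' h) ≠ 0 := by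
    intro z hz
    have h1 := hb _ (Or.inr ⟨z, hz, rfl⟩)
    rw [hφh]
    simpa only [map_sum, map_mul, eval_C, eval_X] using h1
  obtain ⟨hreg, hfin⟩ := hP 1 _ (by rw [hφh]; exact isHomogeneous_sum_mid b) hhP
  -- The tangent form is regular on V, so the factor θ in the correspondence can be dropped and the
  -- pulled back ideal has no zeros outside W.
  have hKW : ∀ q, (idealOf V).comap (fromSphere (σ : ℂ) r') ≤ pointIdeal q → q ∈ W := by
    intro q hq
    refine mem_of_idealOf_le_pointIdeal hWcl (le_trans (fun F hF => ?_) hq)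
    rw [Ideal.mem_comap]
    exact hθreg _ (by rw [mul_comm]; exact hc.mul_φ_mem F hF)
  have hpole : ∀ {e : ℕ} {f : Coord (d + 1)}, f.IsHomogeneous e →
      (f ∈ pointIdeal (pole d σ) ↔ eval (sphereVec 1 0 (σ : ℂ)) f = 0) := fun hf => by
    rw [mem_pointIdeal_of_isHomogeneous hf, (hasCoords_pole (d := d) (σ : ℂ)).eval_eq_zero_iff hf]
  have hmin : pointMult V (pole d σ) =
      intersectionMult V (∑ j : Fin d, C (b j) * X j.succ.castSucc) (pole d σ) := by
    have hlin : ∀ b : Fin d → ℂ, linearForm (sphereVec 0 b 0) =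
        ∑ j : Fin d, C (b j) * X j.succ.castSucc := by
      intro b
      rw [linearForm, sum_sphere]
      simp only [sphereVec_zero, sphereVec_last, sphereVec_mid]
      simp
    have hb0 : b ≠ 0 := by
      rintro rfl
      obtain ⟨z, hz⟩ := hPne hVne
      exact hb _ (Or.inr ⟨z, hz, rfl⟩) (by simp)
    refine le_antisymm ?_ (le_iInf fun ⟨a, ha0, ha⟩ => ?_)
    · refine (iInf_le _ ⟨sphereVec 0 b 0, fun h0 => hb0 (funext fun j => ?_), ?_⟩).trans
        (by rw [hlin])
      · rw [← sphereVec_mid (0 : ℂ) b 0 j, h0]; rfl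
      · rw [hlin, (hasCoords_pole (d := d) (σ : ℂ)).eval_eq_zero_iff (isHomogeneous_sum_mid b)]
        simp only [map_sum, map_mul, eval_X, sphereVec_mid]
        simp
    · have hla : (linearForm a).IsHomogeneous 1 :=
        IsHomogeneous.sum _ _ _ fun _ _ => isHomogeneous_C_mul_X _ _
      rw [(hasCoords_pole (d := d) (σ : ℂ)).eval_eq_zero_iff hla, linearForm, sum_sphere] at ha
      simp only [map_add, map_sum, map_mul, eval_X, eval_C, sphereVec_mid, sphereVec_last,
        sphereVec_zero] at ha
      have ha' : a (Fin.last (d + 1)) = -(σ * a 0) := by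
        simp at ha
        linear_combination σ * ha - a (Fin.last (d + 1)) * hσ
      -- A hyperplane through the pole satisfies a_{d+1} = -σ a₀, so its equation combines the
      -- tangent form with y₁, …, y_d and is the pullback of h'. All competitors in the infimum thus
      -- belong to the linear system.
      let h' : Coord d := C (a 0) * X 0 +
        ∑ j : Fin d, C (a j.succ.castSucc) * (X j.succ - C (r' j) * X 0)
      have hh' : h'.IsHomogeneous 1 :=
        (isHomogeneous_C_mul_X _ _).add (isHomogeneous_sum_sub (fun j => a j.succ.castSucc) r')
      have hφh' : fromSphere (σ : ℂ) r' h' = linearForm a := by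
        rw [map_add, fromSphere_sum_sub _ (fun j => a j.succ.castSucc) r', map_mul, fromSphere_zero,
          MvPolynomial.algHom_C, MvPolynomial.algebraMap_eq, linearForm, sum_sphere, ha', poleForm,
          C_neg, C_mul]
        ring
      have := locLength_le_of_general (p := pole d σ) (V := V) (φ := fromSphere (σ : ℂ) r') le_rfl
        (isHomogeneous_fromSphere _ r') (isHomogeneous_X ℂ 0) hhom hh'
        (fun q hq => hhinf q (hKW q hq)) ?_ hreg
      · rwa [hφh, hφh'] at this
      -- The tangent hyperplane vanishes to second order on the sphere at the pole: its product with
      -- the other tangent form, nonzero there, equals ∑ yⱼ² modulo the equation of the sphere.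
      · refine ⟨poleForm d (-σ), ?_, ?_⟩
        · rw [hpole (isHomogeneous_poleForm _), eval_poleForm, sphereVec_zero, sphereVec_last]
          intro h0
          have : (2 : ℂ) = 0 := by linear_combination h0 - hσ
          norm_num at this
        · have h1 : poleForm d (-σ) * poleForm d σ = ∑ j : Fin d, X j.succ.castSucc *
              X j.succ.castSucc + sphereEq d := by
            have hs : (C (σ : ℂ) ^ 2 : Coord (d + 1)) = 1 := by rw [← C_pow, hσ, C_1]
            simp only [← sq, sphereEq, poleForm, C_neg]
            linear_combination -X (Fin.last (d + 1)) ^ 2 * hs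
          rw [fromSphere_zero, h1]
          refine Ideal.add_mem _ (Ideal.mem_sup_left (Ideal.sum_mem _ fun j _ =>
            Ideal.mul_mem_mul ?_ ?_)) (Ideal.mem_sup_right (sphereEq_mem hVs))
          · rw [hpole (isHomogeneous_X _ _), eval_X, sphereVec_mid]; rfl
          · have h2 : (X j.succ.castSucc : Coord (d + 1)) = fromSphere (σ : ℂ) r' (X j.succ) -
                C (r' j) * fromSphere (σ : ℂ) r' (X 0) := by
              rw [fromSphere_succ, fromSphere_zero, add_sub_cancel_right]
            rw [h2]
            exact Ideal.sub_mem _ (Ideal.subset_span ⟨_, rfl⟩)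
              (Ideal.mul_mem_left _ _ (Ideal.subset_span ⟨_, rfl⟩))
  -- The pole is the only possible base point: any other point of V on the tangent hyperplane has an
  -- image in W at infinity, where h does not vanish.
  obtain ⟨N, hN, hsum⟩ := hc.exists_hasDegree hVcl hWcl hζW he hhom hreg hfin hhinf
    (E := {pole d σ}) (fun p hp hp0 hpθ => by
      rw [Finset.mem_singleton]
      refine eq_pole (Or.inl hpθ) hσ fun j => ?_
      by_contra hne
      have hvec : (fun j => eval p.rep (fromSphere (σ : ℂ) r' (X j))) ≠ 0 := by
        intro h0
        have h1 := congrFun h0 j.succ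
        simp only [fromSphere_succ, map_add, map_mul, hpθ, mul_zero, add_zero, eval_X] at h1
        exact hne h1
      have hq := CP.hasCoords_mk _ hvec
      have hqW : CP.mk _ hvec ∈ W := by
        refine mem_of_forall_mem_idealOf hWcl fun t F hF hFW => ?_
        rw [hq.eval_eq_zero_iff hF, eval_eval_map]
        exact mem_idealOf.1 (hθreg _ (by rw [mul_comm]; exact hc.mul_φ_mem F hFW)) p hp _
          p.hasCoords_rep
      refine hhinf _ hqW ?_ ?_
      · rw [hq.eval_eq_zero_iff (isHomogeneous_X _ _), eval_eval_map, fromSphere_zero, hpθ]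
      · rw [hq.eval_eq_zero_iff hhom, eval_eval_map, hp0])
    (fun p hp => by
      rw [Finset.mem_singleton.1 hp, (hasCoords_pole (d := d) (σ : ℂ)).eval_eq_zero_iff
        (isHomogeneous_poleForm _), eval_poleForm, sphereVec_zero, sphereVec_last]
      linear_combination -hσ)
  refine ⟨N, b, ?_, hN, hmin, ?_⟩
  · rintro rfl
    obtain ⟨z, hz⟩ := hPne hVne
    exact hb _ (Or.inr ⟨z, hz, rfl⟩) (by simp)
  · rw [hmin, ← hφh]
    simpa using hsum

end SphericalCurve

namespace SphericalCurve

open MvPolynomial Filter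

/-! ### The lift to the sphere -/

variable {d : ℕ}

theorem mem_sphereAtInfinity {p : CP d} : p ∈ sphereAtInfinity d ↔
    p.rep 0 = 0 ∧ ∑ j : Fin d, p.rep j.succ ^ 2 = 0 := by
  have : p ∈ sphereAtInfinity d ↔ p.rep 0 ^ 2 = ∑ i : Fin d, p.rep i.succ ^ 2 ∧ ¬ p.rep 0 ≠ 0 :=
    Iff.rfl
  rw [this, not_not]
  constructor
  · rintro ⟨h1, h2⟩
    exact ⟨h2, by rw [← h1, h2]; ring⟩
  · rintro ⟨h1, h2⟩
    exact ⟨by rw [h1, h2]; ring, h1⟩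

/-- The equation of a hyperplane whose pullback under `toSphere` is a sphere. -/
def sphereLin (σ : ℂ) (c : Fin d → ℂ) (τ : ℂ) : Coord (d + 1) :=
  poleForm d (-σ) + ∑ j : Fin d, C (c j) * X j.succ.castSucc + C τ * poleForm d σ

theorem isHomogeneous_sphereLin (σ : ℂ) (c : Fin d → ℂ) (τ : ℂ) :
    (sphereLin σ c τ).IsHomogeneous 1 :=
  ((isHomogeneous_poleForm _).add (isHomogeneous_sum_mid c)).add
    ((isHomogeneous_poleForm _).C_mul _)

theorem eval_sphereForm (c : Fin d → ℂ) (ρ : ℂ) (v : Fin (d + 1) → ℂ) :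
    eval v (sphereForm c ρ) = ∑ j : Fin d, (v j.succ - c j * v 0) ^ 2 - ρ * v 0 ^ 2 := by
  simp [sphereForm]

theorem toSphere_sphereLin {σ : ℂ} (hσ : σ ^ 2 = 1) (r c : Fin d → ℂ) (τ : ℂ) :
    toSphere σ r (sphereLin σ c τ) = coneForm r +
      X 0 * ∑ j : Fin d, C (c j) * (X j.succ - C (r j) * X 0) + C τ * X 0 ^ 2 := by
  simp only [sphereLin, map_add, map_mul]
  rw [toSphere_antipole r hσ, toSphere_poleForm r hσ, toSphere_sum_mid, MvPolynomial.algHom_C,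
    MvPolynomial.algebraMap_eq]

/-- Completing the square. The coefficient τ changes only the squared radius, and the cⱼ move the
centre. -/
theorem toSphere_sphereLin_eq_sphereForm {σ : ℂ} (hσ : σ ^ 2 = 1) (r c : Fin d → ℂ) (τ : ℂ) :
    toSphere σ r (sphereLin σ c τ) =
      sphereForm (fun j => r j - c j / 2) (∑ j, c j ^ 2 / 4 - τ) := by
  have key : ∀ j : Fin d, (X j.succ - C (r j - c j / 2) * X 0 : Coord d) ^ 2 =
      (X j.succ - C (r j) * X 0) ^ 2 + X 0 * (C (c j) * (X j.succ - C (r j) * X 0)) +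
        C (c j ^ 2 / 4) * X 0 ^ 2 := by
    intro j
    have h1 : (C (c j / 2) * 2 : Coord d) = C (c j) := by
      rw [show (2 : Coord d) = C 2 from (map_ofNat C 2).symm, ← C_mul]; congr 1; ring
    have h2 : (C (c j ^ 2 / 4) : Coord d) = C (c j / 2) ^ 2 := by
      rw [← C_pow]; congr 1; ring
    rw [h2, ← h1, C_sub]
    ring
  rw [toSphere_sphereLin hσ, sphereForm, Finset.sum_congr rfl fun j _ => key j,
    Finset.sum_add_distrib, Finset.sum_add_distrib, ← Finset.mul_sum, ← Finset.sum_mul, C_sub,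
    map_sum, coneForm]
  ring

theorem exists_toSphere_eq_sphereForm {σ : ℂ} (hσ : σ ^ 2 = 1) (r c : Fin d → ℂ) (ρ : ℂ) :
    ∃ h : Coord (d + 1), h.IsHomogeneous 1 ∧ toSphere σ r h = sphereForm c ρ := by
  refine ⟨sphereLin σ (fun j => 2 * (r j - c j)) (∑ j, (2 * (r j - c j)) ^ 2 / 4 - ρ),
    isHomogeneous_sphereLin _ _ _, ?_⟩
  rw [toSphere_sphereLin_eq_sphereForm hσ]
  congr 1
  · funext j; ring
  · ring

/-- A sum of squares of real numbers, not all zero, is positive; hence Σ_∞ has no real points. -/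
theorem sum_sq_ne_zero_of_real {p : CP d} (hp : p ∈ realPoints d) (h0 : p.rep 0 = 0) :
    ∑ j : Fin d, p.rep j.succ ^ 2 ≠ 0 := by
  obtain ⟨w, hw⟩ := hp
  obtain ⟨c, hc, hcw⟩ := p.hasCoords_rep.eq_smul hw
  intro h
  have h1 : ((∑ j : Fin d, w j.succ ^ 2 : ℝ) : ℂ) = 0 := by
    push_cast
    have : ∀ i, (w i : ℂ) = c * p.rep i := fun i => congrFun hcw i
    simp only [this, mul_pow, ← Finset.mul_sum, h, mul_zero]
  have h2 : ∑ j : Fin d, w j.succ ^ 2 = 0 := by exact_mod_cast h1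
  refine hw.ne_zero (funext fun i => ?_)
  refine Fin.cases ?_ (fun j => ?_) i
  · have := congrFun hcw 0
    simp only [Pi.smul_apply, h0, smul_zero] at this
    exact this
  · have h4 := (Finset.sum_eq_zero_iff_of_nonneg (fun j _ => sq_nonneg _)).1 h2 j
      (Finset.mem_univ j)
    simpa using h4

/-- Points over the base locus: the ideal of the graph over the hyperplane `x₀ = 0` only
contributes the pole. -/
theorem mem_lift_or_eq_pole {σ : ℂ} (hσ : σ ^ 2 = 1) (r : Fin d → ℂ) {V : Set (CP d)}
    {q : CP (d + 1)} (hq : (idealOf V).comap (toSphere σ r) ≤ pointIdeal q) :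
    q ∈ lift σ r V ∨ q = pole d σ := by
  by_contra hcon
  rw [not_or] at hcon
  obtain ⟨f, hf, hf0, hfq⟩ := exists_linear_ne (Ne.symm hcon.2)
  rw [(hasCoords_pole σ).eval_eq_zero_iff hf] at hf0
  refine hcon.1 (mem_of_forall_mem_idealOf isClosed_closure fun t F hF hFW => ?_)
  -- A point of V on x₀ = 0 is sent by the quadratic forms to a multiple, possibly zero, of the
  -- coordinates of the pole, where f vanishes. Elsewhere F vanishes on the image.
  have hmem : f * F ∈ (idealOf V).comap (toSphere σ r) := by
    have hh := isHomogeneous_map (isHomogeneous_toSphere σ r) (hf.mul hF)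
    rw [Ideal.mem_comap, mem_idealOf_of_isHomogeneous hh]
    intro p hp
    rw [map_mul, map_mul]
    have h1 := mem_idealOf.1 ((corr_lift hσ r V).mul_φ_mem F hFW) p hp _ p.hasCoords_rep
    rw [map_mul] at h1
    rcases mul_eq_zero.1 h1 with h2 | h2
    · rw [eval_X] at h2
      have h3 : (fun j => eval p.rep (toSphere σ r (X j))) =
          (1 / 2 * ∑ j : Fin d, p.rep j.succ ^ 2) • sphereVec 1 0 σ := by
        funext j
        revert j
        rw [forall_fin_sphere]
        refine ⟨?_, ?_, fun j => ?_⟩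
        · rw [toSphere_zero]; simp [eval_coneForm, h2]
        · rw [toSphere_last]; simp [eval_coneForm, h2]; ring
        · rw [toSphere_mid, Pi.smul_apply, sphereVec_mid]; simp [h2]
      rw [← eval_eval_map, h3, eval_smul_of_isHomogeneous hf, hf0, mul_zero, zero_mul]
    · rw [h2, mul_zero]
  rcases (inferInstance : (pointIdeal q).IsPrime).mem_or_mem (hq hmem) with h | h
  · exact absurd ((mem_pointIdeal_of_isHomogeneous hf).1 h) hfq
  · exact (mem_pointIdeal_of_isHomogeneous hF).1 h

/-- The lift of a real curve to the sphere. -/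
theorem lift_spec {σ : ℝ} (hσ : (σ : ℂ) ^ 2 = 1) (r : Fin d → ℝ) {V : Set (CP d)}
    (hV : IsRealCurve V) {e : ℕ} (he : HasDegree V e) :
    HasRealComponents (lift (σ : ℂ) (fun i => (r i : ℂ)) V) ∧
    HasLinearGrowth (lift (σ : ℂ) (fun i => (r i : ℂ)) V) ∧
    IsRegularOn (poleForm d σ) (lift (σ : ℂ) (fun i => (r i : ℂ)) V) ∧
    {q | q ∈ lift (σ : ℂ) (fun i => (r i : ℂ)) V ∧ eval q.rep (poleForm d σ) = 0}.Finite ∧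
    ∃ (N : ℕ) (E : Finset (CP d)), HasDegree (lift (σ : ℂ) (fun i => (r i : ℂ)) V) N ∧
      (∀ p ∈ E, p ∈ sphereAtInfinity d) ∧
      (∀ p ∈ sphereAtInfinity d, p ∉ E → multAtInfinity V p = 0) ∧
      ((2 * e : ℕ) : ℕ∞) = N + ∑ p ∈ E, multAtInfinity V p := by
  classical
  set r' : Fin d → ℂ := fun i => (r i : ℂ) with hr'
  have hc := corr_lift hσ r' V
  have hVcl := hV.isClosed
  have hVr := hV.hasRealComponents
  have hVg := he.hasLinearGrowth
  set W := lift (σ : ℂ) r' V with hWdef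
  have hWcl : IsClosed W := isClosed_closure
  have hWr : HasRealComponents W := hVr.imageOf hVg (isHomogeneous_toSphere _ r')
    (isHomogeneous_X _ _) (fun p _ h => toSphere_vec_ne_zero hσ r' h)
    (fun p hp p' hp' q h h' hq hq' =>
      (hc.hasCoords hp h hq).unique (hc.hasCoords hp' h' hq'))
    (realPoints_of_map (isHomogeneous_toSphere _ r') (toSphere_real r))
  have hWg : HasLinearGrowth W := hVg.imageOf one_le_two (isHomogeneous_toSphere _ r')
  obtain ⟨hζW, hζfin⟩ := hWr.regular_of_dense hWg (isHomogeneous_poleForm (d := d) (σ : ℂ))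
    (A := imageOf _ _ V) rfl (fun q ⟨p, hp, hθ, hq⟩ => hc.eval_ζ_ne_zero hθ hq)
  refine ⟨hWr, hWg, hζW, hζfin, ?_⟩
  obtain ⟨P, hPfin, hPV, -, -, hP⟩ := hVr.exists_test_points hVg (B := ∅) Set.finite_empty
  -- a general hyperplane section of the lift
  let vec : CP (d + 1) → Fin (d + 1) → ℂ := fun q =>
    Fin.cons (eval q.rep (poleForm d (-σ))) fun j => q.rep j.succ.castSucc
  -- Nonvanishing is imposed at the points of the lift over infinity and at the pole itself, which
  -- can be a zero of the pulled back ideal without lying on the lift.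
  obtain ⟨b, hb⟩ := exists_dot_ne_zero
    (F := vec '' ({q | q ∈ W ∧ eval q.rep (poleForm d σ) = 0} ∪ {pole d σ}))
    ((hζfin.union (Set.finite_singleton _)).image _) (by
      have key : ∀ q : CP (d + 1), eval q.rep (poleForm d σ) = 0 → vec q ≠ 0 := by
        intro q hq h0
        have hu : eval q.rep (poleForm d (-σ)) = 0 := congrFun h0 0
        rw [eval_poleForm] at hq hu
        have h00 : q.rep 0 = 0 := by linear_combination (1 / 2) * hq + (1 / 2) * hu
        refine q.rep_ne_zero (funext fun i => ?_)
        revert i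
        rw [forall_fin_sphere]
        refine ⟨h00, ?_, fun j => congrFun h0 j.succ⟩
        rw [h00] at hq
        change q.rep (Fin.last (d + 1)) = 0
        linear_combination (-(σ : ℂ)) * hq - q.rep (Fin.last (d + 1)) * hσ
      rintro _ ⟨q, hq | hq, rfl⟩
      · exact key q hq.2
      · rw [Set.mem_singleton_iff] at hq
        refine key q ?_
        rw [hq, (hasCoords_pole (d := d) (σ : ℂ)).eval_eq_zero_iff (isHomogeneous_poleForm _),
          eval_poleForm, sphereVec_zero, sphereVec_last]
        linear_combination -hσ)
  have hbq : ∀ q, (q ∈ W ∨ q = pole d σ) → eval q.rep (poleForm d σ) = 0 →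
      b 0 * eval q.rep (poleForm d (-σ)) + ∑ j : Fin d, b j.succ * q.rep j.succ.castSucc ≠ 0 := by
    intro q hq hq0
    have := hb (vec q) ⟨q, hq.imp (fun h => ⟨h, hq0⟩) id, rfl⟩
    rw [Fin.sum_univ_succ] at this
    exact this
  have hpole0 : eval (pole d σ).rep (poleForm d σ) = 0 := by
    rw [(hasCoords_pole (d := d) (σ : ℂ)).eval_eq_zero_iff (isHomogeneous_poleForm _),
      eval_poleForm, sphereVec_zero, sphereVec_last]
    linear_combination -hσ
  -- At the pole the coordinates y₁, …, y_d vanish, so nonvanishing there forces this; dividing by b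
  -- 0 normalizes the hyperplane to one that pulls back to a hypersphere.
  have hb0 : b 0 ≠ 0 := by
    intro h0
    refine hbq _ (Or.inr rfl) hpole0 ?_
    rw [h0, zero_mul, zero_add]
    refine Finset.sum_eq_zero fun j _ => ?_
    have : eval (pole d (σ : ℂ)).rep (X j.succ.castSucc) = 0 := by
      rw [(hasCoords_pole (d := d) (σ : ℂ)).eval_eq_zero_iff (isHomogeneous_X _ _), eval_X,
        sphereVec_mid]
      rfl
    rw [eval_X] at this
    rw [this, mul_zero]
  let c : Fin d → ℂ := fun j => b j.succ / b 0
  -- Each affine test point excludes one value of τ, and ρ ≠ 0 excludes another; test points at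
  -- infinity are handled by reality. On the tangent hyperplane τ has no effect, so the choice of b
  -- is not disturbed.
  obtain ⟨τ, hτ⟩ := Set.Finite.infinite_compl (s := (fun z : CP d =>
    -(eval z.rep (coneForm r') + eval z.rep (X 0 * ∑ j : Fin d, C (c j) *
      (X j.succ - C (r' j) * X 0))) / z.rep 0 ^ 2) '' P ∪ {∑ j, c j ^ 2 / 4})
    ((hPfin.image _).union (Set.finite_singleton _)) |>.nonempty
  rw [Set.mem_compl_iff, Set.mem_union, not_or, Set.mem_singleton_iff] at hτ
  set h := sphereLin (σ : ℂ) c τ with hh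
  set ρ := ∑ j, c j ^ 2 / 4 - τ with hρdef
  have hρ : ρ ≠ 0 := sub_ne_zero.2 (Ne.symm hτ.2)
  have hhom : h.IsHomogeneous 1 := isHomogeneous_sphereLin _ _ _
  have hφh : toSphere (σ : ℂ) r' h = sphereForm (fun j => r' j - c j / 2) ρ :=
    toSphere_sphereLin_eq_sphereForm hσ r' c τ
  have hφhom : (toSphere (σ : ℂ) r' h).IsHomogeneous 2 :=
    isHomogeneous_map (isHomogeneous_toSphere _ _) hhom
  have hinf' : ∀ q, (q ∈ W ∨ q = pole d σ) → eval q.rep (poleForm d σ) = 0 →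
      eval q.rep h ≠ 0 := by
    intro q hq hq0 h0
    refine hbq q hq hq0 ?_
    rw [hh, sphereLin, map_add, map_add, map_mul, hq0, mul_zero, add_zero, map_sum] at h0
    have : b 0 * (eval q.rep (poleForm d (-σ)) +
        ∑ j : Fin d, eval q.rep (C (c j) * X j.succ.castSucc)) = 0 := by rw [h0, mul_zero]
    rw [mul_add, Finset.mul_sum] at this
    rw [← this]
    congr 1
    refine Finset.sum_congr rfl fun j _ => ?_
    rw [map_mul, eval_C, eval_X, ← mul_assoc, mul_div_cancel₀ _ hb0]
  have hPh : ∀ z ∈ P, eval z.rep (toSphere (σ : ℂ) r' h) ≠ 0 := by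
    intro z hz h0
    by_cases hz0 : z.rep 0 = 0
    · rw [hφh, eval_sphereForm, hz0] at h0
      refine sum_sq_ne_zero_of_real (hPV hz).2 hz0 ?_
      simpa using h0
    · refine hτ.1 ⟨z, hz, ?_⟩
      rw [hh, toSphere_sphereLin hσ, map_add, map_add, map_mul _ (C τ), eval_C, map_pow,
        eval_X] at h0
      rw [div_eq_iff (pow_ne_zero 2 hz0)]
      linear_combination -h0
  obtain ⟨hreg, hfin⟩ := hP 2 _ hφhom hPh
  have hEfin : {p | p ∈ V ∧ eval p.rep (toSphere (σ : ℂ) r' h) = 0 ∧ p.rep 0 = 0}.Finite :=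
    hfin.subset fun p hp => ⟨hp.1, hp.2.1⟩
  have hE : ∀ p, p ∈ hEfin.toFinset ↔
      p ∈ V ∧ eval p.rep (toSphere (σ : ℂ) r' h) = 0 ∧ p.rep 0 = 0 := fun p => Set.Finite.mem_toFinset _
  -- On x₀ = 0 the equation of any hypersphere reduces to the equation of Σ_∞.
  have hEinf : ∀ p, p.rep 0 = 0 → (eval p.rep (toSphere (σ : ℂ) r' h) = 0 ↔
      p ∈ sphereAtInfinity d) := by
    intro p h0
    rw [hφh, eval_sphereForm, mem_sphereAtInfinity, h0]
    simp
  obtain ⟨N, hN, hsum⟩ := hc.exists_hasDegree hVcl hWcl hζW he hhom hreg hfin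
    (fun q hq => hinf' q (Or.inl hq)) (E := hEfin.toFinset)
    (fun p hp h1 h2 => (hE p).2 ⟨hp, h1, by simpa using h2⟩)
    (fun p hp => by rw [eval_X]; exact ((hE p).1 hp).2.2)
  refine ⟨N, hEfin.toFinset, hN, fun p hp => ?_, fun p hp hpE => ?_, ?_⟩
  · exact (hEinf p ((hE p).1 hp).2.2).1 ((hE p).1 hp).2.1
  · have hp0 := (mem_sphereAtInfinity.1 hp).1
    have hpV : p ∉ V := fun hpV => hpE ((hE p).2 ⟨hpV, (hEinf p hp0).2 hp, hp0⟩)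
    refine le_antisymm ?_ bot_le
    exact (iInf_le _ ⟨(0, 1), one_ne_zero⟩).trans (locLength_eq_zero_of_notMem hVcl hpV _).le
  · rw [hsum]
    congr 1
    refine Finset.sum_congr rfl fun p hp => ?_
    have hp0 : p.rep 0 = 0 := ((hE p).1 hp).2.2
    -- Every hypersphere is a pulled back hyperplane, so the general one has the least multiplicity.
    -- Conversely the chosen section is itself a hypersphere with ρ ≠ 0, hence a competitor in the
    -- infimum.
    refine le_antisymm (le_iInf fun ⟨⟨c', ρ'⟩, hρ'⟩ => ?_) ?_
    · obtain ⟨h', hh', hφh'⟩ := exists_toSphere_eq_sphereForm hσ r' c' ρ'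
      have := locLength_le_of_general (p := p) (V := V) (φ := toSphere (σ : ℂ) r') one_le_two
        (isHomogeneous_toSphere _ r') (isHomogeneous_poleForm (d := d) (σ : ℂ)) hhom hh'
        (fun q hq => hinf' q (mem_lift_or_eq_pole hσ r' hq)) ?_ hreg
      · rwa [hφh'] at this
      · obtain ⟨i, hi⟩ : ∃ i : Fin d, p.rep i.succ ≠ 0 := by
          by_contra hcon
          push Not at hcon
          exact p.rep_ne_zero (funext fun i => Fin.cases hp0 hcon i)
        refine ⟨X i.succ, ?_, Ideal.mem_sup_left ?_⟩
        · rw [mem_pointIdeal_of_isHomogeneous (isHomogeneous_X _ _), eval_X]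
          exact hi
        · have hX0 : (X 0 : Coord d) ^ 2 ∈
              Ideal.span (Set.range fun j => toSphere (σ : ℂ) r' (X j)) := by
            rw [← toSphere_poleForm r' hσ, poleForm, map_sub, map_mul]
            exact Ideal.sub_mem _ (Ideal.subset_span ⟨_, rfl⟩)
              (Ideal.mul_mem_left _ _ (Ideal.subset_span ⟨_, rfl⟩))
          -- For a coordinate xᵢ that is nonzero at p, the form xᵢ x₀² is x₀, which vanishes at p,
          -- times a member of the ideal of the system. This is the second order vanishing that the
          -- minimality criterion requires.
          have h1 : X i.succ * toSphere (σ : ℂ) r' (poleForm d σ) =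
              X 0 * (toSphere (σ : ℂ) r' (X i.succ.castSucc) + C (r' i) * X 0 ^ 2) := by
            rw [toSphere_poleForm r' hσ, toSphere_mid]; ring
          rw [h1]
          refine Ideal.mul_mem_mul ?_ (Ideal.add_mem _ (Ideal.subset_span ⟨_, rfl⟩)
            (Ideal.mul_mem_left _ _ hX0))
          rw [mem_pointIdeal_of_isHomogeneous (isHomogeneous_X _ _), eval_X]
          exact hp0
    · refine (iInf_le _ ⟨(fun j => r' j - c j / 2, ρ), hρ⟩).trans ?_
      rw [← hφh]

end SphericalCurve

namespace SphericalCurve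

open MvPolynomial Filter

/-! ### Complex conjugation -/

theorem length_quotient_map_ringEquiv {A B : Type*} [CommRing A] [CommRing B] (ε : A ≃+* B)
    (I : Ideal A) :
    Module.length B (B ⧸ I.map (ε : A →+* B)) = Module.length A (A ⧸ I) := by
  let _ : Algebra A B := (ε : A →+* B).toAlgebra
  have h1 := Module.length_eq_of_surjective (S := A) (R := B) (M := B ⧸ I.map (ε : A →+* B))
    ε.surjective
  rw [← h1]
  refine (LinearEquiv.length_eq (R := A) ?_).symm
  refine { Ideal.quotientEquiv I (I.map (ε : A →+* B)) ε rfl with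
    map_smul' := fun a x => ?_ }
  obtain ⟨x, rfl⟩ := Ideal.Quotient.mk_surjective x
  change Ideal.Quotient.mk (I.map (ε : A →+* B)) (ε (a * x)) =
    Ideal.Quotient.mk (I.map (ε : A →+* B)) (ε a * ε x)
  rw [map_mul]

section Conj

variable {n : ℕ}

/-- Complex conjugation of the coefficients of a polynomial. -/
def conjPoly (n : ℕ) : Coord n ≃+* Coord n := mapEquiv (Fin (n + 1)) (starRingAut (R := ℂ))

@[simp] theorem conjPoly_X (i : Fin (n + 1)) : conjPoly n (X i) = X i := map_X _ i

@[simp] theorem conjPoly_C (a : ℂ) : conjPoly n (C a) = C (starRingEnd ℂ a) := map_C _ a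

theorem eval_conjPoly (v : Fin (n + 1) → ℂ) (f : Coord n) :
    eval (fun i => starRingEnd ℂ (v i)) (conjPoly n f) = starRingEnd ℂ (eval v f) := by
  induction f using MvPolynomial.induction_on with
  | C a => simp
  | add f g hf hg => simp [hf, hg]
  | mul_X f i hf => simp [hf]

theorem conjPoly_conjPoly (f : Coord n) : conjPoly n (conjPoly n f) = f := by
  induction f using MvPolynomial.induction_on with
  | C a => simp
  | add f g hf hg => simp [hf, hg]
  | mul_X f i hf => simp [hf]

theorem isHomogeneous_conjPoly {e : ℕ} {f : Coord n} (hf : f.IsHomogeneous e) :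
    (conjPoly n f).IsHomogeneous e := hf.map _

theorem CP.hasCoords_conj (p : CP n) :
    p.conj.HasCoords fun i => starRingEnd ℂ (p.rep i) := CP.hasCoords_mk _ _

theorem CP.HasCoords.conj {p : CP n} {v : Fin (n + 1) → ℂ} (h : p.HasCoords v) :
    p.conj.HasCoords fun i => starRingEnd ℂ (v i) := by
  obtain ⟨c, hc, rfl⟩ := p.hasCoords_rep.eq_smul h
  have := p.hasCoords_conj.smul (c := starRingEnd ℂ c) (by simpa using hc)
  convert this using 1
  funext i
  simp

theorem CP.conj_conj (p : CP n) : p.conj.conj = p := by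
  have := p.hasCoords_conj.conj
  simp only [Complex.conj_conj] at this
  exact this.unique p.hasCoords_rep

theorem CP.conj_eq_of_mem_realPoints {p : CP n} (hp : p ∈ realPoints n) : p.conj = p := by
  obtain ⟨w, hw⟩ := hp
  have := hw.conj
  simp only [Complex.conj_ofReal] at this
  exact this.unique hw

theorem eval_conj_eq_zero_iff {e : ℕ} {f : Coord n} (hf : f.IsHomogeneous e) (p : CP n) :
    eval p.conj.rep (conjPoly n f) = 0 ↔ eval p.rep f = 0 := by
  rw [p.hasCoords_conj.eval_eq_zero_iff (isHomogeneous_conjPoly hf), eval_conjPoly,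
    map_eq_zero]

theorem continuous_conj : Continuous (CP.conj : CP n → CP n) := by
  refine continuous_generateFrom_iff.2 ?_
  rintro _ ⟨e, f, hf, rfl⟩
  refine TopologicalSpace.isOpen_generateFrom_of_mem
    ⟨e, conjPoly n f, isHomogeneous_conjPoly hf, ?_⟩
  ext p
  rw [Set.mem_preimage, Set.mem_ofPred_eq, Set.mem_ofPred_eq, not_iff_not]
  rw [← eval_conj_eq_zero_iff (isHomogeneous_conjPoly hf), conjPoly_conjPoly]

/-- The points of a component Z whose conjugates lie in Z form a closed subset containing all real
points of Z. It is infinite, hence all of Z. -/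
theorem HasRealComponents.conj_mem {X : Set (CP n)} (hX : HasRealComponents X)
    (hg : HasLinearGrowth X) {p : CP n} (hp : p ∈ X) : p.conj ∈ X := by
  obtain ⟨𝒵, -, h𝒵, rfl⟩ := hX
  obtain ⟨Z, hZ, hpZ⟩ := hp
  obtain ⟨hcl, hirr, hinf⟩ := h𝒵 Z hZ
  refine ⟨Z, hZ, ?_⟩
  by_contra hcon
  have hss : Z ∩ CP.conj ⁻¹' Z ⊂ Z :=
    ⟨Set.inter_subset_left, fun h => hcon (h hpZ).2⟩
  refine hinf (((hg.mono (Set.subset_sUnion_of_mem hZ)).finite_of_ssubset hirr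
    (hcl.inter (hcl.preimage continuous_conj)) hss).subset fun q hq => ⟨hq.1, ?_⟩)
  rw [Set.mem_preimage, CP.conj_eq_of_mem_realPoints hq.2]
  exact hq.1

theorem conjPoly_mem_idealOf {X : Set (CP n)} (hX : ∀ p ∈ X, p.conj ∈ X) {f : Coord n}
    (hf : f ∈ idealOf X) : conjPoly n f ∈ idealOf X := by
  rw [mem_idealOf] at hf ⊢
  intro p hp v hv
  have h1 := hf _ (hX p hp) _ hv.conj
  have h2 := eval_conjPoly (fun i => starRingEnd ℂ (v i)) f
  simp only [Complex.conj_conj] at h2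
  rw [h2, h1, map_zero]

theorem map_conjPoly_idealOf {X : Set (CP n)} (hX : ∀ p ∈ X, p.conj ∈ X) :
    (idealOf X).map (conjPoly n : Coord n →+* Coord n) = idealOf X := by
  refine le_antisymm (Ideal.map_le_iff_le_comap.2 fun f hf => conjPoly_mem_idealOf hX hf)
    fun f hf => ?_
  rw [← conjPoly_conjPoly f]
  exact Ideal.mem_map_of_mem (conjPoly n : Coord n →+* Coord n) (conjPoly_mem_idealOf hX hf)

theorem conjPoly_mem_pointIdeal {p : CP n} {f : Coord n} :
    conjPoly n f ∈ pointIdeal p.conj ↔ f ∈ pointIdeal p := by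
  have key : ∀ {p : CP n} {f : Coord n}, f ∈ pointIdeal p → conjPoly n f ∈ pointIdeal p.conj := by
    intro p f hf
    rw [mem_pointIdeal] at hf ⊢
    intro c
    obtain ⟨b, hb, hbv⟩ := p.hasCoords_conj.eq_smul p.conj.hasCoords_rep
    have h1 := eval_conjPoly (starRingEnd ℂ (c * b) • p.rep) f
    rw [hf, map_zero] at h1
    rw [← h1, hbv]
    congr 1
    congr 1
    funext i
    simp [mul_assoc]
  refine ⟨fun h => ?_, key⟩
  have := key h
  rwa [conjPoly_conjPoly, CP.conj_conj] at this

/-- Conjugating coefficients is a ring automorphism taking the prime of p to that of its conjugate.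
It is not ℂ-linear, but length is an invariant of rings. -/
theorem locLength_map_conjPoly (J : Ideal (Coord n)) (p : CP n) :
    locLength (J.map (conjPoly n : Coord n →+* Coord n)) p.conj = locLength J p := by
  have H : (pointIdeal p).primeCompl.map (conjPoly n).toMonoidHom =
      (pointIdeal p.conj).primeCompl := by
    ext f
    constructor
    · rintro ⟨g, hg, rfl⟩
      exact fun h => hg (conjPoly_mem_pointIdeal.1 h)
    · intro hf
      refine ⟨conjPoly n f, fun h => hf ?_, conjPoly_conjPoly f⟩
      rw [← conjPoly_conjPoly f]
      exact conjPoly_mem_pointIdeal.2 h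
  let ε := IsLocalization.ringEquivOfRingEquiv (Localization.AtPrime (pointIdeal p))
    (Localization.AtPrime (pointIdeal p.conj)) (conjPoly n) H
  have h1 := length_quotient_map_ringEquiv ε
    (J.map (algebraMap (Coord n) (Localization.AtPrime (pointIdeal p))))
  rw [locLength, locLength, ← h1, Ideal.map_map, Ideal.map_map]
  have h2 : (ε : Localization.AtPrime (pointIdeal p) →+* _).comp
      (algebraMap (Coord n) (Localization.AtPrime (pointIdeal p))) =
      (algebraMap (Coord n) (Localization.AtPrime (pointIdeal p.conj))).comp
        (conjPoly n : Coord n →+* Coord n) :=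
    RingHom.ext fun x => IsLocalization.ringEquivOfRingEquiv_eq H x
  rw [h2]

theorem intersectionMult_conj {X : Set (CP n)} (hX : ∀ p ∈ X, p.conj ∈ X) (f : Coord n)
    (p : CP n) : intersectionMult X (conjPoly n f) p.conj = intersectionMult X f p := by
  rw [intersectionMult_eq, intersectionMult_eq, ← locLength_map_conjPoly _ p, Ideal.map_sup,
    map_conjPoly_idealOf hX, Ideal.map_span, Set.image_singleton]
  rfl

end Conj

variable {d : ℕ}

theorem conjPoly_sphereForm (c : Fin d → ℂ) (ρ : ℂ) :
    conjPoly d (sphereForm c ρ) =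
      sphereForm (fun i => starRingEnd ℂ (c i)) (starRingEnd ℂ ρ) := by
  simp only [sphereForm, map_sub, map_sum, map_pow, map_mul, conjPoly_X, conjPoly_C]

theorem multAtInfinity_conj {X : Set (CP d)} (hX : ∀ p ∈ X, p.conj ∈ X) (p : CP d) :
    multAtInfinity X p.conj = multAtInfinity X p := by
  have key : ∀ p : CP d, multAtInfinity X p.conj ≤ multAtInfinity X p := by
    refine fun p => le_iInf fun s => ?_
    have h1 := intersectionMult_conj hX (sphereForm s.1.1 s.1.2) p
    rw [conjPoly_sphereForm] at h1
    rw [← h1]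
    exact iInf_le (fun s : {s : (Fin d → ℂ) × ℂ // s.2 ≠ 0} =>
      intersectionMult X (sphereForm s.1.1 s.1.2) p.conj)
      ⟨(fun i => starRingEnd ℂ (s.1.1 i), starRingEnd ℂ s.1.2),
        (map_ne_zero (starRingEnd ℂ)).2 s.2⟩
  refine le_antisymm (key p) ?_
  have h1 := key p.conj
  rwa [CP.conj_conj] at h1

theorem conj_mem_sphereAtInfinity {p : CP d} (hp : p ∈ sphereAtInfinity d) :
    p.conj ∈ sphereAtInfinity d := by
  rw [mem_sphereAtInfinity] at hp ⊢
  obtain ⟨c, -, hc⟩ := p.hasCoords_conj.eq_smul p.conj.hasCoords_rep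
  rw [hc]
  constructor
  · simp [hp.1]
  · have := congrArg (starRingEnd ℂ) hp.2
    simp only [map_sum, map_pow, map_zero] at this
    simp only [Pi.smul_apply, smul_eq_mul, mul_pow, ← Finset.mul_sum, this, mul_zero]

/-- If the conjugate coordinates were c times the original ones, ∑ |xⱼ|² would equal c ∑ xⱼ² = 0. -/
theorem conj_ne_of_mem_sphereAtInfinity {p : CP d} (hp : p ∈ sphereAtInfinity d) :
    p.conj ≠ p := by
  intro h
  rw [mem_sphereAtInfinity] at hp
  obtain ⟨c, -, hc⟩ := p.hasCoords_rep.eq_smul (h ▸ p.hasCoords_conj)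
  have h1 : ((∑ j : Fin d, Complex.normSq (p.rep j.succ) : ℝ) : ℂ) = 0 := by
    push_cast
    have : ∀ j : Fin d, (Complex.normSq (p.rep j.succ) : ℂ) = c * p.rep j.succ ^ 2 := fun j => by
      have h2 := congrFun hc j.succ
      simp only [Pi.smul_apply, smul_eq_mul] at h2
      rw [Complex.normSq_eq_conj_mul_self, h2]; ring
    simp only [this, ← Finset.mul_sum, hp.2, mul_zero]
  have h2 : ∑ j : Fin d, Complex.normSq (p.rep j.succ) = 0 := by exact_mod_cast h1
  refine p.rep_ne_zero (funext fun i => Fin.cases hp.1 (fun j => ?_) i)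
  exact Complex.normSq_eq_zero.1
    ((Finset.sum_eq_zero_iff_of_nonneg (fun j _ => Complex.normSq_nonneg _)).1 h2 j
      (Finset.mem_univ j))

section Pairs

open scoped Classical in
theorem sum_count_add_count_conj {s : Multiset (CP d)} {E : Finset (CP d)}
    (hE : ∀ p ∈ E, p.conj ∈ E) (hs : ∀ p ∈ s, p ∈ E) :
    ∑ p ∈ E, (s.count p + s.count p.conj) = 2 * s.card := by
  have h1 := Multiset.sum_count_eq_card hs
  have h2 : ∑ p ∈ E, s.count p.conj = ∑ p ∈ E, s.count p :=
    Finset.sum_nbij' CP.conj CP.conj hE hE (fun p _ => CP.conj_conj p)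
      (fun p _ => CP.conj_conj p) (fun _ _ => rfl)
  rw [Finset.sum_add_distrib, h2, h1, two_mul]

open scoped Classical in
/-- A conjugation invariant function on the sphere at infinity with finite total mass is the sum
of a multiset and its conjugate. -/
theorem exists_multiset_of_conj_invariant {μ : CP d → ℕ} {E : Finset (CP d)}
    (hE : ∀ p ∈ E, p ∈ sphereAtInfinity d) (hconj : ∀ p ∈ E, p.conj ∈ E)
    (hμ : ∀ p ∈ E, μ p.conj = μ p) :
    ∃ s : Multiset (CP d), (∀ p ∈ s, p ∈ E) ∧ ∀ p ∈ E, μ p = s.count p + s.count p.conj := by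
  -- Conjugation has no fixed points here, so a well ordering selects exactly one point of each
  -- conjugate pair.
  let R : CP d → CP d → Prop := WellOrderingRel
  let s : Multiset (CP d) := ∑ p ∈ E with R p p.conj, μ p • {p}
  have hcount : ∀ q, s.count q = if q ∈ E ∧ R q q.conj then μ q else 0 := by
    intro q
    rw [Multiset.count_sum']
    simp only [Multiset.count_nsmul, Multiset.count_singleton]
    by_cases h : q ∈ E ∧ R q q.conj
    · rw [if_pos h, Finset.sum_eq_single q]
      · simp
      · intro b _ hb
        simp [Ne.symm hb]
      · intro h'
        exact absurd (Finset.mem_filter.2 h) h'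
    · rw [if_neg h]
      refine Finset.sum_eq_zero fun b hb => ?_
      rw [if_neg, mul_zero]
      rintro rfl
      exact h (Finset.mem_filter.1 hb)
  refine ⟨s, fun p hp => ?_, fun p hp => ?_⟩
  · by_contra hcon
    have := hcount p
    rw [if_neg fun h => hcon h.1] at this
    exact (Multiset.count_ne_zero.2 hp) this
  · rw [hcount, hcount, CP.conj_conj, hμ p hp]
    have hne := conj_ne_of_mem_sphereAtInfinity (hE p hp)
    rcases trichotomous_of R p p.conj with h | h | h
    · rw [if_pos ⟨hp, h⟩, if_neg fun h' => asymm_of R h h'.2, add_zero]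
    · exact absurd h.symm hne
    · rw [if_neg fun h' => asymm_of R h h'.2, if_pos ⟨hconj p hp, h⟩, zero_add]

end Pairs

/-- `X` is `ℓ`-spherical if and only if its total multiplicity on the sphere at infinity is
`2 ℓ`. -/
theorem isSpherical_iff {X : Set (CP d)} (hX : IsRealCurve X) (hg : HasLinearGrowth X)
    {E : Finset (CP d)} (hE : ∀ p ∈ E, p ∈ sphereAtInfinity d)
    (hE0 : ∀ p ∈ sphereAtInfinity d, p ∉ E → multAtInfinity X p = 0) {ℓ : ℕ} :
    IsSpherical ℓ X ↔ ∑ p ∈ E, multAtInfinity X p = (2 * ℓ : ℕ) := by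
  classical
  have hXc : ∀ p ∈ X, p.conj ∈ X := fun p hp => hX.hasRealComponents.conj_mem hg hp
  -- Closing E under conjugation only adds points of multiplicity zero and lets the sum be organized
  -- in pairs.
  let E' := E ∪ E.image CP.conj
  have hE'inf : ∀ p ∈ E', p ∈ sphereAtInfinity d := by
    intro p hp
    rcases Finset.mem_union.1 hp with h | h
    · exact hE p h
    · obtain ⟨q, hq, rfl⟩ := Finset.mem_image.1 h
      exact conj_mem_sphereAtInfinity (hE q hq)
  have hE'c : ∀ p ∈ E', p.conj ∈ E' := by
    intro p hp
    rcases Finset.mem_union.1 hp with h | h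
    · exact Finset.mem_union_right _ (Finset.mem_image_of_mem _ h)
    · obtain ⟨q, hq, rfl⟩ := Finset.mem_image.1 h
      rw [CP.conj_conj]
      exact Finset.mem_union_left _ hq
  have hsum : ∑ p ∈ E, multAtInfinity X p = ∑ p ∈ E', multAtInfinity X p :=
    Finset.sum_subset Finset.subset_union_left fun p hp hpE => hE0 p (hE'inf p hp) hpE
  rw [hsum]
  constructor
  · rintro ⟨-, s, rfl, hsinf, hs⟩
    have hsE : ∀ p ∈ s, p ∈ E' := by
      intro p hp
      refine Finset.mem_union_left _ ?_
      by_contra hcon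
      have h1 := hs p (hsinf p hp)
      rw [hE0 p (hsinf p hp) hcon] at h1
      have h2 : s.count p = 0 := by
        have : ((s.count p + s.count p.conj : ℕ) : ℕ∞) = 0 := by push_cast; convert h1.symm
        have := Nat.cast_eq_zero.1 this
        omega
      exact Multiset.count_ne_zero.2 hp h2
    rw [← sum_count_add_count_conj hE'c hsE, Nat.cast_sum]
    refine Finset.sum_congr rfl fun p hp => ?_
    rw [hs p (hE'inf p hp)]
    push_cast
    convert rfl
  · intro h
    have hfin : ∀ p ∈ E', multAtInfinity X p ≠ ⊤ := fun p hp htop => by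
      have h1 := Finset.single_le_sum (f := multAtInfinity X) (fun _ _ => bot_le) hp
      rw [h, htop, top_le_iff] at h1
      exact ENat.natCast_ne_top _ h1
    obtain ⟨s, hs1, hs2⟩ := exists_multiset_of_conj_invariant
      (μ := fun p => (multAtInfinity X p).toNat) hE'inf hE'c
      (fun p _ => by rw [multAtInfinity_conj hXc])
    have hs3 : ∀ p ∈ E', multAtInfinity X p = ((s.count p + s.count p.conj : ℕ) : ℕ∞) :=
      fun p hp => by rw [← hs2 p hp, ENat.natCast_toNat (hfin p hp)]
    refine ⟨hX, s, ?_, fun p hp => hE'inf p (hs1 p hp), fun p hp => ?_⟩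
    · have h1 := sum_count_add_count_conj hE'c hs1
      rw [Finset.sum_congr rfl hs3, ← Nat.cast_sum, h1] at h
      have := Nat.cast_injective h
      omega
    · by_cases hpE : p ∈ E'
      · rw [hs3 p hpE]
        push_cast
        convert rfl
      · have h0 : ∀ q, q ∉ E' → s.count q = 0 := fun q hq =>
          Multiset.count_eq_zero.2 fun h => hq (hs1 q h)
        have hpc : p.conj ∉ E' := fun h => hpE (by simpa [CP.conj_conj] using hE'c _ h)
        have h1 := h0 p hpE
        have h2 := h0 _ hpc
        rw [hE0 p hp fun h => hpE (Finset.mem_union_left _ h)]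
        have h3 : (0 : ℕ∞) = ((s.count p : ℕ) : ℕ∞) + ((s.count p.conj : ℕ) : ℕ∞) := by
          rw [h1, h2]; simp
        convert h3

end SphericalCurve

namespace SphericalCurve

open MvPolynomial Filter

/-! ### Smooth points -/

variable {n : ℕ}

/-- The first order Taylor expansion of a polynomial. -/
theorem aeval_add_sub_mem_sq {σ A : Type*} [Fintype σ] [CommRing A] [Algebra ℂ A] (Q : Ideal A)
    (u y : σ → A) (hy : ∀ i, y i ∈ Q) (f : MvPolynomial σ ℂ) :
    aeval (u + y) f - aeval u f - ∑ i, aeval u (pderiv i f) * y i ∈ Q ^ 2 := by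
  classical
  induction f using MvPolynomial.induction_on with
  | C a => simp
  | add f g hf hg =>
    have := Ideal.add_mem _ hf hg
    simp only [map_add, add_mul, Finset.sum_add_distrib]
    convert this using 1
    ring
  | mul_X f j hf =>
    have hD : ∑ i, aeval u (pderiv i f) * y i ∈ Q :=
      Ideal.sum_mem _ fun i _ => Ideal.mul_mem_left _ _ (hy i)
    have h1 : ∑ i, aeval u (pderiv i (f * X j)) * y i =
        (∑ i, aeval u (pderiv i f) * y i) * u j + aeval u f * y j := by
      have : ∀ i, aeval u (pderiv i (f * X j)) * y i =
          aeval u (pderiv i f) * y i * u j + if i = j then aeval u f * y j else 0 := by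
        intro i
        rw [pderiv_mul, pderiv_X, map_add, map_mul, map_mul, aeval_X]
        by_cases h : i = j
        · subst h; simp; ring
        · rw [if_neg h, Pi.single_eq_of_ne' h]; simp; ring
      rw [Finset.sum_congr rfl fun i _ => this i, Finset.sum_add_distrib, Finset.sum_mul]
      simp
    rw [h1, map_mul, map_mul, aeval_X, aeval_X, Pi.add_apply]
    have h2 := Ideal.mul_mem_left (Q ^ 2) (u j + y j) hf
    have h3 : (∑ i, aeval u (pderiv i f) * y i) * y j ∈ Q ^ 2 := by
      rw [sq]; exact Ideal.mul_mem_mul hD (hy j)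
    convert Ideal.add_mem _ h2 h3 using 1
    ring

theorem aeval_C_mul_of_mem_pointIdeal {p : CP n} {f : Coord n} (hf : f ∈ pointIdeal p)
    (L : Coord n) : aeval (fun i => C (p.rep i) * L) f = 0 := by
  have h1 : (Polynomial.aeval L).toRingHom.comp
      (aeval (fun i => Polynomial.C (p.rep i) * Polynomial.X)).toRingHom =
      (aeval (fun i => C (p.rep i) * L) : Coord n →ₐ[ℂ] Coord n).toRingHom := by
    ext i <;> simp [MvPolynomial.algebraMap_eq]
  have h2 := congrArg (fun g : Coord n →+* Coord n => g f) h1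
  have h3 : aeval (fun i => Polynomial.C (p.rep i) * Polynomial.X) f = (0 : Polynomial ℂ) := hf
  simp only [RingHom.comp_apply, AlgHom.toRingHom_eq_coe, RingHom.coe_coe] at h2
  rw [← h2, h3, map_zero]

theorem eval_linearForm (a v : Fin (n + 1) → ℂ) : eval v (linearForm a) = ∑ i, a i * v i := by
  simp [linearForm]

theorem isHomogeneous_linearForm (a : Fin (n + 1) → ℂ) : (linearForm a).IsHomogeneous 1 :=
  IsHomogeneous.sum _ _ _ fun _ _ => isHomogeneous_C_mul_X _ _

/-- The differential of a polynomial at a point. -/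
def diffAt (p : CP n) : Coord n →ₗ[ℂ] (Fin (n + 1) → ℂ) where
  toFun f i := eval p.rep (pderiv i f)
  map_add' f g := by funext i; simp
  map_smul' c f := by funext i; simp

theorem mem_tangentCone {V : Set (CP n)} {p : CP n} {v : Fin (n + 1) → ℂ} :
    v ∈ tangentCone V p ↔ ∀ f ∈ idealOf V, ∑ i, diffAt p f i * v i = 0 := by
  simp [tangentCone, diffAt, Submodule.mem_iInf]

theorem sum_diffAt_mul_rep {e : ℕ} {f : Coord n} (hf : f.IsHomogeneous e) (p : CP n) :
    ∑ i, diffAt p f i * p.rep i = e * eval p.rep f := by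
  have := congrArg (eval p.rep) hf.sum_X_mul_pderiv
  simp only [map_sum, map_mul, eval_X, nsmul_eq_mul, map_natCast] at this
  rw [← this]
  exact Finset.sum_congr rfl fun i _ => mul_comm _ _

theorem rep_mem_tangentCone {V : Set (CP n)} {p : CP n} (hp : p ∈ V) :
    p.rep ∈ tangentCone V p := by
  rw [mem_tangentCone]
  intro f hf
  rw [← sum_homogeneousComponent f, map_sum]
  simp only [Finset.sum_apply, Finset.sum_mul]
  rw [Finset.sum_comm]
  refine Finset.sum_eq_zero fun e _ => ?_
  rw [sum_diffAt_mul_rep (homogeneousComponent_isHomogeneous e f),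
    mem_idealOf.1 (isHomog_idealOf V f hf e) p hp _ p.hasCoords_rep, mul_zero]

/-- Modulo the square of the ideal of a point, a form is its differential times a power of a
linear form. -/
theorem sub_linearForm_diffAt_mem_sq {e : ℕ} {f : Coord n} (hf : f.IsHomogeneous (e + 1))
    {p : CP n} (hfp : eval p.rep f = 0) {L : Coord n} (hL : L.IsHomogeneous 1)
    (hLp : eval p.rep L = 1) : f - L ^ e * linearForm (diffAt p f) ∈ pointIdeal p ^ 2 := by
  have h1 := aeval_add_sub_mem_sq (pointIdeal p) (fun i => C (p.rep i) * L)
    (fun i => X i - C (p.rep i) * L) (fun i => by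
      rw [mem_pointIdeal_of_isHomogeneous ((isHomogeneous_X _ _).sub (hL.C_mul _))]
      simp [hLp]) f
  have h2 : ((fun i => C (p.rep i) * L) + fun i => X i - C (p.rep i) * L) =
      (X : Fin (n + 1) → Coord n) := by
    funext i; simp
  have h3 : ∀ {t : ℕ} {g : Coord n}, g.IsHomogeneous t →
      aeval (fun i => C (p.rep i) * L) g = L ^ t * C (eval p.rep g) := by
    intro t g hg
    have h4 := aeval_mul_of_isHomogeneous (A := Coord n) hg L (fun i => C (p.rep i))
    simp only [mul_comm L] at h4
    rw [h4]
    congr 1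
    have h5 : (aeval (fun i => C (p.rep i)) : Coord n →ₐ[ℂ] Coord n).toRingHom =
        (C : ℂ →+* Coord n).comp (eval p.rep) := by
      ext i <;> simp [MvPolynomial.algebraMap_eq]
    exact congrArg (fun φ : Coord n →+* Coord n => φ g) h5
  rw [h2, aeval_X_left_apply, h3 hf, hfp, C_0, mul_zero, sub_zero] at h1
  convert h1 using 2
  have h6 : ∀ i, aeval (fun i => C (p.rep i) * L) (pderiv i f) = L ^ e * C (diffAt p f i) :=
    fun i => h3 hf.pderiv
  simp only [h6]
  have h7 : ∑ i, C (diffAt p f i) * C (p.rep i) = (0 : Coord n) := by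
    simp only [← C_mul]
    rw [← map_sum, sum_diffAt_mul_rep hf, hfp, mul_zero, C_0]
  calc L ^ e * linearForm (diffAt p f)
      = L ^ e * linearForm (diffAt p f) - L ^ (e + 1) * ∑ i, C (diffAt p f i) * C (p.rep i) := by
        rw [h7, mul_zero, sub_zero]
    _ = _ := by
        rw [linearForm, Finset.mul_sum, Finset.mul_sum, ← Finset.sum_sub_distrib]
        exact Finset.sum_congr rfl fun i _ => by ring

/-- The curve has multiplicity one at a smooth point. -/
theorem IsSmoothPoint.pointMult_eq_one {V : Set (CP n)} {p : CP n} (h : IsSmoothPoint V p) :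
    pointMult V p = 1 := by
  obtain ⟨hp, hT⟩ := h
  have hI : ∀ a : Fin (n + 1) → ℂ, eval p.rep (linearForm a) = 0 →
      idealOf V ⊔ Ideal.span {linearForm a} ≤ pointIdeal p := fun a ha =>
    sup_le (idealOf_le_pointIdeal hp) ((Ideal.span_singleton_le_iff_mem _).2
      ((mem_pointIdeal_of_isHomogeneous (isHomogeneous_linearForm a)).2 ha))
  refine le_antisymm ?_ (le_iInf fun ⟨a, ha0, ha⟩ => ?_)
  swap
  · rw [Order.one_le_iff_ne_zero, intersectionMult_eq, ne_eq, locLength_eq_zero_iff, not_not]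
    exact hI a ha
  -- a hyperplane transversal to the tangent line
  have hpT := rep_mem_tangentCone hp
  obtain ⟨u, huT, hu⟩ : ∃ u ∈ tangentCone V p, u ∉ Submodule.span ℂ {p.rep} := by
    by_contra hcon
    push Not at hcon
    have := Submodule.finrank_mono (show tangentCone V p ≤ Submodule.span ℂ {p.rep} from hcon)
    rw [hT, finrank_span_singleton p.rep_ne_zero] at this
    omega
  obtain ⟨α, hαu, hα⟩ := Submodule.exists_le_ker_of_notMem hu
  have hdot : ∀ (φ : (Fin (n + 1) → ℂ) →ₗ[ℂ] ℂ) (w : Fin (n + 1) → ℂ),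
      φ w = ∑ i, φ (Pi.single i 1) * w i := by
    intro φ w
    conv_lhs => rw [← Finset.univ_sum_single w, map_sum]
    refine Finset.sum_congr rfl fun i _ => ?_
    have : (Pi.single i (w i) : Fin (n + 1) → ℂ) = w i • Pi.single i 1 := by
      rw [← Pi.single_smul, smul_eq_mul, mul_one]
    rw [this, map_smul, smul_eq_mul, mul_comm]
  set a : Fin (n + 1) → ℂ := fun i => α (Pi.single i 1) with hadef
  have hap : eval p.rep (linearForm a) = 0 := by
    rw [eval_linearForm, ← hdot]
    exact hα (Submodule.mem_span_singleton_self _)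
  have ha0 : a ≠ 0 := by
    intro h0
    refine hαu ?_
    rw [hdot]
    exact Finset.sum_eq_zero fun i _ => by
      rw [show α (Pi.single i 1) = 0 from congrFun h0 i, zero_mul]
  -- The tangent space of the cone is a plane that contains the line of p and is not contained in
  -- the kernel of α, so it meets this kernel only in that line.
  have hline : ∀ w ∈ tangentCone V p, ∑ i, a i * w i = 0 → ∃ c : ℂ, c • p.rep = w := by
    intro w hw haw
    by_contra hcon
    push Not at hcon
    have hli : LinearIndependent ℂ ![p.rep, w] :=
      (LinearIndependent.pair_iff' p.rep_ne_zero).2 hcon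
    have hle : Submodule.span ℂ (Set.range ![p.rep, w]) ≤ tangentCone V p := by
      rw [Submodule.span_le]
      rintro _ ⟨i, rfl⟩
      fin_cases i
      · exact hpT
      · exact hw
    have heq := Submodule.eq_of_le_of_finrank_eq hle (by
      rw [finrank_span_eq_card hli, hT]; rfl)
    have hker : Submodule.span ℂ (Set.range ![p.rep, w]) ≤ LinearMap.ker α := by
      rw [Submodule.span_le]
      rintro _ ⟨i, rfl⟩
      fin_cases i
      · exact hα (Submodule.mem_span_singleton_self _)
      · exact (hdot α w).trans haw
    rw [heq] at hker
    exact hαu (hker huT)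
  refine (iInf_le _ ⟨a, ha0, hap⟩).trans ?_
  rw [intersectionMult_eq, ← locLength_pointIdeal p]
  obtain ⟨l, hLp⟩ : ∃ l : Fin (n + 1) → ℂ, eval p.rep (linearForm l) = 1 := by
    obtain ⟨i, hi⟩ := Function.ne_iff.1 p.rep_ne_zero
    refine ⟨Pi.single i (p.rep i)⁻¹, ?_⟩
    rw [eval_linearForm, Finset.sum_eq_single i]
    · rw [Pi.single_eq_same]
      exact inv_mul_cancel₀ hi
    · intro j _ hj
      rw [Pi.single_eq_of_ne hj, zero_mul]
    · simp
  have hL := isHomogeneous_linearForm l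
  let R := Localization.AtPrime (pointIdeal p)
  let al := algebraMap (Coord n) R
  have hunit : IsUnit (al (linearForm l)) := by
    refine IsLocalization.map_units R (⟨(linearForm l), fun hLm => ?_⟩ : (pointIdeal p).primeCompl)
    rw [SetLike.mem_coe, mem_pointIdeal_of_isHomogeneous hL, hLp] at hLm
    exact one_ne_zero hLm
  set J := idealOf V ⊔ Ideal.span {linearForm a} with hJ
  let K : Ideal R := J.map al ⊔ (pointIdeal p).map al • (pointIdeal p).map al
  have hsq : (pointIdeal p ^ 2).map al ≤ K := by
    rw [Ideal.map_pow, sq]; exact le_sup_right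
  -- the linear forms that are generated locally
  let lin : (Fin (n + 1) → ℂ) →ₗ[ℂ] Coord n := ∑ i, (LinearMap.proj i).smulRight (X i)
  have hlin : ∀ b, lin b = linearForm b := by
    intro b
    simp [lin, linearForm, MvPolynomial.smul_eq_C_mul]
  let G : Submodule ℂ (Fin (n + 1) → ℂ) := ((K.comap al).restrictScalars ℂ).comap lin
  have hG : ∀ b, b ∈ G ↔ al (linearForm b) ∈ K := fun b => by
    rw [← hlin]; rfl
  have hGa : a ∈ G := (hG a).2 (Ideal.mem_sup_left (Ideal.mem_map_of_mem _
    (Ideal.mem_sup_right (Ideal.mem_span_singleton_self _))))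
  have hGhom : ∀ e, ∀ f ∈ idealOf V, f.IsHomogeneous e → diffAt p f ∈ G := by
    rintro (_ | e) f hf hfe
    · have : diffAt p f = 0 := by
        funext i
        rw [← totalDegree_zero_iff_isHomogeneous, totalDegree_eq_zero_iff_eq_C] at hfe
        change eval p.rep (pderiv i f) = 0
        rw [hfe, pderiv_C, map_zero]
      rw [this]; exact G.zero_mem
    · have h1 := sub_linearForm_diffAt_mem_sq hfe
        (mem_idealOf.1 hf p hp _ p.hasCoords_rep) hL hLp
      have h2 : al (f - (linearForm l) ^ e * linearForm (diffAt p f)) ∈ K := hsq (Ideal.mem_map_of_mem _ h1)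
      have h3 : al f ∈ K := Ideal.mem_sup_left (Ideal.mem_map_of_mem _ (Ideal.mem_sup_left hf))
      have h4 : al (linearForm l) ^ e * al (linearForm (diffAt p f)) ∈ K := by
        rw [map_sub, map_mul, map_pow] at h2
        convert Ideal.sub_mem _ h3 h2 using 1
        ring
      rw [hG]
      exact (Ideal.unit_mul_mem_iff_mem _ (hunit.pow e)).1 h4
  have hGI : ∀ f ∈ idealOf V, diffAt p f ∈ G := by
    intro f hf
    rw [← sum_homogeneousComponent f, map_sum]
    exact Submodule.sum_mem _ fun e _ => hGhom e _ (isHomog_idealOf V f hf e)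
      (homogeneousComponent_isHomogeneous e f)
  -- Duality: a functional that kills G is given by a vector of the tangent space annihilated by a,
  -- hence by a multiple of p, and so kills every linear form vanishing at p.
  have hGb : ∀ b : Fin (n + 1) → ℂ, eval p.rep (linearForm b) = 0 → b ∈ G := by
    intro b hb
    by_contra hcon
    obtain ⟨φ, hφb, hφ⟩ := Submodule.exists_le_ker_of_notMem hcon
    have hφ' : ∀ g ∈ G, ∑ i, g i * φ (Pi.single i 1) = 0 := fun g hg => by
      have : φ g = 0 := hφ hg
      rw [hdot] at this
      rw [← this]
      exact Finset.sum_congr rfl fun i _ => mul_comm _ _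
    obtain ⟨c, hc⟩ := hline (fun i => φ (Pi.single i 1))
      (mem_tangentCone.2 fun f hf => hφ' _ (hGI f hf)) (hφ' a hGa)
    refine hφb ?_
    rw [hdot]
    have h1 : ∀ i, φ (Pi.single i 1) = c * p.rep i := fun i => (congrFun hc i).symm
    simp only [h1]
    rw [eval_linearForm] at hb
    have : ∑ i, c * p.rep i * b i = c * ∑ i, b i * p.rep i := by
      rw [Finset.mul_sum]
      exact Finset.sum_congr rfl fun i _ => by ring
    rw [this, hb, mul_zero]
  -- Expanding an element of the ideal of p around p itself writes it through the linear forms xᵢ -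
  -- pᵢ L, which all lie in K.
  have hPle : (pointIdeal p).map al ≤ K := by
    rw [Ideal.map_le_iff_le_comap]
    intro f hf
    have hy : ∀ i, (X i - C (p.rep i) * linearForm l : Coord n) =
        linearForm (Pi.single i 1 - p.rep i • l) := by
      intro i
      rw [← hlin, ← hlin, map_sub, map_smul, hlin (Pi.single i 1), MvPolynomial.smul_eq_C_mul]
      congr 1
      rw [linearForm, Finset.sum_eq_single i]
      · simp
      · intro j _ hj
        simp [hj]
      · simp
    have hyP : ∀ i, eval p.rep (X i - C (p.rep i) * linearForm l : Coord n) = 0 := by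
      intro i
      simp [hLp]
    have h1 := aeval_add_sub_mem_sq (K.comap al) (fun i => C (p.rep i) * linearForm l)
      (fun i => X i - C (p.rep i) * linearForm l) (fun i => by
        rw [Ideal.mem_comap, hy, ← hG]
        refine hGb _ ?_
        rw [← hy]
        exact hyP i) f
    have h2 : ((fun i => C (p.rep i) * linearForm l) +
        fun i => X i - C (p.rep i) * linearForm l) = (X : Fin (n + 1) → Coord n) := by
      funext i; simp
    rw [h2, aeval_X_left_apply, aeval_C_mul_of_mem_pointIdeal hf, sub_zero] at h1
    have h3 := Ideal.pow_le_self two_ne_zero h1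
    have h4 : ∑ i, aeval (fun i => C (p.rep i) * linearForm l) (pderiv i f) *
        (X i - C (p.rep i) * linearForm l) ∈ K.comap al := by
      refine Ideal.sum_mem _ fun i _ => Ideal.mul_mem_left _ _ ?_
      rw [Ideal.mem_comap, hy, ← hG]
      refine hGb _ ?_
      rw [← hy]
      exact hyP i
    have := Ideal.add_mem _ h3 h4
    rwa [sub_add_cancel] at this
  -- The maximal ideal lies in J plus its own square, so Nakayama identifies it with J, and the
  -- quotient has length one.
  have hNak : (pointIdeal p).map al ≤ J.map al :=
    Submodule.le_of_le_smul_of_le_jacobson_bot (I := (pointIdeal p).map al)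
      (IsNoetherian.noetherian _) (by
        rw [IsLocalRing.jacobson_eq_maximalIdeal ⊥ bot_ne_top]
        exact (Localization.AtPrime.map_eq_maximalIdeal (I := pointIdeal p)).le) hPle
  rw [locLength, locLength, le_antisymm hNak (Ideal.map_mono (hI a hap))]

end SphericalCurve

namespace SphericalCurve

open MvPolynomial Filter

variable {d : ℕ}

/-! ### Stereographic projection in coordinates -/

theorem fromSphere_eval_eq_cons (σ : ℂ) (r : Fin d → ℂ) (v : Fin (d + 2) → ℂ) :
    (fun j => eval v (fromSphere σ r (X j))) = Fin.cons (v 0 - σ * v (Fin.last (d + 1)))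
      fun j => v j.succ.castSucc + r j * (v 0 - σ * v (Fin.last (d + 1))) := by
  funext i
  refine Fin.cases ?_ (fun j => ?_) i
  · rw [fromSphere_zero, eval_poleForm, Fin.cons_zero]
  · rw [fromSphere_succ, Fin.cons_succ, map_add, map_mul, eval_poleForm, eval_C, eval_X]

theorem isStereo_iff {s : CP (d + 1)} {x : CP d} : IsStereo s x ↔
    s ∈ unitSphere (d + 1) ∧ x.HasCoords fun j => eval s.rep (fromSphere 1 0 (X j)) := by
  rw [fromSphere_eval_eq_cons]
  simp only [one_mul, Pi.zero_apply, zero_mul, add_zero]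
  exact Iff.rfl

theorem hasCoords_fromSphere {s : CP (d + 1)} {x : CP d} {σ : ℂ} (hσ : σ ^ 2 = 1) (r : Fin d → ℂ)
    (h0 : x.rep 0 ≠ 0) (h : s.HasCoords fun j => eval x.rep (toSphere σ r (X j))) :
    x.HasCoords fun j => eval s.rep (fromSphere σ r (X j)) :=
  (corr_lift hσ r Set.univ).hasCoords (Set.mem_univ x) (by rwa [eval_X]) h

theorem isStereo_iff_of_ne {s : CP (d + 1)} {x : CP d} (h0 : x.rep 0 ≠ 0) : IsStereo s x ↔
    s.HasCoords fun j => eval x.rep (toSphere 1 0 (X j)) := by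
  rw [isStereo_iff]
  refine ⟨fun ⟨hs, hx⟩ => ?_, fun h => ⟨?_, hasCoords_fromSphere (one_pow 2) 0 h0 h⟩⟩
  · refine (corr_proj (one_pow 2) 0 le_rfl).hasCoords hs (fun hp => h0 ?_) hx
    have h1 : eval x.rep (X 0 : Coord d) = 0 := by
      rw [hx.eval_eq_zero_iff (isHomogeneous_X _ _), eval_X, fromSphere_zero, hp]
    rwa [eval_X] at h1
  · exact imageOf_toSphere_subset (one_pow 2) 0 Set.univ
      ⟨x, Set.mem_univ x, by rwa [eval_X], h⟩

/-- A point of the sphere projecting to x₀ = 0 has y₀ = y_{d+1}, hence ∑ yⱼ² = 0, so its image is on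
Σ_∞. After Σ_∞ is removed only affine points have preimages. -/
theorem stereoPreimage_diff_sphereAtInfinity (V : Set (CP d)) :
    stereoPreimage (V \ sphereAtInfinity d) = imageOf (toSphere 1 0) (X 0) V := by
  ext s
  constructor
  · rintro ⟨x, ⟨hxV, hx⟩, hs⟩
    have h0 : x.rep 0 ≠ 0 := by
      intro h0
      obtain ⟨hs1, hs2⟩ := isStereo_iff.1 hs
      refine hx (mem_sphereAtInfinity.2 ⟨h0, ?_⟩)
      rw [fromSphere_eval_eq_cons] at hs2
      obtain ⟨c, hc, hcv⟩ := hs2.eq_smul x.hasCoords_rep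
      have h1 : s.rep 0 - 1 * s.rep (Fin.last (d + 1)) = 0 := by
        have := congrFun hcv 0
        rw [h0, Pi.smul_apply, Fin.cons_zero, smul_eq_mul] at this
        exact (mul_eq_zero.1 this.symm).resolve_left hc
      have h2 : ∀ j : Fin d, x.rep j.succ = c * s.rep j.succ.castSucc := fun j => by
        rw [congrFun hcv j.succ, Pi.smul_apply, Fin.cons_succ, h1, mul_zero, add_zero, smul_eq_mul]
      rw [mem_unitSphere] at hs1
      simp only [h2, mul_pow, ← Finset.mul_sum]
      have h3 : ∑ j : Fin d, s.rep j.succ.castSucc ^ 2 = 0 := by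
        linear_combination (s.rep 0 + s.rep (Fin.last (d + 1))) * h1 - hs1
      rw [h3, mul_zero]
    exact ⟨x, hxV, by rwa [eval_X], (isStereo_iff_of_ne h0).1 hs⟩
  · rintro ⟨x, hxV, h0, hs⟩
    rw [eval_X] at h0
    exact ⟨x, ⟨hxV, fun h => h0 (mem_sphereAtInfinity.1 h).1⟩, (isStereo_iff_of_ne h0).2 hs⟩

theorem sphereLift_eq (V : Set (CP d)) : sphereLift V = lift 1 0 V := by
  rw [sphereLift, stereoPreimage_diff_sphereAtInfinity]
  rfl

theorem hasCoords_reflection (s : CP (d + 1)) : (reflection s).HasCoords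
    (sphereVec (s.rep 0) (fun j => s.rep j.succ.castSucc) (-s.rep (Fin.last (d + 1)))) := by
  have h : (reflection s).HasCoords (Fin.snoc (α := fun _ => ℂ)
    (fun j : Fin (d + 1) => s.rep j.castSucc) (-s.rep (Fin.last (d + 1)))) := CP.hasCoords_mk _ _
  convert h using 1
  rw [sphereVec]
  congr 1
  funext i
  exact Fin.cases rfl (fun j => rfl) i

/-- Reflecting and projecting from the north pole has the coordinates of the projection from the
south pole, so ρ is absorbed into the sign σ. -/
theorem isStereo_reflection_iff {s : CP (d + 1)} {x : CP d} : IsStereo (reflection s) x ↔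
    s ∈ unitSphere (d + 1) ∧ x.HasCoords fun j => eval s.rep (fromSphere (-1) 0 (X j)) := by
  have h := hasCoords_reflection s
  rw [isStereo_iff]
  refine and_congr ?_ ?_
  · have h1 : ∀ p : CP (d + 1), p ∈ unitSphere (d + 1) ↔ eval p.rep (sphereEq d) = 0 := fun p => by
      rw [mem_unitSphere]
      simp [sphereEq, sub_eq_zero]
    rw [h1, h1, h.eval_eq_zero_iff isHomogeneous_sphereEq]
    simp only [sphereEq, map_sub, map_add, map_pow, map_sum, eval_X, sphereVec_zero,
      sphereVec_last, sphereVec_mid, neg_sq]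
  · have h2 : (fun j => eval (sphereVec (s.rep 0) (fun j => s.rep j.succ.castSucc)
        (-s.rep (Fin.last (d + 1)))) (fromSphere 1 0 (X j))) =
        fun j => eval s.rep (fromSphere (-1) 0 (X j)) := by
      rw [fromSphere_eval_eq_cons, fromSphere_eval_eq_cons]
      simp only [sphereVec_zero, sphereVec_last, sphereVec_mid, one_mul, neg_mul]
    obtain ⟨c, hc, hcv⟩ := h.eq_smul (reflection s).hasCoords_rep
    have h3 : (fun j => eval (reflection s).rep (fromSphere 1 0 (X j))) =
        c • fun j => eval s.rep (fromSphere (-1) 0 (X j)) := by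
      rw [← h2, hcv]
      funext j
      rw [eval_smul_of_isHomogeneous (isHomogeneous_fromSphere 1 0 j), pow_one, Pi.smul_apply,
        smul_eq_mul]
    rw [h3]
    refine ⟨fun h4 => ?_, fun h4 => h4.smul hc⟩
    have := h4.smul (inv_ne_zero hc)
    rwa [smul_smul, inv_mul_cancel₀ hc, one_smul] at this

theorem stereoImage_reflection (Y : Set (CP (d + 1))) (hY : Y ⊆ unitSphere (d + 1)) :
    stereoImage (reflection '' Y) =
      {x | ∃ s ∈ Y, x.HasCoords fun j => eval s.rep (fromSphere (-1) 0 (X j))} := by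
  ext x
  constructor
  · rintro ⟨_, ⟨s, hs, rfl⟩, hx⟩
    exact ⟨s, hs, (isStereo_reflection_iff.1 hx).2⟩
  · rintro ⟨s, hs, hx⟩
    exact ⟨_, ⟨s, hs, rfl⟩, isStereo_reflection_iff.2 ⟨hY hs, hx⟩⟩

theorem reflectedProjection_eq {Y : Set (CP (d + 1))} (hY : Y ⊆ unitSphere (d + 1))
    (hreg : IsRegularOn (poleForm d (-1)) Y) : reflectedProjection Y = proj (-1) 0 Y := by
  rw [reflectedProjection, stereoImage_reflection Y hY]
  exact closure_eq_of_imageOf_subset (isHomogeneous_fromSphere _ _) (isHomogeneous_poleForm _) hreg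
    (fun p _ h => fromSphere_vec_ne_zero 0 h) (fun q ⟨p, hp, _, hq⟩ => ⟨p, hp, hq⟩)
    (fun q hq => hq)

theorem hasCoords_translation (r : Fin d → ℂ) {p : CP d} {v : Fin (d + 1) → ℂ}
    (hv : p.HasCoords v) : (translation r p).HasCoords
      (Fin.cons (v 0) fun j => v j.succ + v 0 * r j) := by
  have h : (translation r p).HasCoords (Fin.cons (p.rep 0) fun j => p.rep j.succ + p.rep 0 * r j) :=
    CP.hasCoords_mk _ _
  obtain ⟨c, hc, rfl⟩ := p.hasCoords_rep.eq_smul hv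
  convert h.smul hc using 1
  funext i
  refine Fin.cases (by simp) (fun j => ?_) i
  simp only [Fin.cons_succ, Pi.smul_apply, smul_eq_mul]
  ring

theorem translation_translation (r : Fin d → ℂ) (p : CP d) :
    translation (-r) (translation r p) = p := by
  have h := hasCoords_translation (-r) (hasCoords_translation r p.hasCoords_rep)
  refine h.unique ?_
  convert p.hasCoords_rep using 1
  funext i
  refine Fin.cases (by simp) (fun j => ?_) i
  simp

theorem translation_rep_zero_ne {r : Fin d → ℂ} {p : CP d} (h0 : p.rep 0 ≠ 0) :
    (translation r p).rep 0 ≠ 0 := by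
  have h := hasCoords_translation r p.hasCoords_rep
  have h1 := h.eval_eq_zero_iff (isHomogeneous_X ℂ (0 : Fin (d + 1)))
  rw [eval_X, eval_X, Fin.cons_zero] at h1
  exact fun h2 => h0 (h1.1 h2)

theorem isStereo_translation_iff {r : Fin d → ℂ} {s : CP (d + 1)} {p : CP d} (h0 : p.rep 0 ≠ 0) :
    IsStereo s (translation (-r) p) ↔
      s.HasCoords fun j => eval p.rep (toSphere 1 r (X j)) := by
  have h := hasCoords_translation (-r) p.hasCoords_rep
  rw [isStereo_iff_of_ne (translation_rep_zero_ne h0)]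
  have h2 : (fun j => eval (Fin.cons (p.rep 0) fun j => p.rep j.succ + p.rep 0 * (-r) j :
      Fin (d + 1) → ℂ) (toSphere 1 0 (X j))) = fun j => eval p.rep (toSphere 1 r (X j)) := by
    have hcone : eval (Fin.cons (p.rep 0) fun j => p.rep j.succ + p.rep 0 * (-r) j :
        Fin (d + 1) → ℂ) (coneForm 0) = eval p.rep (coneForm r) := by
      rw [eval_coneForm, eval_coneForm]
      refine Finset.sum_congr rfl fun j _ => ?_
      simp only [Fin.cons_succ, Fin.cons_zero, Pi.neg_apply, Pi.zero_apply]
      ring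
    funext i
    revert i
    rw [forall_fin_sphere]
    refine ⟨?_, ?_, fun j => ?_⟩
    · rw [toSphere_zero, toSphere_zero]
      simp only [map_mul, map_add, map_pow, eval_X, eval_C, hcone, Fin.cons_zero]
    · rw [toSphere_last, toSphere_last]
      simp only [map_mul, map_sub, map_pow, eval_X, eval_C, hcone, Fin.cons_zero]
    · rw [toSphere_mid, toSphere_mid]
      simp only [map_mul, map_sub, eval_X, eval_C, Fin.cons_succ, Fin.cons_zero, Pi.neg_apply,
        Pi.zero_apply]
      ring
  obtain ⟨c, hc, hcv⟩ := h.eq_smul (translation (-r) p).hasCoords_rep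
  have h3 : (fun j => eval (translation (-r) p).rep (toSphere 1 0 (X j))) =
      (c ^ 2) • fun j => eval p.rep (toSphere 1 r (X j)) := by
    rw [← h2, hcv]
    funext j
    rw [eval_smul_of_isHomogeneous (isHomogeneous_toSphere 1 0 j), Pi.smul_apply, smul_eq_mul]
  have hc2 := pow_ne_zero 2 hc
  rw [h3]
  refine ⟨fun h4 => ?_, fun h4 => h4.smul hc2⟩
  have := h4.smul (inv_ne_zero hc2)
  rwa [smul_smul, inv_mul_cancel₀ hc2, one_smul] at this

theorem translation_hasCoords_fromSphere_iff {σ : ℂ} {r : Fin d → ℂ} {q : CP d}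
    {v : Fin (d + 2) → ℂ} : (∃ x : CP d, (x.HasCoords fun j => eval v (fromSphere σ 0 (X j))) ∧
      translation r x = q) ↔ q.HasCoords fun j => eval v (fromSphere σ r (X j)) := by
  constructor
  · rintro ⟨x, hx, rfl⟩
    rw [fromSphere_eval_eq_cons] at hx ⊢
    convert hasCoords_translation r hx using 1
    funext i
    refine Fin.cases (by simp) (fun j => ?_) i
    simp only [Fin.cons_succ, Fin.cons_zero, Pi.zero_apply]
    ring
  · intro hq
    refine ⟨translation (-r) q, ?_, ?_⟩
    · rw [fromSphere_eval_eq_cons] at hq ⊢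
      convert hasCoords_translation (-r) hq using 1
      funext i
      refine Fin.cases (by simp) (fun j => ?_) i
      simp only [Fin.cons_succ, Fin.cons_zero, Pi.zero_apply, Pi.neg_apply]
      ring
    · have := translation_translation (-r) q
      rwa [neg_neg] at this

theorem hasCoords_affinePoint (r : Fin d → ℂ) : (affinePoint r).HasCoords (Fin.cons 1 r) :=
  CP.hasCoords_mk _ _

theorem eval_affinePoint_coneForm (r : Fin d → ℂ) :
    eval (affinePoint r).rep (coneForm r) = 0 := by
  rw [(hasCoords_affinePoint r).eval_eq_zero_iff (isHomogeneous_coneForm r), eval_coneForm]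
  simp

/-- The set whose closure defines the inverse and the one defining the projection both contain the
image of the lift off the two tangent hyperplanes and lie in the image of the whole lift. Both
tangent forms are regular on the lift, so the closures agree. -/
theorem inverse_eq {r : Fin d → ℂ} {V : Set (CP d)} (hV : IsClosed V)
    (hreg : IsRegularOn (poleForm d 1) (lift 1 r V))
    (hreg' : IsRegularOn (poleForm d (-1)) (lift 1 r V)) :
    inverse r V = proj (-1) r (lift 1 r V) := by
  have hcorr := corr_lift (one_pow 2) r V
  have hW : IsClosed (lift 1 r V) := isClosed_closure
  have hpre : ∀ s, s ∈ stereoPreimage (translation (-r) '' ((V ∩ affinePart d) \ {affinePoint r})) ↔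
      ∃ p ∈ V, p.rep 0 ≠ 0 ∧ p ≠ affinePoint r ∧
        s.HasCoords fun j => eval p.rep (toSphere 1 r (X j)) := by
    intro s
    constructor
    · rintro ⟨_, ⟨p, ⟨⟨hpV, hp0⟩, hpr⟩, rfl⟩, hs⟩
      exact ⟨p, hpV, hp0, hpr, (isStereo_translation_iff hp0).1 hs⟩
    · rintro ⟨p, hpV, hp0, hpr, hs⟩
      exact ⟨_, ⟨p, ⟨⟨hpV, hp0⟩, hpr⟩, rfl⟩, (isStereo_translation_iff hp0).2 hs⟩
  have hsub : stereoPreimage (translation (-r) '' ((V ∩ affinePart d) \ {affinePoint r})) ⊆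
      lift 1 r V := fun s hs => by
    obtain ⟨p, hpV, hp0, -, hs⟩ := (hpre s).1 hs
    exact subset_closure ⟨p, hpV, by rwa [eval_X], hs⟩
  have hA : ∀ q, q ∈ translation r '' stereoImage (reflection '' stereoPreimage
      (translation (-r) '' ((V ∩ affinePart d) \ {affinePoint r}))) ↔
      ∃ s ∈ stereoPreimage (translation (-r) '' ((V ∩ affinePart d) \ {affinePoint r})),
        q.HasCoords fun j => eval s.rep (fromSphere (-1) r (X j)) := by
    intro q
    rw [stereoImage_reflection _ (hsub.trans (lift_subset (one_pow 2) r V))]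
    constructor
    · rintro ⟨x, ⟨s, hs, hx⟩, rfl⟩
      exact ⟨s, hs, translation_hasCoords_fromSphere_iff.1 ⟨x, hx, rfl⟩⟩
    · rintro ⟨s, hs, hq⟩
      obtain ⟨x, hx, rfl⟩ := translation_hasCoords_fromSphere_iff.2 hq
      exact ⟨x, ⟨s, hs, hx⟩, rfl⟩
  have hhom : (poleForm d (-1) * poleForm d 1).IsHomogeneous (1 + 1) :=
    (isHomogeneous_poleForm _).mul (isHomogeneous_poleForm _)
  have hvec : ∀ p ∈ lift 1 r V, eval p.rep (poleForm d (-1) * poleForm d 1) ≠ 0 →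
      (fun j => eval p.rep (fromSphere (-1) r (X j))) ≠ 0 := fun p _ h =>
    fromSphere_vec_ne_zero r (left_ne_zero_of_mul (by rwa [map_mul] at h))
  have key : ∀ A : Set (CP d),
      imageOf (fromSphere (-1) r) (poleForm d (-1) * poleForm d 1) (lift 1 r V) ⊆ A →
      (∀ q ∈ A, ∃ p ∈ lift 1 r V, q.HasCoords fun j => eval p.rep (fromSphere (-1) r (X j))) →
      closure A =
        closure (imageOf (fromSphere (-1) r) (poleForm d (-1) * poleForm d 1) (lift 1 r V)) :=
    fun A => closure_eq_of_imageOf_subset (isHomogeneous_fromSphere _ _) hhom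
      (hreg'.mul hreg) hvec
  have hproj : proj (-1) r (lift 1 r V) =
      closure (imageOf (fromSphere (-1) r) (poleForm d (-1) * poleForm d 1) (lift 1 r V)) :=
    key (imageOf (fromSphere (-1) r) (poleForm d (-1)) (lift 1 r V))
      (fun q ⟨s, hs, h0, hq⟩ => ⟨s, hs, left_ne_zero_of_mul (by rwa [map_mul] at h0), hq⟩)
      (fun q ⟨s, hs, _, hq⟩ => ⟨s, hs, hq⟩)
  rw [inverse, hproj]
  refine key _ ?_ fun q hq => ?_
  · rintro q ⟨s, hs, h0, hq⟩
    rw [map_mul] at h0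
    have h1 : s ∈ imageOf (toSphere 1 r) (X 0) V := by
      rw [hcorr.symm.imageOf_eq hW hV]
      exact ⟨hs, right_ne_zero_of_mul h0⟩
    obtain ⟨p, hpV, hp0, hps⟩ := h1
    refine (hA q).2 ⟨s, (hpre s).2 ⟨p, hpV, by rwa [eval_X] at hp0, ?_, hps⟩, hq⟩
    -- The vertex r lies on its isotropic cone and so lifts into the tangent hyperplane at the south
    -- pole, which `h0` excludes.
    rintro rfl
    refine left_ne_zero_of_mul h0 ?_
    rw [hps.eval_eq_zero_iff (isHomogeneous_poleForm _), eval_eval_map,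
      toSphere_antipole r (one_pow 2), eval_affinePoint_coneForm]
  · obtain ⟨s, hs, hq'⟩ := (hA q).1 hq
    exact ⟨s, hsub hs, hq'⟩

theorem southPole_eq : southPole d = pole d (-1) := by
  have h := hasCoords_affinePoint (Fin.snoc (0 : Fin d → ℂ) (-1) : Fin (d + 1) → ℂ)
  refine h.unique_smul (hasCoords_pole (-1)) (c := 1) ?_
  rw [one_smul]
  funext i
  revert i
  rw [forall_fin_sphere]
  refine ⟨by rw [sphereVec_zero]; rfl, ?_, fun j => ?_⟩
  · rw [sphereVec_last, ← Fin.succ_last, Fin.cons_succ, Fin.snoc_last]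
  · rw [sphereVec_mid, ← Fin.succ_castSucc, Fin.cons_succ, Fin.snoc_castSucc]

theorem mem_northTangent {p : CP (d + 1)} :
    p ∈ northTangent d ↔ eval p.rep (poleForm d 1) = 0 := by
  rw [eval_poleForm, one_mul, sub_eq_zero]
  exact eq_comm

end SphericalCurve

namespace SphericalCurve

open MvPolynomial Filter

/-! ### Spherical curves and inversion -/

variable {d : ℕ}

theorem hasDegree_empty {n : ℕ} : HasDegree (∅ : Set (CP n)) 0 := by
  refine ⟨0, Eventually.of_forall fun t => ?_⟩
  rw [hilbertFunction_eq, hilbert_eq_zero fun f _ => ?_]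
  · simp
  · rw [mem_idealOf]
    exact fun p hp => absurd hp (Set.notMem_empty p)

theorem HasDegree.nonempty {n e : ℕ} {V : Set (CP n)} (h : HasDegree V e) (he : 0 < e) :
    V.Nonempty := by
  by_contra hcon
  rw [Set.not_nonempty_iff_eq_empty] at hcon
  subst hcon
  exact he.ne (hasDegree_empty.unique h)

theorem exists_natCast_of_add_eq {a b : ℕ} {x : ℕ∞} (h : (a : ℕ∞) = b + x) :
    ∃ c : ℕ, x = c ∧ a = b + c := by
  have hx : x ≠ ⊤ := by
    rintro rfl
    rw [add_top] at h
    exact ENat.natCast_ne_top _ h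
  lift x to ℕ using hx
  exact ⟨x, rfl, by exact_mod_cast h⟩

/-- The lift of a curve of positive spherical degree. -/
theorem HasSphericalDegree.lift_spec {V : Set (CP d)} {k : ℕ} (h : HasSphericalDegree V k)
    (hk : 0 < k) (r : Fin d → ℝ) :
    IsRealCurve (lift 1 (fun i => (r i : ℂ)) V) ∧
    HasDegree (lift 1 (fun i => (r i : ℂ)) V) (2 * k) ∧
    IsRegularOn (poleForm d 1) (lift 1 (fun i => (r i : ℂ)) V) ∧
    {q | q ∈ lift 1 (fun i => (r i : ℂ)) V ∧ eval q.rep (poleForm d 1) = 0}.Finite := by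
  obtain ⟨e, ℓ, he, hℓ, hke⟩ := h
  have h1 := SphericalCurve.lift_spec (σ := 1) (by norm_num) r hℓ.1 he
  rw [Complex.ofReal_one] at h1
  obtain ⟨hr, hg, hreg, hfin, N, E, hN, hE, hE0, hsum⟩ := h1
  -- The degree count becomes 2e = N + 2ℓ. Positivity of k is then used only to see that the lift is
  -- not empty.
  rw [(isSpherical_iff hℓ.1 he.hasLinearGrowth hE hE0).1 hℓ, ← Nat.cast_add,
    Nat.cast_inj] at hsum
  have hNk : N = 2 * k := by omega
  subst hNk
  exact ⟨hr.isRealCurve (hN.nonempty (by omega)) hg, hN, hreg, hfin⟩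

/-- The projection from a pole of a real curve on the sphere that has multiplicity `m` at the
pole. -/
theorem proj_isSpherical {σ : ℝ} (hσ : (σ : ℂ) ^ 2 = 1) (r : Fin d → ℝ) {V : Set (CP (d + 1))}
    (hV : IsRealCurve V) (hVs : V ⊆ unitSphere (d + 1)) {k m : ℕ} (hk : HasDegree V (2 * k))
    (hm : pointMult V (pole d σ) = m) :
    m ≤ k ∧ IsSpherical (k - m) (proj (σ : ℂ) (fun i => (r i : ℂ)) V) ∧
      HasDegree (proj (σ : ℂ) (fun i => (r i : ℂ)) V) (2 * k - m) ∧
      HasSphericalDegree (proj (σ : ℂ) (fun i => (r i : ℂ)) V) k := by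
  obtain ⟨hreg, hW, N, -, -, hN, -, hsum⟩ := proj_spec hσ r hV hVs hk
  rw [hm, ← Nat.cast_add, Nat.cast_inj] at hsum
  have hc := corr_proj hσ (fun i => (r i : ℂ)) hVs
  -- Lifting from the same pole with the same translation recovers the part of V off the tangent
  -- hyperplane, which is dense in V.
  have hlift : lift (σ : ℂ) (fun i => (r i : ℂ)) (proj (σ : ℂ) (fun i => (r i : ℂ)) V) = V := by
    rw [lift, hc.imageOf_eq hV.isClosed isClosed_closure]
    exact closure_setOf_ne_zero (isHomogeneous_poleForm _) hV.isClosed hreg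
  obtain ⟨-, -, -, -, N', E, hN', hE, hE0, hsum'⟩ := lift_spec hσ r hW hN
  rw [hlift] at hN'
  obtain rfl := hN'.unique hk
  -- From 2k = N + m and 2N = 2k + s, the total multiplicity on Σ_∞ is s = 2(k - m); that s is a
  -- natural number is what bounds m by k.
  obtain ⟨s, hs, hsum'⟩ := exists_natCast_of_add_eq hsum'
  have hmk : m ≤ k := by omega
  have hNm : N = 2 * k - m := by omega
  have hsph : IsSpherical (k - m) (proj (σ : ℂ) (fun i => (r i : ℂ)) V) := by
    rw [isSpherical_iff hW hN.hasLinearGrowth hE hE0, hs, Nat.cast_inj]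
    omega
  refine ⟨hmk, hsph, hNm ▸ hN, N, k - m, hN, hsph, ?_⟩
  omega

theorem toSphere_affinePoint {σ : ℂ} (hσ : σ ^ 2 = 1) (r : Fin d → ℂ) :
    (pole d (-σ)).HasCoords fun j => eval (affinePoint r).rep (toSphere σ r (X j)) := by
  have hp := hasCoords_affinePoint r
  have h0 : eval (affinePoint r).rep (X 0 : Coord d) ≠ 0 := by
    rw [ne_eq, hp.eval_eq_zero_iff (isHomogeneous_X _ _), eval_X, Fin.cons_zero]
    exact one_ne_zero
  have hvec := toSphere_vec_ne_zero hσ r h0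
  have hq := CP.hasCoords_mk _ hvec
  have hq' := HasCoords_map (isHomogeneous_toSphere σ r) hq hp
  convert hq using 1
  refine (hasCoords_pole (-σ)).unique_smul hq' (c := 1 / 2) ?_
  have hcone : eval (Fin.cons 1 r : Fin (d + 1) → ℂ) (coneForm r) = 0 := by
    rw [eval_coneForm]; simp
  funext i
  revert i
  rw [forall_fin_sphere]
  refine ⟨?_, ?_, fun j => ?_⟩
  · rw [toSphere_zero, Pi.smul_apply, sphereVec_zero]
    simp [hcone]
  · rw [toSphere_last, Pi.smul_apply, sphereVec_last]
    simp [hcone]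
    ring
  · rw [toSphere_mid, Pi.smul_apply, sphereVec_mid]
    simp

theorem pole_mem_lift_iff {r : Fin d → ℂ} {V : Set (CP d)} (hV : IsClosed V) :
    pole d (-1) ∈ lift 1 r V ↔ affinePoint r ∈ V := by
  have hc := corr_lift (one_pow 2) r V
  have h0 : eval (affinePoint r).rep (X 0 : Coord d) ≠ 0 := by
    rw [ne_eq, (hasCoords_affinePoint r).eval_eq_zero_iff (isHomogeneous_X _ _), eval_X,
      Fin.cons_zero]
    exact one_ne_zero
  have hpole := toSphere_affinePoint (one_pow 2) r
  constructor
  · intro h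
    have h1 : pole d (-1) ∈ imageOf (toSphere 1 r) (X 0) V := by
      rw [hc.symm.imageOf_eq isClosed_closure hV]
      exact ⟨h, hc.eval_ζ_ne_zero h0 hpole⟩
    obtain ⟨p, hp, hp0, hpq⟩ := h1
    have h2 := hc.hasCoords hp hp0 hpq
    have h3 := (corr_lift (one_pow 2) r Set.univ).hasCoords (Set.mem_univ _) h0 hpole
    exact h3.unique h2 ▸ hp
  · intro h
    exact hc.mem_of_mem isClosed_closure h h0 hpole

/-- The multiplicity of a curve at a point is that of its lift at the corresponding pole. -/
theorem pointMult_lift {r : Fin d → ℂ} {V : Set (CP d)} (hr : affinePoint r ∈ V)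
    {b : Fin d → ℂ} (hb : b ≠ 0) (hfin : pointMult (lift 1 r V) (pole d (-1)) ≠ ⊤)
    (hmin : pointMult (lift 1 r V) (pole d (-1)) = intersectionMult (lift 1 r V)
      (∑ j : Fin d, C (b j) * X j.succ.castSucc) (pole d (-1))) :
    pointMult V (affinePoint r) = pointMult (lift 1 r V) (pole d (-1)) := by
  have hc := corr_lift (one_pow 2) r V
  have hp := hasCoords_affinePoint r
  have h0 : eval (affinePoint r).rep (X 0 : Coord d) ≠ 0 := by
    rw [ne_eq, hp.eval_eq_zero_iff (isHomogeneous_X _ _), eval_X, Fin.cons_zero]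
    exact one_ne_zero
  have hpole := toSphere_affinePoint (one_pow 2) r
  have hX0 : (X 0 : Coord d) ∉ pointIdeal (affinePoint r) := by
    rwa [mem_pointIdeal_of_isHomogeneous (isHomogeneous_X _ _)]
  have hform : ∀ b : Fin d → ℂ, linearForm (Fin.cons (-∑ j, b j * r j) b : Fin (d + 1) → ℂ) =
      ∑ j : Fin d, C (b j) * (X j.succ - C (r j) * X 0) := by
    intro b
    rw [linearForm, Fin.sum_univ_succ]
    simp only [Fin.cons_zero, Fin.cons_succ, mul_sub, Finset.sum_sub_distrib, C_neg, map_sum,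
      C_mul, neg_mul, Finset.sum_mul, ← mul_assoc]
    ring
  have hloc : ∀ b : Fin d → ℂ, intersectionMult V (toSphere 1 r
      (∑ j : Fin d, C (b j) * X j.succ.castSucc)) (affinePoint r) =
      intersectionMult V (linearForm (Fin.cons (-∑ j, b j * r j) b : Fin (d + 1) → ℂ))
        (affinePoint r) := by
    intro b
    -- The pullback of a hyperplane through both poles is x₀ times a hyperplane through r, and x₀
    -- does not vanish at r.
    rw [toSphere_sum_mid, ← hform, intersectionMult_eq, intersectionMult_eq]
    refine locLength_congr (fun f hf => ⟨1, (Ideal.ne_top_iff_one _).1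
      (inferInstance : (pointIdeal (affinePoint r)).IsPrime).ne_top, ?_⟩)
      (fun f hf => ⟨X 0, hX0, ?_⟩)
    · rw [one_mul]
      have hle : Ideal.span {X 0 * linearForm (Fin.cons (-∑ j, b j * r j) b)} ≤
          Ideal.span {linearForm (Fin.cons (-∑ j, b j * r j) b : Fin (d + 1) → ℂ)} :=
        Ideal.span_singleton_le_span_singleton.2 (dvd_mul_left _ _)
      exact sup_le_sup_left hle (idealOf V) hf
    · obtain ⟨g, hg, y, hy, rfl⟩ := Submodule.mem_sup.1 hf
      obtain ⟨a, rfl⟩ := Ideal.mem_span_singleton'.1 hy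
      rw [mul_add]
      refine Ideal.add_mem _ (Ideal.mem_sup_left (Ideal.mul_mem_left _ _ hg))
        (Ideal.mem_sup_right (Ideal.mem_span_singleton'.2 ⟨a, by ring⟩))
  have hcmp : ∀ b : Fin d → ℂ,
      (intersectionMult V (linearForm (Fin.cons (-∑ j, b j * r j) b : Fin (d + 1) → ℂ))
        (affinePoint r) ≠ ⊤ ∨ intersectionMult (lift 1 r V)
          (∑ j : Fin d, C (b j) * X j.succ.castSucc) (pole d (-1)) ≠ ⊤) →
      intersectionMult V (linearForm (Fin.cons (-∑ j, b j * r j) b : Fin (d + 1) → ℂ))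
        (affinePoint r) = intersectionMult (lift 1 r V)
          (∑ j : Fin d, C (b j) * X j.succ.castSucc) (pole d (-1)) := by
    intro b hfin
    rw [← hloc] at hfin ⊢
    exact hc.locLength_eq hr h0 hpole (isHomogeneous_sum_mid b) hfin
  refine le_antisymm ?_ (le_iInf fun ⟨a, ha0, ha⟩ => ?_)
  · rw [hmin]
    rw [hmin] at hfin
    rw [← hcmp b (Or.inr hfin)]
    refine iInf_le (fun a : {a : Fin (d + 1) → ℂ // a ≠ 0 ∧
      eval (affinePoint r).rep (linearForm a) = 0} =>
        intersectionMult V (linearForm a.1) (affinePoint r))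
      ⟨Fin.cons (-∑ j, b j * r j) b, fun h => hb (funext fun j => congrFun h j.succ), ?_⟩
    rw [hp.eval_eq_zero_iff (isHomogeneous_linearForm _), eval_linearForm, Fin.sum_univ_succ]
    simp
  · rw [hp.eval_eq_zero_iff (isHomogeneous_linearForm _), eval_linearForm,
      Fin.sum_univ_succ] at ha
    simp only [Fin.cons_zero, Fin.cons_succ, mul_one] at ha
    have hab : a = Fin.cons (-∑ j, a (Fin.succ j) * r j) fun j => a j.succ := by
      funext i
      refine Fin.cases ?_ (fun j => rfl) i
      rw [Fin.cons_zero]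
      linear_combination ha
    -- The comparison `hcmp` needs one finite side; an infinite value satisfies the bound trivially.
    by_cases htop : intersectionMult V (linearForm a) (affinePoint r) = ⊤
    · change _ ≤ intersectionMult V (linearForm a) (affinePoint r)
      rw [htop]; exact le_top
    · change _ ≤ intersectionMult V (linearForm a) (affinePoint r)
      rw [hab] at htop ⊢
      rw [hcmp _ (Or.inl htop)]
      have hlin : linearForm (sphereVec 0 (fun j => a j.succ) 0) =
          ∑ j : Fin d, C (a j.succ) * X j.succ.castSucc := by
        rw [linearForm, sum_sphere]
        simp only [sphereVec_zero, sphereVec_last, sphereVec_mid]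
        simp
      rw [← hlin]
      refine iInf_le (fun a : {a : Fin (d + 2) → ℂ // a ≠ 0 ∧
        eval (pole d (-1)).rep (linearForm a) = 0} =>
          intersectionMult (lift 1 r V) (linearForm a.1) (pole d (-1)))
        ⟨sphereVec 0 (fun j => a j.succ) 0, fun h => ha0 ?_, ?_⟩
      · have h1 : ∀ j : Fin d, a j.succ = 0 := fun j => by
          have := congrFun h j.succ.castSucc
          rwa [sphereVec_mid] at this
        rw [hab]
        funext i
        refine Fin.cases ?_ (fun j => h1 j) i
        simp [h1]
      · rw [(hasCoords_pole (-1)).eval_eq_zero_iff (isHomogeneous_linearForm _), eval_linearForm,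
          sum_sphere]
        simp only [sphereVec_zero, sphereVec_last, sphereVec_mid]
        simp

/-- The inverse of a curve of positive spherical degree `k` in a point of multiplicity `m`. -/
theorem HasSphericalDegree.inverse_spec {V : Set (CP d)} {k : ℕ} (h : HasSphericalDegree V k)
    (hk : 0 < k) (r : Fin d → ℝ) :
    ∃ m : ℕ, m ≤ k ∧ IsSpherical (k - m) (inverse (fun i => (r i : ℂ)) V) ∧
      HasDegree (inverse (fun i => (r i : ℂ)) V) (2 * k - m) ∧
      HasSphericalDegree (inverse (fun i => (r i : ℂ)) V) k ∧
      (affinePoint (fun i => (r i : ℂ)) ∉ V → m = 0) ∧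
      (affinePoint (fun i => (r i : ℂ)) ∈ V →
        pointMult V (affinePoint fun i => (r i : ℂ)) = m) := by
  obtain ⟨hW, hdeg, hreg, -⟩ := h.lift_spec hk r
  have hVcl : IsClosed V := by
    obtain ⟨_, _, _, hs, _⟩ := h
    exact hs.1.isClosed
  have hs := lift_subset (one_pow 2) (fun i => (r i : ℂ)) V
  have hσ : ((-1 : ℝ) : ℂ) = -1 := by norm_num
  have hσ2 : ((-1 : ℝ) : ℂ) ^ 2 = 1 := by norm_num
  obtain ⟨hreg', -, N, b, hb, -, hmin, hsum⟩ := proj_spec hσ2 r hW hs hdeg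
  obtain ⟨m, hm, -⟩ := exists_natCast_of_add_eq hsum
  have hsph := proj_isSpherical hσ2 r hW hs hdeg hm
  rw [hσ] at hreg' hmin hm hsph
  -- The inverse is the projection of the lift from the south pole, so m is the multiplicity of the
  -- lift there.
  rw [← inverse_eq hVcl hreg hreg'] at hsph
  refine ⟨m, hsph.1, hsph.2.1, hsph.2.2.1, hsph.2.2.2, fun hr => ?_, fun hr => ?_⟩
  · have h1 : pole d (-1) ∉ lift 1 (fun i => (r i : ℂ)) V := fun h1 =>
      hr ((pole_mem_lift_iff hVcl).1 h1)
    rw [hmin, locLength_eq_zero_of_notMem hW.isClosed h1] at hm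
    exact_mod_cast hm.symm
  · rw [pointMult_lift hr hb (by rw [hm]; exact ENat.natCast_ne_top m) hmin, hm]

end SphericalCurve

end

/-! ### Assembly of the three statements. -/

theorem corollary2p6 (d k : ℕ) :
    (∀ δ : Set (CP d), HasSphericalDegree δ k → 0 < k →
      IsRealCurve (sphereLift δ) ∧ HasDegree (sphereLift δ) (2 * k) ∧
      sphereLift δ ⊆ unitSphere (d + 1) ∧ (sphereLift δ ∩ northTangent d).Finite) ∧
    (∀ (δ' : Set (CP (d + 1))) (m : ℕ),
      IsRealCurve δ' → HasDegree δ' (2 * k) → δ' ⊆ unitSphere (d + 1) →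
      (δ' ∩ northTangent d).Finite → pointMult δ' (southPole d) = m →
      m ≤ k ∧ IsSpherical (k - m) (reflectedProjection δ') ∧
      HasDegree (reflectedProjection δ') (2 * k - m) ∧
      HasSphericalDegree (reflectedProjection δ') k) ∧
    (∀ (δ : Set (CP d)) (r : Fin d → ℝ), HasSphericalDegree δ (k + 1) →
      HasSphericalDegree (inverse (fun i => (r i : ℂ)) δ) (k + 1) ∧
      (affinePoint (fun i => (r i : ℂ)) ∉ δ →
        IsSpherical (k + 1) (inverse (fun i => (r i : ℂ)) δ) ∧
        HasDegree (inverse (fun i => (r i : ℂ)) δ) (2 * k + 2)) ∧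
      (IsSmoothPoint δ (affinePoint (fun i => (r i : ℂ))) →
        IsSpherical k (inverse (fun i => (r i : ℂ)) δ) ∧
        HasDegree (inverse (fun i => (r i : ℂ)) δ) (2 * k + 1)) ∧
      (IsDoublePoint δ (affinePoint (fun i => (r i : ℂ))) →
        1 ≤ k ∧ IsSpherical (k - 1) (inverse (fun i => (r i : ℂ)) δ) ∧
        HasDegree (inverse (fun i => (r i : ℂ)) δ) (2 * k))) := by
  have hzero : (fun i => ((0 : Fin d → ℝ) i : ℂ)) = 0 := by funext i; simp
  refine ⟨fun δ hδ hk => ?_, fun δ' m hδ' hdeg hs _ hm => ?_, fun δ r hδ => ?_⟩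
  · have h := hδ.lift_spec hk 0
    rw [hzero] at h
    rw [sphereLift_eq]
    refine ⟨h.1, h.2.1, lift_subset (one_pow 2) 0 δ, h.2.2.2.subset fun q hq => ⟨hq.1, ?_⟩⟩
    exact mem_northTangent.1 hq.2
  · have hσ : ((-1 : ℝ) : ℂ) = -1 := by norm_num
    have hσ2 : ((-1 : ℝ) : ℂ) ^ 2 = 1 := by norm_num
    -- Regularity of the tangent form at the south pole shows that the points of δ' on that
    -- hyperplane do not affect the closure, so `reflectedProjection` is the projection from the
    -- south pole.
    have hreg := (proj_spec hσ2 0 hδ' hs hdeg).1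
    have h := proj_isSpherical hσ2 0 hδ' hs hdeg (by rw [hσ, ← southPole_eq]; exact hm)
    rw [hσ] at hreg
    rwa [hσ, hzero, ← reflectedProjection_eq hs hreg] at h
  · have hδ1 : HasSphericalDegree δ ((k + 1 : ℕ) : ℤ) := by exact_mod_cast hδ
    obtain ⟨m, hmk, hsph, hdeg, hsd, hm0, hm⟩ := hδ1.inverse_spec k.succ_pos r
    refine ⟨by exact_mod_cast hsd, fun hr => ?_, fun hr => ?_, fun hr => ?_⟩
    · obtain rfl := hm0 hr
      exact ⟨hsph, hdeg⟩
    · have h1 : m = 1 := by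
        have := hm hr.1
        rw [hr.pointMult_eq_one] at this
        exact_mod_cast this.symm
      subst h1
      exact ⟨hsph, hdeg⟩
    · have h2 : m = 2 := by
        have := hm hr.1
        rw [hr.2] at this
        exact_mod_cast this.symm
      subst h2
      exact ⟨by omega, hsph, hdeg⟩
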